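/- Let $\mathcal A\subset\mathbb R^n$ be a finite set of nonzero, pairwise noncollinear vectors with multiplicities $m_\alpha\in\mathbb Z_{\ge 0}$ $(\alpha\in\mathcal A)$, and put $|m|=\sum_{\alpha\in\mathcal A}m_\alpha$ and $\Pi_\alpha=\{x\in\mathbb R^n:(x,\alpha)=0\}$. Let $(x,y)=\sum_j x_jy_j$ denote also the complex bilinear extension of the standard inner product to $\mathbb C^n$, write $x^2=(x,x)$, and let $A_m(x)=\prod_{\alpha\in\mathcal A}(x,\alpha)^{m_\alpha}$ for $x\in\mathbb C^n$. Let $\phi:\mathbb C^n\times\mathbb C^n\to\mathbb C$ be a Baker–Akhiezer function of $(\mathcal A,m)$ in the original axiomatics, i.e. 1. $\phi(x,\lambda)=P(x,\lambda)e^{(x,\lambda)}$ where, for each $\lambda\in\mathbb C^n$, $P(\cdot,\lambda)$ is a polynomial in $x$ of degree at most $|m|$ whose homogeneous component of degree $|m|$ is $A_m(x)A_m(\lambda)$; 2. for all $\alpha\in\mathcal A$, $\lambda\in\mathbb C^n$ and $x\in\Pi_\alpha$, $$\partial_\alpha\phi(x,\lambda)=\partial_\alpha^3\phi(x,\lambda)=\cdots=\partial_\alpha^{2m_\alpha-1}\phi(x,\lambda)=0,\qquad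 \partial_\alpha=(\alpha,\partial/\partial x);$$ 3. for each $x\in\mathbb C^n$ the function $\lambda\mapsto\phi(x,\lambda)$ is continuous on $\mathbb C^n$. Then for all $\lambda,\mu\in\mathbb C^n$ and all $\xi\in\mathbb R^n\setminus\bigcup_{\alpha\in\mathcal A}\Pi_\alpha$ the following integral converges absolutely, and $$\int_{i\xi+\mathbb R^n}\frac{\phi(-ix,\lambda)\,\phi(ix,\mu)}{A_m(x)^2}\,d\gamma(x)=e^{-(\lambda^2+\mu^2)/2}\,\phi(\lambda,\mu),\qquad d\gamma(x)=(2\pi)^{-n/2}e^{-x^2/2}\,dx,$$ where $\int_{i\xi+\mathbb R^n}f(x)\,dx$ means $\int_{\mathbb R^n}f(i\xi+y)\,dy$ with Lebesgue measure $dy$. -/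

import Mathlib

open MeasureTheory

namespace BakerAkhiezer

variable {n : ℕ}

/-- The complexification of a real vector: the inclusion of `ℝⁿ` in `ℂⁿ`. -/
def toComplex (v : Fin n → ℝ) : Fin n → ℂ := fun j => (v j : ℂ)

/-- The complex bilinear (not sesquilinear) extension `(x, y) = ∑ⱼ xⱼ yⱼ` to `ℂⁿ` of the standard
inner product of `ℝⁿ`; in particular `x² = bilin x x`. -/
def bilin (x y : Fin n → ℂ) : ℂ := ∑ j, x j * y j

/-- The hyperplane `Π_α = {x ∈ ℝⁿ : (x, α) = 0}`. -/
def hyperplane (α : Fin n → ℝ) : Set (Fin n → ℝ) := {x | ∑ j, x j * α j = 0}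

/-- `|m| = ∑_{α ∈ 𝒜} m_α`. -/
def totalMult (𝒜 : Finset (Fin n → ℝ)) (m : (Fin n → ℝ) → ℕ) : ℕ := ∑ α ∈ 𝒜, m α

/-- The function `A_m(x) = ∏_{α ∈ 𝒜} (x, α)^{m_α}` on `ℂⁿ`. -/
def Am (𝒜 : Finset (Fin n → ℝ)) (m : (Fin n → ℝ) → ℕ) (x : Fin n → ℂ) : ℂ :=
  ∏ α ∈ 𝒜, bilin x (toComplex α) ^ m α

/-- `A_m` as a polynomial in the coordinates of `x`. -/
noncomputable def AmPoly (𝒜 : Finset (Fin n → ℝ)) (m : (Fin n → ℝ) → ℕ) :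
    MvPolynomial (Fin n) ℂ :=
  ∏ α ∈ 𝒜, (∑ j, MvPolynomial.X j * MvPolynomial.C (α j : ℂ)) ^ m α

theorem eval_AmPoly (𝒜 : Finset (Fin n → ℝ)) (m : (Fin n → ℝ) → ℕ) (x : Fin n → ℂ) :
    MvPolynomial.eval x (AmPoly 𝒜 m) = Am 𝒜 m x := by
  simp [AmPoly, Am, bilin, toComplex, map_prod]

/-- The iterated directional derivative `∂_α^k f (x)`, where `∂_α = (α, ∂/∂x)`, of a function of
complex variables: the `k`-th complex derivative of `t ↦ f (x + t α)` at `t = 0`. -/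
noncomputable def dirDeriv (k : ℕ) (α : Fin n → ℝ) (f : (Fin n → ℂ) → ℂ) (x : Fin n → ℂ) : ℂ :=
  iteratedDeriv k (fun t : ℂ => f (x + t • toComplex α)) 0

/-- `φ(x, lam)` is a (rational) Baker-Akhiezer function, in the original axiomatics, of the
collection `𝒜` with multiplicities `m`. -/
structure IsBakerAkhiezer (𝒜 : Finset (Fin n → ℝ)) (m : (Fin n → ℝ) → ℕ)
    (φ : (Fin n → ℂ) → (Fin n → ℂ) → ℂ) : Prop where
  /-- `φ(x, lam) = P(x, lam) e^{(x, lam)}` where `P` is polynomial in `x`, with highest degree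
  term `A_m(x) A_m(lam)`: the terms of degree greater than `|m|` vanish, and those of degree `|m|`
  add up to `A_m(x) A_m(lam)`. -/
  form : ∀ lam : Fin n → ℂ, ∃ P : MvPolynomial (Fin n) ℂ,
    P.totalDegree ≤ totalMult 𝒜 m ∧
    MvPolynomial.homogeneousComponent (totalMult 𝒜 m) P
      = MvPolynomial.C (Am 𝒜 m lam) * AmPoly 𝒜 m ∧
    ∀ x : Fin n → ℂ, φ x lam = MvPolynomial.eval x P * Complex.exp (bilin x lam)
  /-- `∂_α φ = ∂_α³ φ = ⋯ = ∂_α^{2 m_α - 1} φ = 0` on `Π_α`, for every `α ∈ 𝒜`. -/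
  quasiInvariant : ∀ α ∈ 𝒜, ∀ k < m α, ∀ x ∈ hyperplane α, ∀ lam : Fin n → ℂ,
    dirDeriv (2 * k + 1) α (fun z => φ z lam) (toComplex x) = 0
  /-- Continuous dependence on the spectral parameter. Where `A_m(lam) ≠ 0` the two conditions
  above determine `φ(·, lam)`; this one determines it for the remaining values of `lam`. -/
  continuous_param : ∀ x : Fin n → ℂ, Continuous (φ x)

/-- The point `iξ + y` of the real affine subspace `iξ + ℝⁿ` of `ℂⁿ`. -/
noncomputable def contour (ξ y : Fin n → ℝ) : Fin n → ℂ :=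
  Complex.I • toComplex ξ + toComplex y

/-- The density `(2π)^{-n/2} e^{-x²/2}` of the Gaussian measure `γ`, at `x ∈ ℂⁿ`. -/
noncomputable def gaussDensity (x : Fin n → ℂ) : ℂ :=
  (((2 * Real.pi) ^ (-(n : ℝ) / 2) : ℝ) : ℂ) * Complex.exp (-bilin x x / 2)

/-- The integrand `φ(-ix, lam) φ(ix, mu) / A_m(x)²` times the density of `γ`. -/
noncomputable def integrand (𝒜 : Finset (Fin n → ℝ)) (m : (Fin n → ℝ) → ℕ)
    (φ : (Fin n → ℂ) → (Fin n → ℂ) → ℂ) (lam mu x : Fin n → ℂ) : ℂ :=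
  φ (-Complex.I • x) lam * φ (Complex.I • x) mu / Am 𝒜 m x ^ 2 * gaussDensity x

end BakerAkhiezer

namespace BakerAkhiezer

/-! Multiplied by e^{(λ²+μ²)/2 - (λ,μ)}, the integral (`normInt`) is shown to be the polynomial
factor of φ(·, μ) evaluated at λ. For μ off all hyperplanes that factor is the only polynomial of
degree at most |m| with top part A_m(μ) A_m that is quasi-invariant with parameter μ
(`IsFactor.eq`). So the normalised integral only has to be a polynomial in λ with these properties;
the remaining μ follow by continuity.

Uniqueness is a zero count. For γ ≠ 0 the N-th derivative at 0 of q(t)e^{γt} is γ^N times a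
polynomial in N of degree at most deg q, so more than deg q vanishing derivatives force q = 0. Hence
the top component of a quasi-invariant polynomial vanishes to order m_α on every Π_α, is divisible
by A_m, and has degree at least |m| unless it is zero (`eq_zero_of_quasiInv`). Cramer's rule
together with continuity in λ then makes the coefficients of the factor P(x, λ) polynomial in λ
(`IsBakerAkhiezer.exists_polynomial`).

Quasi-invariance also holds in the spectral variable (`quasiInv_atPoint`). For x and λ orthogonal to
α, consider P(x + tα, λ + cα)e^{(α,α)tc}. With the difference of the exponents of t and c fixed, its
coefficients are again derivatives of a polynomial times an exponential, now in the variable tc; the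
same zero count shows that the Taylor coefficients of order 1, 3, ..., 2m_α - 1 in c vanish. A
by-product is that B = ∏_{β≠α}(x, β)^{m_β} has vanishing odd normal derivatives of order below 2m_α
on Π_α.

The integral does not depend on ξ (`IsAdmissible.integral_eq`). Inside a chamber this is holomorphy.
Across Π_α the jump is the integral of the kernel minus its reflection. Its numerator f(x)B(σx)² -
f(σx)B(x)² vanishes to order 2m_α, cancelling the pole, so the jump tends to the integral of a
function odd under the reflection, which is zero.

Completing the square by x = w + i(μ - λ) removes all exponentials from the normalised integral
except the Gaussian. Since the contour may be chosen afresh for each λ, a bounded displacement keeps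
A_m away from zero, which gives polynomial growth in λ, hence a polynomial by Liouville
(`IsModel.exists_normInt_eq_eval`). Letting λ go to infinity along rays gives the top part
(`IsModel.tendsto_normInt`), and quasi-invariance in λ is inherited from φ(-ix, λ) under the
integral (`IsModel.quasiInv_normInt`). -/

/-! ### Derivatives at 0 of a polynomial times an exponential -/

/-- The `N`-th derivative at `0` of `t ↦ q(t) e^{γ t}`, as a linear functional of `q`. -/
noncomputable def expDeriv (N : ℕ) (γ : ℂ) : Polynomial ℂ →ₗ[ℂ] ℂ :=
  ∑ j ∈ Finset.range (N + 1), ((N.descFactorial j : ℂ) * γ ^ (N - j)) • Polynomial.lcoeff ℂ j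

theorem expDeriv_apply (N : ℕ) (γ : ℂ) (q : Polynomial ℂ) :
    expDeriv N γ q
      = ∑ j ∈ Finset.range (N + 1), (N.descFactorial j : ℂ) * γ ^ (N - j) * q.coeff j := by
  simp [expDeriv]

theorem iteratedDeriv_polynomial_eval (q : Polynomial ℂ) (N : ℕ) :
    iteratedDeriv N (fun t : ℂ => q.eval t) 0 = N.factorial * q.coeff N := by
  have h : ∀ (N : ℕ) (q : Polynomial ℂ), iteratedDeriv N (fun t : ℂ => q.eval t)
      = fun t => ((Polynomial.derivative)^[N] q).eval t := by
    intro N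
    induction N with
    | zero => intro q; simp
    | succ N ih =>
      intro q
      rw [iteratedDeriv_succ']
      have : deriv (fun t : ℂ => q.eval t) = fun t => (Polynomial.derivative q).eval t := by
        ext t; exact q.deriv
      rw [this, ih, Function.iterate_succ_apply]
  rw [h]
  beta_reduce
  rw [← Polynomial.coeff_zero_eq_eval_zero, Polynomial.coeff_iterate_derivative]
  simp [Nat.descFactorial_self]

theorem iteratedDeriv_exp_affine (a γ : ℂ) (N : ℕ) :
    iteratedDeriv N (fun t : ℂ => Complex.exp (a + t * γ)) 0 = γ ^ N * Complex.exp a := by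
  have h : iteratedDeriv N (fun t : ℂ => Complex.exp (a + t * γ))
      = fun t => γ ^ N * Complex.exp (a + t * γ) := by
    induction N with
    | zero => simp
    | succ N ih =>
      rw [iteratedDeriv_succ, ih]
      ext t
      have h1 : HasDerivAt (fun t : ℂ => a + t * γ) γ t := by
        simpa using ((hasDerivAt_id t).mul_const γ).const_add a
      rw [((h1.cexp).const_mul (γ ^ N)).deriv]
      ring
  rw [h]; simp

theorem iteratedDeriv_polynomial_mul_exp (q : Polynomial ℂ) (a γ : ℂ) (N : ℕ) :
    iteratedDeriv N (fun t : ℂ => q.eval t * Complex.exp (a + t * γ)) 0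
      = Complex.exp a * expDeriv N γ q := by
  rw [iteratedDeriv_fun_mul, expDeriv_apply, Finset.mul_sum]
  · refine Finset.sum_congr rfl fun j _ => ?_
    rw [iteratedDeriv_polynomial_eval, iteratedDeriv_exp_affine,
      Nat.descFactorial_eq_factorial_mul_choose]
    push_cast; ring
  · exact q.differentiable.contDiff.contDiffAt
  · fun_prop

/-- The system is triangular: the derivative of order N involves the coefficients up to N, the last
one with factor N!. -/
theorem eq_zero_of_expDeriv_eq_zero (γ : ℂ) (q : Polynomial ℂ) (h : ∀ N, expDeriv N γ q = 0) :
    q = 0 := by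
  ext N
  induction N using Nat.strong_induction_on with
  | _ N ih =>
    have := h N
    rw [expDeriv_apply, Finset.sum_range_succ, Finset.sum_eq_zero, zero_add,
      Nat.descFactorial_self, Nat.sub_self, pow_zero, mul_one] at this
    · simpa [Nat.factorial_ne_zero] using this
    · intro j hj
      rw [ih j (Finset.mem_range.1 hj)]; simp

/-- The polynomial interpolating `N ↦ γ^{-N} expDeriv N γ q`. -/
noncomputable def newton (d : ℕ) (γ : ℂ) (q : Polynomial ℂ) : Polynomial ℂ :=
  ∑ j ∈ Finset.range (d + 1), Polynomial.C (q.coeff j * γ⁻¹ ^ j) * descPochhammer ℂ j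

theorem natDegree_newton_le (d : ℕ) (γ : ℂ) (q : Polynomial ℂ) : (newton d γ q).natDegree ≤ d := by
  refine Polynomial.natDegree_sum_le_of_forall_le _ _ fun j hj => ?_
  refine (Polynomial.natDegree_C_mul_le _ _).trans ?_
  rw [descPochhammer_natDegree]
  exact Nat.lt_succ_iff.1 (Finset.mem_range.1 hj)

theorem coeff_newton (d : ℕ) (γ : ℂ) (q : Polynomial ℂ) :
    (newton d γ q).coeff d = q.coeff d * γ⁻¹ ^ d := by
  rw [newton, Polynomial.finsetSum_coeff, Finset.sum_range_succ, Finset.sum_eq_zero, zero_add,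
    Polynomial.coeff_C_mul]
  · have : (descPochhammer ℂ d).coeff d = 1 := by
      have := (monic_descPochhammer ℂ d).coeff_natDegree
      rwa [descPochhammer_natDegree] at this
    rw [this, mul_one]
  · intro j hj
    rw [Polynomial.coeff_C_mul,
      Polynomial.coeff_eq_zero_of_natDegree_lt (p := descPochhammer ℂ j), mul_zero]
    rw [descPochhammer_natDegree]
    exact Finset.mem_range.1 hj

/-- After division by γ^N the derivative of order N depends on N only through falling factorials.
Vanishing derivatives thus become roots of a polynomial of degree at most d, which is the source of
every zero count below. -/
theorem eval_newton {d : ℕ} {γ : ℂ} (hγ : γ ≠ 0) {q : Polynomial ℂ} (hq : q.natDegree ≤ d)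
    (N : ℕ) : γ ^ N * (newton d γ q).eval (N : ℂ) = expDeriv N γ q := by
  have key : ∀ j, γ ^ N * (Polynomial.C (q.coeff j * γ⁻¹ ^ j) * descPochhammer ℂ j).eval (N : ℂ)
      = (N.descFactorial j : ℂ) * γ ^ (N - j) * q.coeff j := by
    intro j
    rw [Polynomial.eval_mul, Polynomial.eval_C, descPochhammer_eval_eq_descFactorial]
    rcases lt_or_ge N j with h | h
    · simp [Nat.descFactorial_eq_zero_iff_lt.2 h]
    · rw [pow_sub₀ _ hγ h, inv_pow]; ring
  rw [newton, Polynomial.eval_finsetSum, Finset.mul_sum, expDeriv_apply,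
    Finset.sum_congr rfl fun j _ => key j]
  rcases le_total d N with h | h
  · refine Finset.sum_subset (Finset.range_mono (by omega)) fun j _ hj => ?_
    rw [Polynomial.coeff_eq_zero_of_natDegree_lt, mul_zero]
    simp at hj; omega
  · symm
    refine Finset.sum_subset (Finset.range_mono (by omega)) fun j _ hj => ?_
    rw [Nat.descFactorial_eq_zero_iff_lt.2]
    · simp
    · simpa [Nat.lt_succ_iff, Nat.succ_le_iff] using hj

/-- A polynomial of degree at most `d` vanishes as soon as more than `d` of the derivatives at `0`
of `t ↦ q(t) e^{γ t}` do. -/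
theorem eq_zero_of_card_expDeriv {d : ℕ} {γ : ℂ} (hγ : γ ≠ 0) {q : Polynomial ℂ}
    (hq : q.natDegree ≤ d) (S : Finset ℕ) (hS : d < S.card) (h : ∀ i ∈ S, expDeriv i γ q = 0) :
    q = 0 := by
  have h0 : newton d γ q = 0 := by
    refine Polynomial.eq_zero_of_natDegree_lt_card_of_eval_eq_zero' _
      (S.map ⟨fun i : ℕ => (i : ℂ), Nat.cast_injective⟩) ?_ ?_
    · intro z hz
      obtain ⟨i, hi, rfl⟩ := Finset.mem_map.1 hz
      have := h i hi
      rw [← eval_newton hγ hq] at this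
      simpa [hγ] using this
    · rw [Finset.card_map]
      exact (natDegree_newton_le d γ q).trans_lt hS
  refine eq_zero_of_expDeriv_eq_zero γ q fun N => ?_
  rw [← eval_newton hγ hq, h0]; simp

/-- The constant `∏_{k < m} (-(2 * k + 1))`. -/
noncomputable def oddProd (m : ℕ) : ℂ := ∏ k ∈ Finset.range m, (-((2 * k + 1 : ℕ) : ℂ))

theorem oddProd_ne_zero (m : ℕ) : oddProd m ≠ 0 :=
  Finset.prod_ne_zero_iff.2 fun k _ => neg_ne_zero.2 (Nat.cast_ne_zero.2 (by omega))

theorem card_odds (m : ℕ) :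
    ((Finset.range m).map ⟨fun k => 2 * k + 1, fun a b h => by simpa using h⟩).card = m := by
  simp

theorem eq_zero_of_expDeriv_odd {m : ℕ} {γ : ℂ} (hγ : γ ≠ 0) {q : Polynomial ℂ} {d : ℕ}
    (hd : d < m) (hq : q.natDegree ≤ d) (h : ∀ k < m, expDeriv (2 * k + 1) γ q = 0) : q = 0 := by
  refine eq_zero_of_card_expDeriv hγ hq _ ((card_odds m).symm ▸ hd) ?_
  intro i hi
  obtain ⟨k, hk, rfl⟩ := Finset.mem_map.1 hi
  exact h k (Finset.mem_range.1 hk)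

/-- The interpolating polynomial has degree at most m and the m roots 1, 3, ..., 2m - 1, so it is
its coefficient of degree m times ∏(X - (2k+1)). Its value at N = 0 is the constant coefficient of
q. -/
theorem coeff_zero_of_expDeriv_odd {m : ℕ} {γ : ℂ} (hγ : γ ≠ 0) {q : Polynomial ℂ}
    (hq : q.natDegree ≤ m) (h : ∀ k < m, expDeriv (2 * k + 1) γ q = 0) :
    q.coeff 0 * γ ^ m = q.coeff m * oddProd m := by
  set R : Polynomial ℂ := ∏ k ∈ Finset.range m, (Polynomial.X - Polynomial.C ((2 * k + 1 : ℕ) : ℂ))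
    with hR
  have hRm : R.Monic := Polynomial.monic_prod_of_monic _ _ fun k _ => Polynomial.monic_X_sub_C _
  have hRd : R.natDegree = m := by
    rw [hR, Polynomial.natDegree_prod_of_monic _ _ fun k _ => Polynomial.monic_X_sub_C _]
    simp only [Polynomial.natDegree_X_sub_C, Finset.sum_const, Finset.card_range, smul_eq_mul,
      mul_one]
  have h0 : newton m γ q - Polynomial.C (q.coeff m * γ⁻¹ ^ m) * R = 0 := by
    by_contra hne
    have hle : (newton m γ q - Polynomial.C (q.coeff m * γ⁻¹ ^ m) * R).natDegree ≤ m :=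
      (Polynomial.natDegree_sub_le _ _).trans (max_le (natDegree_newton_le m γ q)
        ((Polynomial.natDegree_C_mul_le _ _).trans hRd.le))
    have hc : (newton m γ q - Polynomial.C (q.coeff m * γ⁻¹ ^ m) * R).coeff m = 0 := by
      have : R.coeff m = 1 := by rw [← hRd]; exact hRm.coeff_natDegree
      rw [Polynomial.coeff_sub, coeff_newton, Polynomial.coeff_C_mul, this]; ring
    have hlt : (newton m γ q - Polynomial.C (q.coeff m * γ⁻¹ ^ m) * R).natDegree < m := by
      refine lt_of_le_of_ne hle fun he => hne ?_
      rw [← Polynomial.leadingCoeff_eq_zero, Polynomial.leadingCoeff, he, hc]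
    refine hne (Polynomial.eq_zero_of_natDegree_lt_card_of_eval_eq_zero' _
      ((Finset.range m).map ⟨fun k : ℕ => ((2 * k + 1 : ℕ) : ℂ), fun a b h => ?_⟩) ?_ ?_)
    · have := Nat.cast_injective (R := ℂ) h
      omega
    · intro z hz
      obtain ⟨k, hk, rfl⟩ := Finset.mem_map.1 hz
      have h1 := h k (Finset.mem_range.1 hk)
      rw [← eval_newton hγ hq] at h1
      have h2 : (newton m γ q).eval ((2 * k + 1 : ℕ) : ℂ) = 0 := by
        rcases mul_eq_zero.1 h1 with h3 | h3
        · exact absurd h3 (pow_ne_zero _ hγ)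
        · exact h3
      have h3 : R.eval ((2 * k + 1 : ℕ) : ℂ) = 0 := by
        rw [hR, Polynomial.eval_prod]
        refine Finset.prod_eq_zero hk ?_
        simp
      change Polynomial.eval ((2 * k + 1 : ℕ) : ℂ) _ = 0
      rw [Polynomial.eval_sub, Polynomial.eval_mul, h2, h3]
      simp
    · simpa using hlt
  have h1 : (newton m γ q).eval ((0 : ℕ) : ℂ) = q.coeff 0 := by
    have := eval_newton hγ hq 0
    simpa [expDeriv_apply] using this
  have h2 : R.eval ((0 : ℕ) : ℂ) = oddProd m := by
    simp [hR, Polynomial.eval_prod, oddProd]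
  have h3 := congrArg (Polynomial.eval ((0 : ℕ) : ℂ)) h0
  rw [Polynomial.eval_sub, Polynomial.eval_mul, Polynomial.eval_C, h1, h2, Polynomial.eval_zero,
    sub_eq_zero] at h3
  rw [h3, inv_pow]
  field_simp

/-! ### Restriction of polynomials to lines -/

/-- The polynomial `t ↦ Q(x + t v)`. -/
noncomputable def line (x v : Fin n → ℂ) : MvPolynomial (Fin n) ℂ →ₐ[ℂ] Polynomial ℂ :=
  MvPolynomial.aeval fun j => Polynomial.C (x j) + Polynomial.C (v j) * Polynomial.X

/-- The polynomial `t ↦ Q(X + t v)` with coefficients depending polynomially on `X`. -/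
noncomputable def lineMv (v : Fin n → ℂ) :
    MvPolynomial (Fin n) ℂ →ₐ[ℂ] Polynomial (MvPolynomial (Fin n) ℂ) :=
  MvPolynomial.aeval fun j =>
    Polynomial.C (MvPolynomial.X j) + Polynomial.C (MvPolynomial.C (v j)) * Polynomial.X

theorem eval_line (x v : Fin n → ℂ) (Q : MvPolynomial (Fin n) ℂ) (t : ℂ) :
    (line x v Q).eval t = MvPolynomial.eval (x + t • v) Q := by
  have : (Polynomial.evalRingHom t).comp (line x v : MvPolynomial (Fin n) ℂ →+* Polynomial ℂ)
      = MvPolynomial.eval (x + t • v) := by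
    refine MvPolynomial.ringHom_ext (fun c => ?_) fun j => ?_
    · simp [line, Polynomial.algebraMap_eq]
    · simp [line, -Polynomial.X_mul_C]
      ring
  exact congrArg (fun f => f Q) this

theorem line_eq_map_lineMv (x v : Fin n → ℂ) (Q : MvPolynomial (Fin n) ℂ) :
    line x v Q = (lineMv v Q).map (MvPolynomial.eval x) := by
  have : (line x v : MvPolynomial (Fin n) ℂ →+* Polynomial ℂ)
      = (Polynomial.mapRingHom (MvPolynomial.eval x)).comp
        (lineMv v : MvPolynomial (Fin n) ℂ →+* _) := by
    refine MvPolynomial.ringHom_ext (fun c => ?_) fun j => ?_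
    · have h : algebraMap ℂ (Polynomial (MvPolynomial (Fin n) ℂ)) c
          = Polynomial.C (MvPolynomial.C c) := rfl
      simp [line, lineMv, Polynomial.algebraMap_eq, h]
    · simp [line, lineMv]
  exact congrArg (fun f => f Q) this

theorem coeff_line (x v : Fin n → ℂ) (Q : MvPolynomial (Fin n) ℂ) (i : ℕ) :
    (line x v Q).coeff i = MvPolynomial.eval x ((lineMv v Q).coeff i) := by
  rw [line_eq_map_lineMv, Polynomial.coeff_map]

theorem coeff_zero_line (x v : Fin n → ℂ) (Q : MvPolynomial (Fin n) ℂ) :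
    (line x v Q).coeff 0 = MvPolynomial.eval x Q := by
  rw [Polynomial.coeff_zero_eq_eval_zero, eval_line]; simp

theorem natDegree_line_le (x v : Fin n → ℂ) (Q : MvPolynomial (Fin n) ℂ) :
    (line x v Q).natDegree ≤ Q.totalDegree := by
  rw [line, MvPolynomial.aeval_def, MvPolynomial.eval₂_eq]
  refine Polynomial.natDegree_sum_le_of_forall_le _ _ fun d hd => ?_
  rw [Polynomial.algebraMap_eq]
  refine (Polynomial.natDegree_C_mul_le _ _).trans ?_
  refine (Polynomial.natDegree_prod_le _ _).trans ?_
  refine le_trans ?_ (MvPolynomial.le_totalDegree hd)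
  refine Finset.sum_le_sum fun j _ => ?_
  refine (Polynomial.natDegree_pow_le).trans ?_
  refine (Nat.mul_le_mul_left _ (?_ : _ ≤ 1)).trans (mul_one _).le
  compute_degree

theorem eval_smul_of_isHomogeneous {Q : MvPolynomial (Fin n) ℂ} {N : ℕ} (hQ : Q.IsHomogeneous N)
    (s : ℂ) (x : Fin n → ℂ) :
    MvPolynomial.eval (s • x) Q = s ^ N * MvPolynomial.eval x Q := by
  rw [MvPolynomial.eval_eq, MvPolynomial.eval_eq, Finset.mul_sum]
  refine Finset.sum_congr rfl fun d hd => ?_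
  have : N = ∑ j ∈ d.support, d j := by
    have := hQ.degree_eq_sum_deg_support hd
    simpa [Finsupp.degree] using this
  simp only [Pi.smul_apply, smul_eq_mul, mul_pow, Finset.prod_mul_distrib]
  rw [Finset.prod_pow_eq_pow_sum, ← this]; ring

theorem coeff_line_smul {Q : MvPolynomial (Fin n) ℂ} {N : ℕ} (hQ : Q.IsHomogeneous N)
    {s : ℂ} (hs : s ≠ 0) (x v : Fin n → ℂ) {i : ℕ} (hi : i ≤ N) :
    (line (s • x) v Q).coeff i = s ^ (N - i) * (line x v Q).coeff i := by
  have : line (s • x) v Q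
      = Polynomial.C (s ^ N) * (line x v Q).comp (Polynomial.C s⁻¹ * Polynomial.X) := by
    refine Polynomial.funext fun t => ?_
    rw [eval_line, Polynomial.eval_mul, Polynomial.eval_C, Polynomial.eval_comp, eval_line,
      ← eval_smul_of_isHomogeneous hQ]
    congr 2
    ext j
    simp; field_simp
  rw [this, Polynomial.coeff_C_mul, Polynomial.comp_C_mul_X_coeff, pow_sub₀ _ hs hi, inv_pow]
  ring

theorem coeff_line_eq_zero {Q : MvPolynomial (Fin n) ℂ} {N : ℕ} (hQ : Q.totalDegree ≤ N)
    (x v : Fin n → ℂ) {i : ℕ} (hi : N < i) : (line x v Q).coeff i = 0 :=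
  Polynomial.coeff_eq_zero_of_natDegree_lt
    (((natDegree_line_le x v Q).trans hQ).trans_lt hi)

/-- The part of `t ↦ Q(x + t v)` that is homogeneous of degree `D` in `x`. -/
noncomputable def diagPoly (Q : MvPolynomial (Fin n) ℂ) (x v : Fin n → ℂ) (D : ℕ) :
    Polynomial ℂ :=
  ∑ i ∈ Finset.range (Q.totalDegree + 1), Polynomial.monomial i
    ((line x v (MvPolynomial.homogeneousComponent (D + i) Q)).coeff i)

theorem coeff_diagPoly (Q : MvPolynomial (Fin n) ℂ) (x v : Fin n → ℂ) (D i : ℕ) :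
    (diagPoly Q x v D).coeff i
      = (line x v (MvPolynomial.homogeneousComponent (D + i) Q)).coeff i := by
  rw [diagPoly, Polynomial.finsetSum_coeff]
  simp only [Polynomial.coeff_monomial]
  rw [Finset.sum_ite_eq']
  split_ifs with h
  · rfl
  · rw [MvPolynomial.homogeneousComponent_eq_zero]
    · simp
    · simp at h; omega

theorem natDegree_diagPoly_le {Q : MvPolynomial (Fin n) ℂ} {N : ℕ} (hQ : Q.totalDegree ≤ N)
    (x v : Fin n → ℂ) (D : ℕ) : (diagPoly Q x v D).natDegree ≤ N - D := by
  refine Polynomial.natDegree_le_iff_coeff_eq_zero.2 fun i hi => ?_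
  rw [coeff_diagPoly, MvPolynomial.homogeneousComponent_eq_zero]
  · simp
  · omega

/-- The coefficient of t^i in the component of degree N has degree N - i in the base point, so the
part of degree D in x gathers the components with N = D + i. -/
theorem line_smul_eq_sum (Q : MvPolynomial (Fin n) ℂ) (x v : Fin n → ℂ) {s : ℂ} (hs : s ≠ 0) :
    line (s • x) v Q = ∑ D ∈ Finset.range (Q.totalDegree + 1), s ^ D • diagPoly Q x v D := by
  ext i
  rw [Polynomial.finsetSum_coeff]
  simp only [Polynomial.coeff_smul, coeff_diagPoly, smul_eq_mul]
  set M := Q.totalDegree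
  set f : ℕ → ℂ := fun N =>
    (line (s • x) v (MvPolynomial.homogeneousComponent N Q)).coeff i with hf
  have h1 : (line (s • x) v Q).coeff i = ∑ N ∈ Finset.range (M + 1), f N := by
    conv_lhs => rw [← MvPolynomial.sum_homogeneousComponent Q]
    rw [map_sum, Polynomial.finsetSum_coeff]
  have h2 : ∑ N ∈ Finset.range (M + 1), f N = ∑ N ∈ Finset.range (i + (M + 1)), f N := by
    refine Finset.sum_subset (Finset.range_mono (by omega)) fun N _ hN => ?_
    simp only [hf]
    rw [MvPolynomial.homogeneousComponent_eq_zero]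
    · simp
    · simp at hN; omega
  rw [h1, h2, Finset.sum_range_add, Finset.sum_eq_zero, zero_add]
  · refine Finset.sum_congr rfl fun D _ => ?_
    simp only [hf]
    rw [coeff_line_smul (MvPolynomial.homogeneousComponent_isHomogeneous _ _) hs _ _ (by omega),
      Nat.add_sub_cancel_left, add_comm i D]
  · intro N hN
    exact coeff_line_eq_zero
      (MvPolynomial.homogeneousComponent_isHomogeneous _ _).totalDegree_le _ _ (Finset.mem_range.1 hN)

theorem polynomial_eq_zero_of_real {p : Polynomial ℂ}
    (h : ∀ s : ℝ, s ≠ 0 → p.eval (s : ℂ) = 0) : p = 0 := by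
  refine Polynomial.eq_zero_of_infinite_isRoot p ?_
  refine Set.Infinite.mono (s := (fun s : ℝ => (s : ℂ)) '' {s | s ≠ 0}) ?_ ?_
  · rintro _ ⟨s, hs, rfl⟩
    exact h s hs
  · refine Set.Infinite.image Complex.ofReal_injective.injOn ?_
    exact (Set.finite_singleton (0 : ℝ)).infinite_compl

theorem mvPolynomial_eq_zero_of_real {p : MvPolynomial (Fin n) ℂ}
    (h : ∀ x : Fin n → ℝ, MvPolynomial.eval (toComplex x) p = 0) : p = 0 := by
  refine MvPolynomial.funext_set (fun _ => Set.range ((↑) : ℝ → ℂ))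
    (fun _ => Set.infinite_range_of_injective Complex.ofReal_injective) fun x hx => ?_
  choose y hy using fun i => hx i (Set.mem_univ i)
  have : x = toComplex y := by ext i; exact (hy i).symm
  rw [this, h]; simp

/-! ### Linear forms -/

theorem bilin_comm (x y : Fin n → ℂ) : bilin x y = bilin y x := by
  simp [bilin, mul_comm]

theorem bilin_add_left (x y z : Fin n → ℂ) : bilin (x + y) z = bilin x z + bilin y z := by
  simp [bilin, add_mul, Finset.sum_add_distrib]

theorem bilin_smul_left (c : ℂ) (x y : Fin n → ℂ) : bilin (c • x) y = c * bilin x y := by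
  simp [bilin, Finset.mul_sum, mul_assoc]

theorem bilin_add_right (x y z : Fin n → ℂ) : bilin x (y + z) = bilin x y + bilin x z := by
  rw [bilin_comm, bilin_add_left, bilin_comm y, bilin_comm z]

theorem bilin_smul_right (c : ℂ) (x y : Fin n → ℂ) : bilin x (c • y) = c * bilin x y := by
  rw [bilin_comm, bilin_smul_left, bilin_comm]

theorem bilin_toComplex (x y : Fin n → ℝ) :
    bilin (toComplex x) (toComplex y) = ((∑ j, x j * y j : ℝ) : ℂ) := by
  simp [bilin, toComplex]

theorem toComplex_add (x y : Fin n → ℝ) : toComplex (x + y) = toComplex x + toComplex y := by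
  ext; simp [toComplex]

theorem toComplex_smul (s : ℝ) (x : Fin n → ℝ) : toComplex (s • x) = (s : ℂ) • toComplex x := by
  ext; simp [toComplex]

theorem bilin_eq_zero_of_mem_hyperplane {α x : Fin n → ℝ} (h : x ∈ hyperplane α) :
    bilin (toComplex x) (toComplex α) = 0 := by
  rw [bilin_toComplex, show ∑ j, x j * α j = 0 from h]; simp

theorem smul_mem_hyperplane {α x : Fin n → ℝ} (h : x ∈ hyperplane α) (s : ℝ) :
    s • x ∈ hyperplane α := by
  have h' : ∑ j, x j * α j = 0 := h
  simp only [hyperplane, Set.mem_ofPred_eq, Pi.smul_apply, smul_eq_mul, mul_assoc]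
  rw [← Finset.mul_sum, h', mul_zero]

theorem add_mem_hyperplane {α x y : Fin n → ℝ} (h : x ∈ hyperplane α) (h' : y ∈ hyperplane α) :
    x + y ∈ hyperplane α := by
  have h1 : ∑ j, x j * α j = 0 := h
  have h2 : ∑ j, y j * α j = 0 := h'
  simp only [hyperplane, Set.mem_ofPred_eq, Pi.add_apply, add_mul, Finset.sum_add_distrib, h1, h2,
    add_zero]

theorem normSq_pos {α : Fin n → ℝ} (hα : α ≠ 0) : 0 < ∑ j, α j * α j := by
  obtain ⟨j, hj⟩ := Function.ne_iff.1 hα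
  exact Finset.sum_pos' (fun i _ => mul_self_nonneg _) ⟨j, Finset.mem_univ _, mul_self_pos.2 hj⟩

theorem bilin_self_ne_zero {α : Fin n → ℝ} (hα : α ≠ 0) :
    bilin (toComplex α) (toComplex α) ≠ 0 := by
  rw [bilin_toComplex]
  exact_mod_cast ne_of_gt (normSq_pos hα)

/-- The linear form `x ↦ (x, α)`. -/
noncomputable def linForm (α : Fin n → ℝ) : MvPolynomial (Fin n) ℂ :=
  ∑ j, MvPolynomial.X j * MvPolynomial.C (α j : ℂ)

theorem AmPoly_eq (𝒜 : Finset (Fin n → ℝ)) (m : (Fin n → ℝ) → ℕ) :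
    AmPoly 𝒜 m = ∏ α ∈ 𝒜, linForm α ^ m α := rfl

theorem eval_linForm (α : Fin n → ℝ) (x : Fin n → ℂ) :
    MvPolynomial.eval x (linForm α) = bilin x (toComplex α) := by
  simp [linForm, bilin, toComplex]

theorem isHomogeneous_linForm (α : Fin n → ℝ) : (linForm α).IsHomogeneous 1 := by
  refine MvPolynomial.IsHomogeneous.sum _ _ _ fun j _ => ?_
  exact (MvPolynomial.isHomogeneous_X _ j).mul (MvPolynomial.isHomogeneous_C _ _)

theorem isHomogeneous_AmPoly (𝒜 : Finset (Fin n → ℝ)) (m : (Fin n → ℝ) → ℕ) :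
    (AmPoly 𝒜 m).IsHomogeneous (totalMult 𝒜 m) := by
  rw [AmPoly_eq]
  refine MvPolynomial.IsHomogeneous.prod _ _ _ fun α _ => ?_
  simpa using (isHomogeneous_linForm α).pow (m α)

theorem linForm_ne_zero {α : Fin n → ℝ} (hα : α ≠ 0) : linForm α ≠ 0 := by
  intro h
  have := eval_linForm α (toComplex α)
  rw [h, map_zero] at this
  exact bilin_self_ne_zero hα this.symm

theorem AmPoly_ne_zero {𝒜 : Finset (Fin n → ℝ)} (h : ∀ α ∈ 𝒜, α ≠ 0) (m : (Fin n → ℝ) → ℕ) :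
    AmPoly 𝒜 m ≠ 0 :=
  Finset.prod_ne_zero_iff.2 fun α hα => pow_ne_zero _ (linForm_ne_zero (h α hα))

theorem line_linForm (x v : Fin n → ℂ) (α : Fin n → ℝ) :
    line x v (linForm α) = Polynomial.C (bilin x (toComplex α))
      + Polynomial.C (bilin v (toComplex α)) * Polynomial.X := by
  refine Polynomial.funext fun t => ?_
  rw [eval_line, eval_linForm, bilin_add_left, bilin_smul_left]
  simp only [Polynomial.eval_add, Polynomial.eval_mul, Polynomial.eval_C, Polynomial.eval_X]
  ring

/-- The orthogonal projection to the hyperplane `Π_α`. -/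
noncomputable def proj (α x : Fin n → ℝ) : Fin n → ℝ :=
  x - ((∑ j, x j * α j) / ∑ j, α j * α j) • α

theorem proj_mem_hyperplane {α : Fin n → ℝ} (hα : α ≠ 0) (x : Fin n → ℝ) :
    proj α x ∈ hyperplane α := by
  have := (normSq_pos hα).ne'
  simp only [hyperplane, proj, Set.mem_ofPred_eq, Pi.sub_apply, Pi.smul_apply, smul_eq_mul, sub_mul,
    Finset.sum_sub_distrib, mul_assoc]
  rw [← Finset.mul_sum, div_mul_cancel₀ _ this, sub_self]

/-- Substitution of the orthogonal projection to `Π_α` in a polynomial. -/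
noncomputable def projHom (α : Fin n → ℝ) :
    MvPolynomial (Fin n) ℂ →ₐ[ℂ] MvPolynomial (Fin n) ℂ :=
  MvPolynomial.aeval fun j =>
    MvPolynomial.X j - MvPolynomial.C ((α j / ∑ i, α i * α i : ℝ) : ℂ) * linForm α

theorem eval_projHom (α x : Fin n → ℝ) (S : MvPolynomial (Fin n) ℂ) :
    MvPolynomial.eval (toComplex x) (projHom α S)
      = MvPolynomial.eval (toComplex (proj α x)) S := by
  have : (MvPolynomial.eval (toComplex x)).comp
      (projHom α : MvPolynomial (Fin n) ℂ →+* MvPolynomial (Fin n) ℂ)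
      = MvPolynomial.eval (toComplex (proj α x)) := by
    refine MvPolynomial.ringHom_ext (fun c => ?_) fun j => ?_
    · simp [projHom]
    · simp only [projHom, RingHom.comp_apply, RingHom.coe_coe, MvPolynomial.aeval_X, map_sub,
        MvPolynomial.eval_X, map_mul, MvPolynomial.eval_C, eval_linForm, bilin_toComplex]
      simp only [toComplex, proj, Pi.sub_apply, Pi.smul_apply, smul_eq_mul]
      push_cast
      ring
  exact congrArg (fun f => f S) this

/-- Modulo the linear form, orthogonal projection to Π_α fixes every coordinate, hence every
polynomial. -/
theorem linForm_dvd_sub_projHom (α : Fin n → ℝ) (S : MvPolynomial (Fin n) ℂ) :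
    linForm α ∣ S - projHom α S := by
  rw [← Ideal.mem_span_singleton, ← Ideal.Quotient.mk_eq_mk_iff_sub_mem]
  have : (Ideal.Quotient.mkₐ ℂ (Ideal.span {linForm α})).comp (projHom α)
      = Ideal.Quotient.mkₐ ℂ (Ideal.span {linForm α}) := by
    refine MvPolynomial.algHom_ext fun j => ?_
    simp only [AlgHom.comp_apply, projHom, MvPolynomial.aeval_X, Ideal.Quotient.mkₐ_eq_mk]
    rw [Ideal.Quotient.mk_eq_mk_iff_sub_mem, Ideal.mem_span_singleton]
    exact ⟨-MvPolynomial.C ((α j / ∑ i, α i * α i : ℝ) : ℂ), by ring⟩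
  exact (congrArg (fun f => f S) this).symm

theorem linForm_dvd_iff {α : Fin n → ℝ} (hα : α ≠ 0) (S : MvPolynomial (Fin n) ℂ) :
    linForm α ∣ S ↔ ∀ x ∈ hyperplane α, MvPolynomial.eval (toComplex x) S = 0 := by
  constructor
  · rintro ⟨R, rfl⟩ x hx
    rw [map_mul, eval_linForm, bilin_eq_zero_of_mem_hyperplane hx, zero_mul]
  · intro h
    have h0 : projHom α S = 0 := mvPolynomial_eq_zero_of_real fun x => by
      rw [eval_projHom]; exact h _ (proj_mem_hyperplane hα x)
    simpa [h0] using linForm_dvd_sub_projHom α S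

theorem eval_eq_zero_of_hyperplane {α : Fin n → ℝ} (hα : α ≠ 0) {S : MvPolynomial (Fin n) ℂ}
    (h : ∀ x ∈ hyperplane α, MvPolynomial.eval (toComplex x) S = 0) {x : Fin n → ℂ}
    (hx : bilin x (toComplex α) = 0) : MvPolynomial.eval x S = 0 := by
  obtain ⟨R, rfl⟩ := (linForm_dvd_iff hα S).2 h
  rw [map_mul, eval_linForm, hx, zero_mul]

theorem projHom_linForm {α : Fin n → ℝ} (hα : α ≠ 0) : projHom α (linForm α) = 0 :=
  mvPolynomial_eq_zero_of_real fun x => by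
    rw [eval_projHom, eval_linForm, bilin_eq_zero_of_mem_hyperplane (proj_mem_hyperplane hα x)]

/-- The multiples of the linear form are the kernel of a ring homomorphism into a domain. -/
theorem prime_linForm {α : Fin n → ℝ} (hα : α ≠ 0) : Prime (linForm α) := by
  have key : ∀ S, linForm α ∣ S ↔ projHom α S = 0 := fun S =>
    ⟨fun ⟨R, hR⟩ => by rw [hR, map_mul, projHom_linForm hα, zero_mul],
      fun h => by simpa [h] using linForm_dvd_sub_projHom α S⟩
  refine ⟨linForm_ne_zero hα, fun hu => ?_, fun a b hab => ?_⟩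
  · have := hu.map (MvPolynomial.eval (0 : Fin n → ℂ))
    rw [eval_linForm] at this
    simp [bilin] at this
  · rw [key, map_mul, mul_eq_zero] at hab
    rwa [key, key]

/-- Otherwise the projection of β to Π_α is orthogonal to both α and β, hence to itself. It is then
zero by positivity, and β is a multiple of α. -/
theorem not_linForm_dvd {α β : Fin n → ℝ} (hα : α ≠ 0) (h : LinearIndependent ℝ ![α, β]) :
    ¬ linForm α ∣ linForm β := by
  rw [linForm_dvd_iff hα]
  intro h0
  have h1 := h0 _ (proj_mem_hyperplane hα β)
  rw [eval_linForm, bilin_toComplex] at h1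
  have h1' : ∑ j, proj α β j * β j = 0 := by exact_mod_cast h1
  have h2 : ∑ j, proj α β j * α j = 0 := proj_mem_hyperplane hα β
  have h3 : ∑ j, proj α β j * proj α β j = 0 := by
    have : ∀ j, proj α β j * proj α β j = proj α β j * β j
        - ((∑ j, β j * α j) / ∑ j, α j * α j) * (proj α β j * α j) := fun j => by
      conv_lhs => rw [proj]
      simp only [Pi.sub_apply, Pi.smul_apply, smul_eq_mul, proj]; ring
    rw [Finset.sum_congr rfl fun j _ => this j, Finset.sum_sub_distrib, ← Finset.mul_sum, h1', h2]
    simp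
  have h4 : proj α β = 0 := by
    by_contra hne
    exact (normSq_pos hne).ne' h3
  rw [LinearIndependent.pair_iff] at h
  have := h (-((∑ j, β j * α j) / ∑ j, α j * α j)) 1 (by
    rw [← h4, proj]; simp [sub_eq_add_neg, add_comm])
  exact one_ne_zero this.2

/-- The powers of distinct linear forms are coprime, so each is treated alone. A factor (x, α) can
be split off as long as the first normal coefficient not yet used vanishes on Π_α. -/
theorem AmPoly_dvd {𝒜 : Finset (Fin n → ℝ)} (h_ne : ∀ α ∈ 𝒜, α ≠ 0)
    (h_nc : ∀ α ∈ 𝒜, ∀ β ∈ 𝒜, α ≠ β → LinearIndependent ℝ ![α, β]) (k : (Fin n → ℝ) → ℕ)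
    {T : MvPolynomial (Fin n) ℂ}
    (hT : ∀ α ∈ 𝒜, ∀ x ∈ hyperplane α, ∀ i < k α,
      (line (toComplex x) (toComplex α) T).coeff i = 0) : AmPoly 𝒜 k ∣ T := by
  rw [AmPoly_eq]
  refine Finset.prod_dvd_of_isRelPrime (fun α hα β hβ hne => ?_) fun α hα => ?_
  · refine IsRelPrime.pow ?_
    exact ((prime_linForm (h_ne α hα)).irreducible.isRelPrime_iff_not_dvd).2
      (not_linForm_dvd (h_ne α hα) (h_nc α hα β hβ hne))
  · have key : ∀ i ≤ k α, linForm α ^ i ∣ T := by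
      intro i
      induction i with
      | zero => simp
      | succ i ih =>
        intro hi
        obtain ⟨S, hS⟩ := ih (by omega)
        have : linForm α ∣ S := by
          rw [linForm_dvd_iff (h_ne α hα)]
          intro x hx
          have h1 := hT α hα x hx i (by omega)
          rw [hS, map_mul, map_pow, line_linForm, bilin_eq_zero_of_mem_hyperplane hx, map_zero,
            zero_add, mul_pow, ← map_pow, mul_assoc, Polynomial.coeff_C_mul, 
            Polynomial.coeff_X_pow_mul', if_pos le_rfl, Nat.sub_self, coeff_zero_line] at h1
          exact (mul_eq_zero.1 h1).resolve_left (pow_ne_zero _ (bilin_self_ne_zero (h_ne α hα)))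
        obtain ⟨R, hR⟩ := this
        exact ⟨R, by rw [hS, hR]; ring⟩
    exact key _ le_rfl

theorem eq_zero_of_AmPoly_dvd {𝒜 : Finset (Fin n → ℝ)} {k : (Fin n → ℝ) → ℕ}
    {T : MvPolynomial (Fin n) ℂ} {N : ℕ} (hN : T.totalDegree ≤ N) (hlt : N < totalMult 𝒜 k)
    (h_ne : ∀ α ∈ 𝒜, α ≠ 0) (h : AmPoly 𝒜 k ∣ T) : T = 0 := by
  obtain ⟨S, rfl⟩ := h
  by_contra hne
  have hS : S ≠ 0 := right_ne_zero_of_mul hne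
  rw [MvPolynomial.totalDegree_mul_of_isDomain (AmPoly_ne_zero h_ne k) hS,
    (isHomogeneous_AmPoly 𝒜 k).totalDegree (AmPoly_ne_zero h_ne k)] at hN
  omega

theorem eq_C_mul_of_AmPoly_dvd {𝒜 : Finset (Fin n → ℝ)} {k : (Fin n → ℝ) → ℕ}
    {T : MvPolynomial (Fin n) ℂ} (hN : T.totalDegree ≤ totalMult 𝒜 k)
    (h_ne : ∀ α ∈ 𝒜, α ≠ 0) (h : AmPoly 𝒜 k ∣ T) :
    ∃ a : ℂ, T = MvPolynomial.C a * AmPoly 𝒜 k := by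
  obtain ⟨S, rfl⟩ := h
  by_cases hS : S = 0
  · exact ⟨0, by simp [hS]⟩
  rw [MvPolynomial.totalDegree_mul_of_isDomain (AmPoly_ne_zero h_ne k) hS,
    (isHomogeneous_AmPoly 𝒜 k).totalDegree (AmPoly_ne_zero h_ne k)] at hN
  have : S.totalDegree = 0 := by omega
  rw [MvPolynomial.totalDegree_eq_zero_iff_eq_C] at this
  exact ⟨MvPolynomial.coeff 0 S, by rw [mul_comm, ← this]⟩

/-! ### Quasi-invariance and uniqueness -/

/-- The odd normal derivatives of `Q(x) e^{(x, lam)}` of order less than `2 * k` vanish on `Π_α`, where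
`γ = (α, lam)`. -/
def QuasiInv (α : Fin n → ℝ) (k : ℕ) (γ : ℂ) (Q : MvPolynomial (Fin n) ℂ) : Prop :=
  ∀ x ∈ hyperplane α, ∀ j < k,
    expDeriv (2 * j + 1) γ (line (toComplex x) (toComplex α) Q) = 0

theorem dirDeriv_eq {f : (Fin n → ℂ) → ℂ} {Q : MvPolynomial (Fin n) ℂ} {lam : Fin n → ℂ}
    (hf : ∀ x, f x = MvPolynomial.eval x Q * Complex.exp (bilin x lam)) (N : ℕ) (α : Fin n → ℝ)
    (x : Fin n → ℂ) : dirDeriv N α f x = Complex.exp (bilin x lam)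
      * expDeriv N (bilin lam (toComplex α)) (line x (toComplex α) Q) := by
  rw [dirDeriv, ← iteratedDeriv_polynomial_mul_exp]
  congr 1
  ext t
  rw [hf, eval_line, bilin_add_left, bilin_smul_left, bilin_comm lam]

theorem quasiInv_iff {f : (Fin n → ℂ) → ℂ} {Q : MvPolynomial (Fin n) ℂ} {lam : Fin n → ℂ}
    (hf : ∀ x, f x = MvPolynomial.eval x Q * Complex.exp (bilin x lam)) (α : Fin n → ℝ) (k : ℕ) :
    QuasiInv α k (bilin lam (toComplex α)) Q ↔ ∀ j < k, ∀ x ∈ hyperplane α,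
      dirDeriv (2 * j + 1) α f (toComplex x) = 0 := by
  constructor
  · intro h j hj x hx
    rw [dirDeriv_eq hf, h x hx j hj, mul_zero]
  · intro h x hx j hj
    have := h j hj x hx
    rw [dirDeriv_eq hf] at this
    exact (mul_eq_zero.1 this).resolve_left (Complex.exp_ne_zero _)

theorem QuasiInv.sub {α : Fin n → ℝ} {k : ℕ} {γ : ℂ} {Q R : MvPolynomial (Fin n) ℂ}
    (hQ : QuasiInv α k γ Q) (hR : QuasiInv α k γ R) : QuasiInv α k γ (Q - R) := by
  intro x hx j hj
  rw [map_sub, map_sub, hQ x hx j hj, hR x hx j hj, sub_zero]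

/-- Π_α is a cone, so the condition holds at sx for every real s ≠ 0. It is polynomial in s, and its
coefficients are the conditions for the parts of each degree in x. -/
theorem QuasiInv.diagPoly {α : Fin n → ℝ} {k : ℕ} {γ : ℂ} {Q : MvPolynomial (Fin n) ℂ}
    (hQ : QuasiInv α k γ Q) {x : Fin n → ℝ} (hx : x ∈ hyperplane α) {j : ℕ} (hj : j < k) (D : ℕ) :
    expDeriv (2 * j + 1) γ (diagPoly Q (toComplex x) (toComplex α) D) = 0 := by
  rcases lt_or_ge Q.totalDegree D with hD | hD
  · have : BakerAkhiezer.diagPoly Q (toComplex x) (toComplex α) D = 0 := by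
      ext i
      rw [coeff_diagPoly, MvPolynomial.homogeneousComponent_eq_zero _ _ (by omega)]; simp
    rw [this, map_zero]
  set p : Polynomial ℂ := ∑ D ∈ Finset.range (Q.totalDegree + 1), Polynomial.monomial D
    (expDeriv (2 * j + 1) γ (BakerAkhiezer.diagPoly Q (toComplex x) (toComplex α) D)) with hp
  have h0 : p = 0 := by
    refine polynomial_eq_zero_of_real fun s hs => ?_
    have h1 := hQ _ (smul_mem_hyperplane hx s) j hj
    rw [toComplex_smul, line_smul_eq_sum _ _ _ (by exact_mod_cast hs), map_sum] at h1
    rw [hp, Polynomial.eval_finsetSum, ← h1]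
    refine Finset.sum_congr rfl fun D _ => ?_
    rw [Polynomial.eval_monomial, map_smul, smul_eq_mul, mul_comm]
  have h2 := congrArg (fun q => Polynomial.coeff q D) h0
  simp only [hp, Polynomial.finsetSum_coeff, Polynomial.coeff_monomial, Polynomial.coeff_zero] at h2
  rwa [Finset.sum_ite_eq', if_pos (Finset.mem_range.2 (by omega))] at h2

/-- The part of degree N - i in x has degree at most i in t but satisfies k > i odd conditions, so
it is zero. Its coefficient of t^i is the one in question. This shows that the top component
vanishes to order k on Π_α. -/
theorem QuasiInv.coeff_top {α : Fin n → ℝ} {k : ℕ} {γ : ℂ} (hγ : γ ≠ 0)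
    {Q : MvPolynomial (Fin n) ℂ} (hQ : QuasiInv α k γ Q) {N : ℕ} (hN : Q.totalDegree ≤ N)
    {x : Fin n → ℝ} (hx : x ∈ hyperplane α) {i : ℕ} (hi : i < k) :
    (line (toComplex x) (toComplex α) (MvPolynomial.homogeneousComponent N Q)).coeff i = 0 := by
  rcases lt_or_ge N i with h | h
  · exact coeff_line_eq_zero
      (MvPolynomial.homogeneousComponent_isHomogeneous _ _).totalDegree_le _ _ h
  · have h0 : BakerAkhiezer.diagPoly Q (toComplex x) (toComplex α) (N - i) = 0 := by
      refine eq_zero_of_expDeriv_odd hγ (d := i) hi ?_ fun j hj => hQ.diagPoly hx hj _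
      refine (natDegree_diagPoly_le hN _ _ _).trans (by omega)
    have := coeff_diagPoly Q (toComplex x) (toComplex α) (N - i) i
    rw [h0, Nat.sub_add_cancel h] at this
    simpa using this.symm

theorem homogeneousComponent_totalDegree_ne_zero {Q : MvPolynomial (Fin n) ℂ} (hQ : Q ≠ 0) :
    MvPolynomial.homogeneousComponent Q.totalDegree Q ≠ 0 := by
  intro h
  have hs : Q.support.Nonempty := MvPolynomial.support_nonempty.2 hQ
  obtain ⟨d, hd, hd'⟩ := Finset.exists_mem_eq_sup _ hs fun s => s.sum fun _ e => e
  have : MvPolynomial.coeff d (MvPolynomial.homogeneousComponent Q.totalDegree Q)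
      = MvPolynomial.coeff d Q := by
    rw [MvPolynomial.coeff_homogeneousComponent, if_pos]
    rw [MvPolynomial.totalDegree, hd']; rfl
  rw [h, MvPolynomial.coeff_zero] at this
  exact MvPolynomial.mem_support_iff.1 hd this.symm

/-- A nonzero top component would be divisible by A_m, which has degree |m|. -/
theorem eq_zero_of_quasiInv {𝒜 : Finset (Fin n → ℝ)} (h_ne : ∀ α ∈ 𝒜, α ≠ 0)
    (h_nc : ∀ α ∈ 𝒜, ∀ β ∈ 𝒜, α ≠ β → LinearIndependent ℝ ![α, β]) {m : (Fin n → ℝ) → ℕ}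
    {γ : (Fin n → ℝ) → ℂ} (hγ : ∀ α ∈ 𝒜, γ α ≠ 0) {Q : MvPolynomial (Fin n) ℂ}
    (hQ : ∀ α ∈ 𝒜, QuasiInv α (m α) (γ α) Q)
    (hdeg : ∀ N, totalMult 𝒜 m ≤ N → MvPolynomial.homogeneousComponent N Q = 0) : Q = 0 := by
  by_contra hne
  have hlt : Q.totalDegree < totalMult 𝒜 m := by
    by_contra hge
    exact homogeneousComponent_totalDegree_ne_zero hne (hdeg _ (not_lt.1 hge))
  refine homogeneousComponent_totalDegree_ne_zero hne (eq_zero_of_AmPoly_dvd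
    (MvPolynomial.homogeneousComponent_isHomogeneous _ _).totalDegree_le hlt h_ne
    (AmPoly_dvd h_ne h_nc m ?_))
  intro α hα x hx i hi
  exact (hQ α hα).coeff_top (hγ α hα) le_rfl hx hi

/-! ### Polynomial dependence on the spectral parameter -/

theorem span_range_eq_top {ι S : Type*} [Fintype S] (u : ι → S → ℂ)
    (h : ∀ w : S → ℂ, (∀ i, ∑ d, u i d * w d = 0) → w = 0) :
    Submodule.span ℂ (Set.range u) = ⊤ := by
  classical
  by_contra hne
  obtain ⟨f, hf, hle⟩ := Submodule.exists_le_ker_of_lt_top _ (lt_top_iff_ne_top.2 hne)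
  refine hf ?_
  have h0 := h (fun d => f (Pi.single d 1)) fun i => ?_
  · refine LinearMap.pi_ext' fun d => LinearMap.ext_ring ?_
    exact congrFun h0 d
  · have h1 : f (u i) = 0 := hle (Submodule.subset_span ⟨i, rfl⟩)
    rw [← h1]
    conv_rhs => rw [← Finset.univ_sum_single (u i), map_sum]
    refine Finset.sum_congr rfl fun d _ => ?_
    rw [← smul_eq_mul, ← map_smul, ← Pi.single_smul, smul_eq_mul, mul_one]

/-- Cramer's rule: injectivity at one parameter value selects a square subsystem whose determinant D
is nonzero there, hence nonzero as a polynomial. Since v is assumed to solve the system for every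
parameter, multiplication by the adjugate gives polynomial numerators over the common denominator D.
-/
theorem exists_rational_solution {ι S : Type*} [Fintype S]
    (R : ι → S → MvPolynomial (Fin n) ℂ) (b : ι → MvPolynomial (Fin n) ℂ)
    (v : (Fin n → ℂ) → S → ℂ)
    (hv : ∀ lam i, ∑ d, MvPolynomial.eval lam (R i d) * v lam d = MvPolynomial.eval lam (b i))
    (lam₀ : Fin n → ℂ)
    (h : ∀ w : S → ℂ, (∀ i, ∑ d, MvPolynomial.eval lam₀ (R i d) * w d = 0) → w = 0) :
    ∃ D : MvPolynomial (Fin n) ℂ, D ≠ 0 ∧ ∀ d, ∃ N : MvPolynomial (Fin n) ℂ,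
      ∀ lam, MvPolynomial.eval lam D * v lam d = MvPolynomial.eval lam N := by
  classical
  have hspan := span_range_eq_top (fun i d => MvPolynomial.eval lam₀ (R i d)) h
  obtain ⟨f, hf, -, hli⟩ := Submodule.exists_fun_fin_finrank_span_eq ℂ
    (Set.range fun i d => MvPolynomial.eval lam₀ (R i d))
  have hcard : Module.finrank ℂ (Submodule.span ℂ
      (Set.range fun i d => MvPolynomial.eval lam₀ (R i d))) = Fintype.card S := by
    rw [hspan, finrank_top, Module.finrank_fintype_fun_eq_card]
  let e : S ≃ Fin (Module.finrank ℂ (Submodule.span ℂ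
      (Set.range fun i d => MvPolynomial.eval lam₀ (R i d)))) :=
    Fintype.equivOfCardEq (by rw [hcard, Fintype.card_fin])
  have hf' : ∀ a : S, ∃ i, (fun d => MvPolynomial.eval lam₀ (R i d)) = f (e a) := fun a => hf (e a)
  choose g hg using hf'
  let A : Matrix S S (MvPolynomial (Fin n) ℂ) := Matrix.of fun a d => R (g a) d
  refine ⟨A.det, ?_, fun d => ⟨(A.adjugate.mulVec fun a => b (g a)) d, fun lam => ?_⟩⟩
  · intro h0
    have h1 : ((MvPolynomial.eval lam₀).mapMatrix A).det = 0 := by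
      rw [← RingHom.map_det, h0, map_zero]
    have h2 : LinearIndependent ℂ ((MvPolynomial.eval lam₀).mapMatrix A).row := by
      have : ((MvPolynomial.eval lam₀).mapMatrix A).row = f ∘ e := by
        ext a d
        exact congrFun (hg a) d
      rw [this]
      exact hli.comp _ e.injective
    rw [Matrix.linearIndependent_rows_iff_isUnit, Matrix.isUnit_iff_isUnit_det, h1] at h2
    simp at h2
  · have h1 : ((MvPolynomial.eval lam).mapMatrix A).mulVec (v lam)
        = fun a => MvPolynomial.eval lam (b (g a)) := by
      ext a
      rw [← hv lam (g a)]
      rfl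
    have h2 : ((MvPolynomial.eval lam).mapMatrix A).adjugate.mulVec
        (((MvPolynomial.eval lam).mapMatrix A).mulVec (v lam))
        = ((MvPolynomial.eval lam).mapMatrix A).det • v lam := by
      rw [Matrix.mulVec_mulVec, Matrix.adjugate_mul, Matrix.smul_mulVec, Matrix.one_mulVec]
    rw [h1] at h2
    have h3 := congrFun h2 d
    rw [← RingHom.map_det, Pi.smul_apply, smul_eq_mul] at h3
    rw [← h3, ← RingHom.map_adjugate]
    simp [Matrix.mulVec, dotProduct]

theorem exists_eval_ne_zero {D : MvPolynomial (Fin n) ℂ} (hD : D ≠ 0) :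
    ∃ x : Fin n → ℝ, MvPolynomial.eval (toComplex x) D ≠ 0 := by
  by_contra h
  push Not at h
  exact hD (mvPolynomial_eq_zero_of_real h)

/-- The nonvanishing locus of a nonzero polynomial is dense. -/
theorem dense_eval_ne_zero {D : MvPolynomial (Fin n) ℂ} (hD : D ≠ 0) :
    Dense {x : Fin n → ℂ | MvPolynomial.eval x D ≠ 0} := by
  intro z
  obtain ⟨w, hw⟩ := exists_eval_ne_zero hD
  set p := line z (toComplex w - z) D
  have hp : p ≠ 0 := by
    intro h
    have := eval_line z (toComplex w - z) D 1
    rw [show line z (toComplex w - z) D = 0 from h] at this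
    simp at this
    exact hw this.symm
  have hc : Continuous fun t : ℂ => z + t • (toComplex w - z) := by fun_prop
  have h1 : (0 : ℂ) ∈ closure {t : ℂ | p.eval t ≠ 0} := by
    have hfin : {t : ℂ | p.eval t = 0}.Finite := by
      refine (p.roots.toFinset.finite_toSet).subset fun t ht => ?_
      simpa [hp] using ht
    exact hfin.countable.dense_compl ℂ 0
  have h2 := map_mem_closure hc h1 (t := {x : Fin n → ℂ | MvPolynomial.eval x D ≠ 0})
    fun t ht => by
      have : p.eval t ≠ 0 := ht
      rwa [eval_line] at this
  simpa using h2

/-- The prime factors of D are removed one by one. N vanishes on the zero set of a prime factor q,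
so q divides N by the Nullstellensatz; q then cancels where it is nonzero, and everywhere by density
and continuity. -/
theorem exists_polynomial_of_continuous {f : (Fin n → ℂ) → ℂ} (hf : Continuous f)
    (D : MvPolynomial (Fin n) ℂ) (hD : D ≠ 0) : ∀ N : MvPolynomial (Fin n) ℂ,
    (∀ x, MvPolynomial.eval x D * f x = MvPolynomial.eval x N) →
    ∃ p : MvPolynomial (Fin n) ℂ, ∀ x, f x = MvPolynomial.eval x p := by
  induction D using UniqueFactorizationMonoid.induction_on_prime with
  | h₁ => exact absurd rfl hD
  | h₂ u hu =>
    intro N hN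
    obtain ⟨v, hv⟩ := hu.exists_left_inv
    refine ⟨v * N, fun x => ?_⟩
    rw [map_mul, ← hN, ← mul_assoc, ← map_mul, hv, map_one, one_mul]
  | h₃ D q hD0 hq ih =>
    intro N hN
    have hdvd : q ∣ N := by
      have : (Ideal.span {q}).IsPrime := (Ideal.span_singleton_prime hq.ne_zero).2 hq
      rw [← Ideal.mem_span_singleton,
        ← MvPolynomial.IsPrime.vanishingIdeal_zeroLocus (K := ℂ) (Ideal.span {q})]
      intro x hx
      have h1 : MvPolynomial.eval x q = 0 := hx q (Ideal.mem_span_singleton_self q)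
      have h2 := hN x
      rw [map_mul, h1] at h2
      change MvPolynomial.eval x N = 0
      simpa using h2.symm
    obtain ⟨N', rfl⟩ := hdvd
    refine ih hD0 N' fun x => ?_
    have hcont : Continuous fun x => MvPolynomial.eval x D * f x :=
      (MvPolynomial.continuous_eval D).mul hf
    refine congrFun (hcont.ext_on (dense_eval_ne_zero hq.ne_zero)
      (MvPolynomial.continuous_eval N') fun y hy => ?_) x
    have := hN y
    rw [map_mul, map_mul, mul_assoc] at this
    exact mul_left_cancel₀ hy this

theorem exists_generic {𝒜 : Finset (Fin n → ℝ)} (h_ne : ∀ α ∈ 𝒜, α ≠ 0) :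
    ∃ x : Fin n → ℝ, ∀ α ∈ 𝒜, bilin (toComplex x) (toComplex α) ≠ 0 := by
  obtain ⟨x, hx⟩ := exists_eval_ne_zero (AmPoly_ne_zero h_ne fun _ => 1)
  refine ⟨x, fun α hα => ?_⟩
  rw [AmPoly_eq, map_prod, Finset.prod_ne_zero_iff] at hx
  simpa [eval_linForm] using hx α hα

/-- The defining properties of the polynomial factor of a Baker-Akhiezer function. -/
structure IsFactor (𝒜 : Finset (Fin n → ℝ)) (m : (Fin n → ℝ) → ℕ) (lam : Fin n → ℂ)
    (P : MvPolynomial (Fin n) ℂ) : Prop where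
  totalDegree_le : P.totalDegree ≤ totalMult 𝒜 m
  top : MvPolynomial.homogeneousComponent (totalMult 𝒜 m) P
    = MvPolynomial.C (Am 𝒜 m lam) * AmPoly 𝒜 m
  quasiInv : ∀ α ∈ 𝒜, QuasiInv α (m α) (bilin lam (toComplex α)) P

theorem IsFactor.eq {𝒜 : Finset (Fin n → ℝ)} (h_ne : ∀ α ∈ 𝒜, α ≠ 0)
    (h_nc : ∀ α ∈ 𝒜, ∀ β ∈ 𝒜, α ≠ β → LinearIndependent ℝ ![α, β]) {m : (Fin n → ℝ) → ℕ}
    {lam : Fin n → ℂ} (hlam : ∀ α ∈ 𝒜, bilin lam (toComplex α) ≠ 0)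
    {P P' : MvPolynomial (Fin n) ℂ} (hP : IsFactor 𝒜 m lam P) (hP' : IsFactor 𝒜 m lam P') :
    P = P' := by
  refine sub_eq_zero.1 (eq_zero_of_quasiInv h_ne h_nc hlam
    (fun α hα => (hP.quasiInv α hα).sub (hP'.quasiInv α hα)) fun N hN => ?_)
  rcases hN.eq_or_lt with rfl | hN
  · rw [map_sub, hP.top, hP'.top, sub_self]
  · exact MvPolynomial.homogeneousComponent_eq_zero _ _ (lt_of_le_of_lt
      (MvPolynomial.totalDegree_sub _ _) (lt_of_le_of_lt
        (max_le hP.totalDegree_le hP'.totalDegree_le) hN))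

theorem IsBakerAkhiezer.exists_isFactor {𝒜 : Finset (Fin n → ℝ)} {m : (Fin n → ℝ) → ℕ}
    {φ : (Fin n → ℂ) → (Fin n → ℂ) → ℂ} (hφ : IsBakerAkhiezer 𝒜 m φ) (lam : Fin n → ℂ) :
    ∃ P, IsFactor 𝒜 m lam P ∧
      ∀ x, φ x lam = MvPolynomial.eval x P * Complex.exp (bilin x lam) := by
  obtain ⟨P, h1, h2, h3⟩ := hφ.form lam
  refine ⟨P, ⟨h1, h2, fun α hα => ?_⟩, h3⟩
  rw [quasiInv_iff (f := fun z => φ z lam) h3]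
  exact fun j hj x hx => hφ.quasiInvariant α hα j hj x hx lam

/-- The monomials of degree at most `M`. -/
noncomputable def monomialsLE (n M : ℕ) : Finset (Fin n →₀ ℕ) :=
  (Finsupp.finite_of_degree_le (σ := Fin n) M).toFinset

theorem mem_monomialsLE {M : ℕ} {d : Fin n →₀ ℕ} : d ∈ monomialsLE n M ↔ d.degree ≤ M := by
  simp [monomialsLE]

theorem coeff_eq_zero_of_degree {Q : MvPolynomial (Fin n) ℂ} {M : ℕ} (hQ : Q.totalDegree ≤ M)
    {d : Fin n →₀ ℕ} (hd : M < d.degree) : MvPolynomial.coeff d Q = 0 :=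
  MvPolynomial.coeff_eq_zero_of_totalDegree_lt (hQ.trans_lt hd)

theorem eq_sum_monomialsLE {Q : MvPolynomial (Fin n) ℂ} {M : ℕ} (hQ : Q.totalDegree ≤ M) :
    Q = ∑ d : monomialsLE n M, MvPolynomial.monomial d.1 (MvPolynomial.coeff d.1 Q) := by
  rw [Finset.sum_coe_sort (monomialsLE n M)
    fun d => MvPolynomial.monomial d (MvPolynomial.coeff d Q)]
  conv_lhs => rw [Q.as_sum]
  refine Finset.sum_subset (fun d hd => ?_) fun d _ hd => ?_
  · rw [mem_monomialsLE]
    by_contra h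
    exact MvPolynomial.mem_support_iff.1 hd (coeff_eq_zero_of_degree hQ (not_le.1 h))
  · rw [MvPolynomial.notMem_support_iff.1 hd, map_zero]

theorem coeff_sum_monomialsLE {M : ℕ} (w : monomialsLE n M → ℂ) (d : monomialsLE n M) :
    MvPolynomial.coeff d.1 (∑ d : monomialsLE n M, MvPolynomial.monomial d.1 (w d)) = w d := by
  classical
  rw [MvPolynomial.coeff_sum]
  simp only [MvPolynomial.coeff_monomial]
  rw [Finset.sum_eq_single d]
  · simp
  · intro b _ hb
    rw [if_neg fun h => hb (Subtype.ext h)]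
  · simp

theorem totalDegree_sum_monomialsLE {M : ℕ} (w : monomialsLE n M → ℂ) :
    (∑ d : monomialsLE n M, MvPolynomial.monomial d.1 (w d)).totalDegree ≤ M := by
  refine MvPolynomial.totalDegree_finsetSum_le fun d _ => ?_
  refine (MvPolynomial.totalDegree_monomial_le _ _).trans ?_
  exact mem_monomialsLE.1 d.2

/-- The evaluation functionals span the dual of the polynomials of degree at most M, so each
coefficient is a fixed linear combination of values at points. -/
theorem continuous_coeff {M : ℕ} {P : (Fin n → ℂ) → MvPolynomial (Fin n) ℂ}
    (hP : ∀ lam, (P lam).totalDegree ≤ M)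
    (hc : ∀ x, Continuous fun lam => MvPolynomial.eval x (P lam)) (d : monomialsLE n M) :
    Continuous fun lam => MvPolynomial.coeff d.1 (P lam) := by
  classical
  set u : (Fin n → ℂ) → monomialsLE n M → ℂ :=
    fun x d => MvPolynomial.eval x (MvPolynomial.monomial d.1 (1 : ℂ)) with hu
  have hev : ∀ x (w : monomialsLE n M → ℂ), ∑ d, u x d * w d
      = MvPolynomial.eval x (∑ d : monomialsLE n M, MvPolynomial.monomial d.1 (w d)) := by
    intro x w
    rw [map_sum]
    refine Finset.sum_congr rfl fun d _ => ?_
    simp only [hu, MvPolynomial.eval_monomial]; ring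
  have htop := span_range_eq_top u fun w hw => by
    have h0 : (∑ d : monomialsLE n M, MvPolynomial.monomial d.1 (w d)) = 0 :=
      MvPolynomial.funext fun x => by rw [← hev, hw, map_zero]
    ext d
    rw [← coeff_sum_monomialsLE w d, h0]; simp
  have key : ∀ r ∈ Submodule.span ℂ (Set.range u),
      Continuous fun lam => ∑ d, r d * MvPolynomial.coeff d.1 (P lam) := by
    intro r hr
    induction hr using Submodule.span_induction with
    | mem r hr =>
      obtain ⟨x, rfl⟩ := hr
      convert hc x using 2 with lam
      rw [hev, ← eq_sum_monomialsLE (hP lam)]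
    | zero => simpa using continuous_const
    | add r s _ _ hr hs => 
      simp only [Pi.add_apply, add_mul, Finset.sum_add_distrib]
      exact hr.add hs
    | smul c r _ hr => simpa [mul_assoc, ← Finset.mul_sum] using hr.const_mul c
  have := key (Pi.single d 1) (htop ▸ Submodule.mem_top)
  simpa [Pi.single_apply] using this

/-- The polynomial factor of a Baker-Akhiezer function, with coefficients that are polynomials in
the spectral parameter. -/
theorem IsBakerAkhiezer.exists_polynomial {𝒜 : Finset (Fin n → ℝ)} (h_ne : ∀ α ∈ 𝒜, α ≠ 0)
    (h_nc : ∀ α ∈ 𝒜, ∀ β ∈ 𝒜, α ≠ β → LinearIndependent ℝ ![α, β])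
    {m : (Fin n → ℝ) → ℕ} {φ : (Fin n → ℂ) → (Fin n → ℂ) → ℂ} (hφ : IsBakerAkhiezer 𝒜 m φ) :
    ∃ F : MvPolynomial (Fin n) (MvPolynomial (Fin n) ℂ), ∀ lam,
      IsFactor 𝒜 m lam (MvPolynomial.map (MvPolynomial.eval lam) F) ∧
      ∀ x, φ x lam = MvPolynomial.eval x (MvPolynomial.map (MvPolynomial.eval lam) F)
        * Complex.exp (bilin x lam) := by
  classical
  choose P hP hPφ using hφ.exists_isFactor
  set M := totalMult 𝒜 m with hM
  have hcont : ∀ d : monomialsLE n M, Continuous fun lam => MvPolynomial.coeff d.1 (P lam) := by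
    refine continuous_coeff (fun lam => (hP lam).totalDegree_le) fun x => ?_
    have : (fun lam => MvPolynomial.eval x (P lam))
        = fun lam => φ x lam * Complex.exp (-bilin x lam) := by
      ext lam
      rw [hPφ, mul_assoc, ← Complex.exp_add]; simp
    rw [this]
    refine (hφ.continuous_param x).mul (Complex.continuous_exp.comp ?_)
    unfold bilin
    fun_prop
  obtain ⟨lam₀, hlam₀⟩ := exists_generic h_ne
  -- The unknowns are the coefficients of P(·, λ). The equations are all the quasi-invariance
  -- conditions, polynomial in λ through (λ, α), together with the prescribed coefficients of degree
  -- |m|.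
  let ι := {p : (Fin n → ℝ) × ℕ × (Fin n → ℝ) //
    p.1 ∈ 𝒜 ∧ p.2.1 < m p.1 ∧ p.2.2 ∈ hyperplane p.1} ⊕ {d : monomialsLE n M // d.1.degree = M}
  let R : ι → monomialsLE n M → MvPolynomial (Fin n) ℂ := Sum.elim
    (fun p d => ∑ i ∈ Finset.range (2 * p.1.2.1 + 1 + 1),
      MvPolynomial.C (((2 * p.1.2.1 + 1).descFactorial i : ℂ)
        * (line (toComplex p.1.2.2) (toComplex p.1.1) (MvPolynomial.monomial d.1 1)).coeff i)
        * linForm p.1.1 ^ (2 * p.1.2.1 + 1 - i))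
    (fun e d => if d = e.1 then 1 else 0)
  let b : ι → MvPolynomial (Fin n) ℂ := Sum.elim 0
    fun e => MvPolynomial.C (MvPolynomial.coeff e.1.1 (AmPoly 𝒜 m)) * AmPoly 𝒜 m
  have hR1 : ∀ (p : {p : (Fin n → ℝ) × ℕ × (Fin n → ℝ) //
      p.1 ∈ 𝒜 ∧ p.2.1 < m p.1 ∧ p.2.2 ∈ hyperplane p.1}) (lam : Fin n → ℂ)
      (w : monomialsLE n M → ℂ),
      ∑ d, MvPolynomial.eval lam (R (Sum.inl p) d) * w d
      = expDeriv (2 * p.1.2.1 + 1) (bilin lam (toComplex p.1.1))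
        (line (toComplex p.1.2.2) (toComplex p.1.1)
          (∑ d : monomialsLE n M, MvPolynomial.monomial d.1 (w d))) := by
    intro p lam w
    rw [map_sum, map_sum]
    refine Finset.sum_congr rfl fun d _ => ?_
    rw [show MvPolynomial.monomial d.1 (w d) = w d • MvPolynomial.monomial d.1 (1 : ℂ) by
      rw [MvPolynomial.smul_monomial, smul_eq_mul, mul_one], map_smul, map_smul, smul_eq_mul,
      mul_comm, expDeriv_apply]
    simp only [R, Sum.elim_inl, map_sum, map_mul, map_pow, MvPolynomial.eval_C, eval_linForm]
    congr 1
    refine Finset.sum_congr rfl fun i _ => ?_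
    ring
  have hR2 : ∀ (e : {d : monomialsLE n M // d.1.degree = M}) (lam : Fin n → ℂ)
      (w : monomialsLE n M → ℂ), ∑ d, MvPolynomial.eval lam (R (Sum.inr e) d) * w d = w e.1 := by
    intro e lam w
    simp [R, apply_ite (MvPolynomial.eval lam)]
  have hv : ∀ lam i, ∑ d, MvPolynomial.eval lam (R i d) * MvPolynomial.coeff d.1 (P lam)
      = MvPolynomial.eval lam (b i) := by
    rintro lam (p | e)
    · rw [hR1, ← eq_sum_monomialsLE (hP lam).totalDegree_le,
        (hP lam).quasiInv _ p.2.1 _ p.2.2.2 _ p.2.2.1]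
      simp [b]
    · rw [hR2]
      have := congrArg (MvPolynomial.coeff e.1.1) (hP lam).top
      rw [MvPolynomial.coeff_homogeneousComponent, if_pos e.2, MvPolynomial.coeff_C_mul] at this
      rw [this]
      simp [b, eval_AmPoly, mul_comm]
  -- Injectivity of the homogeneous system at the generic λ₀ is the uniqueness statement
  -- `eq_zero_of_quasiInv`.
  have hinj : ∀ w : monomialsLE n M → ℂ,
      (∀ i, ∑ d, MvPolynomial.eval (toComplex lam₀) (R i d) * w d = 0) → w = 0 := by
    intro w hw
    have h0 : (∑ d : monomialsLE n M, MvPolynomial.monomial d.1 (w d)) = 0 := by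
      refine eq_zero_of_quasiInv h_ne h_nc (m := m) hlam₀ (fun α hα x hx j hj => ?_) fun N hN => ?_
      · have := hw (Sum.inl ⟨(α, j, x), hα, hj, hx⟩)
        rwa [hR1] at this
      · rcases hN.eq_or_lt with rfl | hN
        · ext d
          rw [MvPolynomial.coeff_homogeneousComponent, MvPolynomial.coeff_zero]
          split_ifs with hd
          · have hdm : d ∈ monomialsLE n M := mem_monomialsLE.2 hd.le
            have := hw (Sum.inr ⟨⟨d, hdm⟩, hd⟩)
            rw [hR2] at this
            exact (coeff_sum_monomialsLE w ⟨d, hdm⟩).trans this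
          · rfl
        · exact MvPolynomial.homogeneousComponent_eq_zero _ _
            ((totalDegree_sum_monomialsLE w).trans_lt hN)
    ext d
    rw [← coeff_sum_monomialsLE w d, h0]; simp
  obtain ⟨D, hD0, hD⟩ := exists_rational_solution R b
    (fun lam d => MvPolynomial.coeff d.1 (P lam)) hv (toComplex lam₀) hinj
  have hpoly : ∀ d : monomialsLE n M, ∃ p : MvPolynomial (Fin n) ℂ,
      ∀ lam, MvPolynomial.coeff d.1 (P lam) = MvPolynomial.eval lam p := fun d => by
    obtain ⟨N, hN⟩ := hD d
    exact exists_polynomial_of_continuous (hcont d) D hD0 N hN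
  choose p hp using hpoly
  refine ⟨∑ d : monomialsLE n M, MvPolynomial.monomial d.1 (p d), fun lam => ?_⟩
  have : MvPolynomial.map (MvPolynomial.eval lam)
      (∑ d : monomialsLE n M, MvPolynomial.monomial d.1 (p d)) = P lam := by
    rw [map_sum, eq_sum_monomialsLE (hP lam).totalDegree_le]
    refine Finset.sum_congr rfl fun d _ => ?_
    rw [MvPolynomial.map_monomial, ← hp]
  rw [this]
  exact ⟨hP lam, hPφ lam⟩

/-! ### Taylor coefficients in the spectral parameter -/

theorem expDeriv_X_pow (N : ℕ) (γ : ℂ) (j : ℕ) :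
    expDeriv N γ (Polynomial.X ^ j) = N.descFactorial j * γ ^ (N - j) := by
  rw [expDeriv_apply]
  simp only [Polynomial.coeff_X_pow, mul_ite, mul_one, mul_zero]
  rw [Finset.sum_ite_eq']
  split_ifs with h
  · rfl
  · rw [Nat.descFactorial_eq_zero_iff_lt.2]
    · simp
    · simpa [Nat.lt_succ_iff, Nat.succ_le_iff] using h

theorem expDeriv_X_pow_mul_eq_zero {N u : ℕ} (h : N < u) (γ : ℂ) (q : Polynomial ℂ) :
    expDeriv N γ (Polynomial.X ^ u * q) = 0 := by
  rw [expDeriv_apply]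
  refine Finset.sum_eq_zero fun j hj => ?_
  rw [Polynomial.coeff_X_pow_mul', if_neg, mul_zero]
  have := Finset.mem_range.1 hj
  omega

/-- Expansion of the factor e^{δt}; the powers of t beyond N do not reach the derivative of order N.
-/
theorem expDeriv_add (N : ℕ) (γ δ : ℂ) (q : Polynomial ℂ) :
    expDeriv N (γ + δ) q = ∑ u ∈ Finset.range (N + 1),
      ((u.factorial : ℂ)⁻¹ * δ ^ u) * expDeriv N γ (Polynomial.X ^ u * q) := by
  induction q using Polynomial.induction_on' with
  | add p q hp hq => simp only [mul_add, map_add, hp, hq, Finset.sum_add_distrib]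
  | monomial j a =>
    rw [← mul_one a, ← smul_eq_mul, ← Polynomial.smul_monomial, ← Polynomial.X_pow_eq_monomial]
    simp only [mul_smul_comm, map_smul, smul_eq_mul, ← pow_add, expDeriv_X_pow]
    rw [add_comm γ δ, add_pow, Finset.mul_sum, Finset.mul_sum]
    rcases lt_or_ge N j with h | h
    · rw [Nat.descFactorial_eq_zero_iff_lt.2 h]
      symm
      rw [Finset.sum_eq_zero]
      · simp
      · intro u _
        rw [Nat.descFactorial_eq_zero_iff_lt.2 (by omega)]; simp
    · have hsub : Finset.range (N - j + 1) ⊆ Finset.range (N + 1) :=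
        Finset.range_mono (by omega)
      rw [← Finset.sum_subset hsub]
      · refine Finset.sum_congr rfl fun u _ => ?_
        have h1 : N.descFactorial (u + j) = (u.factorial * (N - j).choose u) * N.descFactorial j := by
          rw [← Nat.descFactorial_eq_factorial_mul_choose,
            ← Nat.descFactorial_mul_descFactorial (Nat.le_add_left j u), Nat.add_sub_cancel]
        have h2 : (u.factorial : ℂ) ≠ 0 := Nat.cast_ne_zero.2 u.factorial_ne_zero
        rw [h1, show N - (u + j) = N - j - u by omega]
        push_cast
        field_simp
      · intro u hu hu'
        rw [Nat.descFactorial_eq_zero_iff_lt.2]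
        · simp
        · simp at hu'; omega

/-- The image of a polynomial family under a linear functional, as a polynomial in the parameter. -/
noncomputable def applyCoeff (l : MvPolynomial (Fin n) ℂ →ₗ[ℂ] ℂ)
    (P : Polynomial (MvPolynomial (Fin n) ℂ)) : Polynomial ℂ :=
  ∑ j ∈ Finset.range (P.natDegree + 1), Polynomial.monomial j (l (P.coeff j))

theorem coeff_applyCoeff (l : MvPolynomial (Fin n) ℂ →ₗ[ℂ] ℂ)
    (P : Polynomial (MvPolynomial (Fin n) ℂ)) (j : ℕ) :
    (applyCoeff l P).coeff j = l (P.coeff j) := by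
  rw [applyCoeff, Polynomial.finsetSum_coeff]
  simp only [Polynomial.coeff_monomial]
  rw [Finset.sum_ite_eq']
  split_ifs with h
  · rfl
  · rw [Polynomial.coeff_eq_zero_of_natDegree_lt, map_zero]
    simp at h; omega

theorem eval_applyCoeff (l : MvPolynomial (Fin n) ℂ →ₗ[ℂ] ℂ)
    (P : Polynomial (MvPolynomial (Fin n) ℂ)) (c : ℂ) :
    (applyCoeff l P).eval c = l (P.eval (MvPolynomial.C c)) := by
  rw [applyCoeff, Polynomial.eval_finsetSum, Polynomial.eval_eq_sum_range, map_sum]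
  refine Finset.sum_congr rfl fun j _ => ?_
  rw [Polynomial.eval_monomial, ← map_pow, mul_comm (P.coeff j), ← MvPolynomial.smul_eq_C_mul,
    map_smul, smul_eq_mul, mul_comm]

/-- An identity in the parameter c is compared coefficientwise. The value c = 0 is left out because
there the conditions transverse to Π_α degenerate. -/
theorem apply_coeff_eq (l : MvPolynomial (Fin n) ℂ →ₗ[ℂ] ℂ)
    {P : Polynomial (MvPolynomial (Fin n) ℂ)} {q : Polynomial ℂ}
    (h : ∀ c : ℂ, c ≠ 0 → l (P.eval (MvPolynomial.C c)) = q.eval c) (j : ℕ) :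
    l (P.coeff j) = q.coeff j := by
  rw [← coeff_applyCoeff]
  congr 1
  refine sub_eq_zero.1 (polynomial_eq_zero_of_real fun s hs => ?_)
  rw [Polynomial.eval_sub, eval_applyCoeff, h _ (by exact_mod_cast hs), sub_self]

/-- If `P` describes the polynomial factor along `c ↦ lam + c α`, then
`lamCoeff P α j · e^{(x, lam)}` is the `j`-th Taylor coefficient of the function in `c`. -/
noncomputable def lamCoeff (P : Polynomial (MvPolynomial (Fin n) ℂ)) (α : Fin n → ℝ) (j : ℕ) :
    MvPolynomial (Fin n) ℂ :=
  ∑ r ∈ Finset.range (j + 1), (r.factorial : ℂ)⁻¹ • (linForm α ^ r * P.coeff (j - r))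

/-- The formal exponential series `∑ a^r c^r / r!`. -/
noncomputable def expSeries (a : Polynomial ℂ) : PowerSeries (Polynomial ℂ) :=
  PowerSeries.mk fun r => (r.factorial : ℂ)⁻¹ • a ^ r

theorem expSeries_add (a b : Polynomial ℂ) : expSeries (a + b) = expSeries a * expSeries b := by
  have : ∀ a : Polynomial ℂ,
      expSeries a = PowerSeries.rescale a (PowerSeries.exp (Polynomial ℂ)) := by
    intro a
    ext1 r
    rw [expSeries, PowerSeries.coeff_mk, PowerSeries.coeff_rescale, PowerSeries.coeff_exp,
      mul_comm, ← Algebra.smul_def, one_div]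
    rw [show ((r.factorial : ℂ)⁻¹) = ((r.factorial : ℚ)⁻¹ : ℚ) • (1 : ℂ) by
      rw [Rat.smul_one_eq_cast]; push_cast; rfl, smul_assoc, one_smul]
  rw [this, this, this, PowerSeries.exp_mul_exp_eq_exp_add]

/-- The condition for β holds identically in c, so its Taylor coefficients in c vanish. The
exponential also depends on c, and along x + tβ it contributes e^{c((x,α) + t(α,β))}, which is why
formal power series in c are used. -/
theorem quasiInv_lamCoeff {P : Polynomial (MvPolynomial (Fin n) ℂ)} {α β : Fin n → ℝ}
    {lam : Fin n → ℂ} {k : ℕ}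
    (hP : ∀ c : ℂ, QuasiInv β k (bilin (lam + c • toComplex α) (toComplex β))
      (P.eval (MvPolynomial.C c))) (j : ℕ) :
    QuasiInv β k (bilin lam (toComplex β)) (lamCoeff P α j) := by
  intro x hx i hi
  set N := 2 * i + 1
  set γ := bilin lam (toComplex β)
  set γ₁ := bilin (toComplex α) (toComplex β)
  set a := bilin (toComplex x) (toComplex α)
  set L : ℕ → Polynomial ℂ := fun r => line (toComplex x) (toComplex β) (P.coeff r)
  -- Only the part of the exponential depending on t is included. The remaining factor e^{c(x,α)} is
  -- constant in t and is multiplied in at the end.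
  set E : PowerSeries (Polynomial ℂ) :=
    PowerSeries.mk L * expSeries (Polynomial.C γ₁ * Polynomial.X) with hE
  have hE0 : ∀ r, expDeriv N γ (PowerSeries.coeff r E) = 0 := by
    intro r
    let l : ℕ → MvPolynomial (Fin n) ℂ →ₗ[ℂ] ℂ := fun u =>
      (expDeriv N γ).comp ((LinearMap.mulLeft ℂ (Polynomial.X ^ u)).comp
        (line (toComplex x) (toComplex β)).toLinearMap)
    set q : Polynomial ℂ := ∑ u ∈ Finset.range (N + 1),
      Polynomial.C ((u.factorial : ℂ)⁻¹ * γ₁ ^ u) * (Polynomial.X ^ u * applyCoeff (l u) P) with hq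
    -- As a polynomial in c, q is the derivative of order N at parameter γ + cγ₁, expanded by
    -- `expDeriv_add`.
    have hq0 : q = 0 := by
      refine Polynomial.funext fun c => ?_
      have := hP c x hx i hi
      rw [bilin_add_left, bilin_smul_left, expDeriv_add] at this
      rw [Polynomial.eval_zero, ← this, hq, Polynomial.eval_finsetSum]
      refine Finset.sum_congr rfl fun u _ => ?_
      rw [Polynomial.eval_mul, Polynomial.eval_C, Polynomial.eval_mul, Polynomial.eval_pow,
        Polynomial.eval_X, eval_applyCoeff, mul_pow]
      simp only [l, LinearMap.comp_apply, LinearMap.mulLeft_apply, AlgHom.toLinearMap_apply]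
      ring
    have hc := congrArg (fun p => Polynomial.coeff p r) hq0
    simp only [hq, Polynomial.finsetSum_coeff, Polynomial.coeff_C_mul, Polynomial.coeff_X_pow_mul',
      Polynomial.coeff_zero, coeff_applyCoeff] at hc
    rw [hE, mul_comm, PowerSeries.coeff_mul, map_sum,
      Finset.Nat.sum_antidiagonal_eq_sum_range_succ_mk]
    set g : ℕ → ℂ := fun u => (u.factorial : ℂ)⁻¹ * γ₁ ^ u
      * (if u ≤ r then l u (P.coeff (r - u)) else 0) with hg
    have hg1 : ∀ u, N + 1 ≤ u → g u = 0 := by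
      intro u hu
      have : l u (P.coeff (r - u)) = 0 := expDeriv_X_pow_mul_eq_zero (by omega) _ _
      simp only [hg, this, ite_self, mul_zero]
    have hg2 : ∀ u, r + 1 ≤ u → g u = 0 := by
      intro u hu
      simp only [hg]
      rw [if_neg (by omega), mul_zero]
    have hle : ∀ K ≤ N + 1 + (r + 1), (∀ u, K ≤ u → g u = 0) →
        ∑ u ∈ Finset.range K, g u = ∑ u ∈ Finset.range (N + 1 + (r + 1)), g u := by
      intro K hK h
      refine Finset.sum_subset (Finset.range_mono hK) fun u _ hu => h u ?_
      simpa using hu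
    have hc' : ∑ u ∈ Finset.range (N + 1), g u = 0 := hc
    rw [hle _ (by omega) hg1, ← hle _ (by omega) hg2] at hc'
    rw [← hc']
    refine Finset.sum_congr rfl fun u hu => ?_
    simp only [hg]
    rw [if_pos (by have := Finset.mem_range.1 hu; omega)]
    simp only [expSeries, PowerSeries.coeff_mk, l, LinearMap.comp_apply, LinearMap.mulLeft_apply,
      AlgHom.toLinearMap_apply, L]
    rw [mul_pow, ← map_pow, ← Polynomial.smul_eq_C_mul, smul_smul, smul_mul_assoc, map_smul,
      smul_eq_mul]
  have hH : PowerSeries.coeff j (E * expSeries (Polynomial.C a))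
      = line (toComplex x) (toComplex β) (lamCoeff P α j) := by
    rw [hE, mul_assoc, ← expSeries_add, mul_comm, PowerSeries.coeff_mul, lamCoeff, map_sum,
      Finset.Nat.sum_antidiagonal_eq_sum_range_succ_mk]
    refine Finset.sum_congr rfl fun r _ => ?_
    rw [expSeries, PowerSeries.coeff_mk, PowerSeries.coeff_mk, map_smul, map_mul, map_pow,
      line_linForm, smul_mul_assoc, bilin_comm (toComplex β),
      add_comm (Polynomial.C a)]
  rw [← hH, PowerSeries.coeff_mul, map_sum]
  refine Finset.sum_eq_zero fun p _ => ?_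
  rw [expSeries, PowerSeries.coeff_mk, ← map_pow, Polynomial.smul_C, mul_comm,
    ← Polynomial.smul_eq_C_mul, map_smul, hE0, smul_zero]

theorem homogeneousComponent_linForm_pow_mul (α : Fin n → ℝ) (r N : ℕ)
    (Q : MvPolynomial (Fin n) ℂ) :
    MvPolynomial.homogeneousComponent N (linForm α ^ r * Q)
      = if r ≤ N then linForm α ^ r * MvPolynomial.homogeneousComponent (N - r) Q else 0 := by
  have hmem : ∀ K, linForm α ^ r * MvPolynomial.homogeneousComponent K Q
      ∈ MvPolynomial.homogeneousSubmodule (Fin n) ℂ (r + K) := by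
    intro K
    rw [MvPolynomial.mem_homogeneousSubmodule]
    refine MvPolynomial.IsHomogeneous.mul ?_ (MvPolynomial.homogeneousComponent_isHomogeneous _ _)
    simpa using (isHomogeneous_linForm α).pow r
  conv_lhs => rw [← MvPolynomial.sum_homogeneousComponent Q, Finset.mul_sum, map_sum]
  simp only [MvPolynomial.homogeneousComponent_of_mem (hmem _)]
  split_ifs with h
  · have : ∀ K, (N = r + K) ↔ (N - r = K) := fun K => by omega
    simp only [this]
    rw [Finset.sum_ite_eq]
    split_ifs with h'
    · rfl
    · rw [MvPolynomial.homogeneousComponent_eq_zero, mul_zero]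
      simp at h'; omega
  · refine Finset.sum_eq_zero fun K _ => if_neg (by omega)

theorem totalMult_update {𝒜 : Finset (Fin n → ℝ)} {α : Fin n → ℝ} (hα : α ∈ 𝒜)
    (m : (Fin n → ℝ) → ℕ) (k : ℕ) :
    totalMult 𝒜 (Function.update m α k) + m α = totalMult 𝒜 m + k := by
  rw [totalMult, totalMult, Finset.sum_update_of_mem hα,
    ← Finset.sum_sdiff (Finset.singleton_subset_iff.2 hα) (f := m), Finset.sum_singleton]
  ring

theorem AmPoly_eq_mul {𝒜 : Finset (Fin n → ℝ)} {α : Fin n → ℝ} (hα : α ∈ 𝒜)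
    (m : (Fin n → ℝ) → ℕ) :
    AmPoly 𝒜 m = linForm α ^ m α * AmPoly 𝒜 (Function.update m α 0) := by
  rw [AmPoly_eq, AmPoly_eq, ← Finset.mul_prod_erase _ _ hα, ← Finset.mul_prod_erase 𝒜
    (fun β => linForm β ^ Function.update m α 0 β) hα, Function.update_self, pow_zero, one_mul]
  congr 1
  refine Finset.prod_congr rfl fun β hβ => ?_
  rw [Function.update_of_ne (Finset.ne_of_mem_erase hβ)]

theorem exists_generic_mem_hyperplane {𝒜 : Finset (Fin n → ℝ)} (h_ne : ∀ α ∈ 𝒜, α ≠ 0)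
    (h_nc : ∀ α ∈ 𝒜, ∀ β ∈ 𝒜, α ≠ β → LinearIndependent ℝ ![α, β]) {α : Fin n → ℝ}
    (hα : α ∈ 𝒜) : ∃ x ∈ hyperplane α, ∀ β ∈ 𝒜, β ≠ α →
      bilin (toComplex x) (toComplex β) ≠ 0 := by
  have h0 : ¬ linForm α ∣ ∏ β ∈ 𝒜.erase α, linForm β := by
    intro h
    obtain ⟨β, hβ, hd⟩ := ((prime_linForm (h_ne α hα)).dvd_finsetProd_iff _).1 h
    rw [Finset.mem_erase] at hβ
    exact not_linForm_dvd (h_ne α hα) (h_nc α hα β hβ.2 hβ.1.symm) hd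
  rw [linForm_dvd_iff (h_ne α hα)] at h0
  push Not at h0
  obtain ⟨x, hx, hx0⟩ := h0
  refine ⟨x, hx, fun β hβ hne => ?_⟩
  rw [map_prod, Finset.prod_ne_zero_iff] at hx0
  simpa [eval_linForm] using hx0 β (Finset.mem_erase.2 ⟨hne, hβ⟩)

theorem eval_AmPoly_update_ne_zero {𝒜 : Finset (Fin n → ℝ)} {α : Fin n → ℝ}
    {x : Fin n → ℂ} (hx : ∀ β ∈ 𝒜, β ≠ α → bilin x (toComplex β) ≠ 0) (m : (Fin n → ℝ) → ℕ) :
    MvPolynomial.eval x (AmPoly 𝒜 (Function.update m α 0)) ≠ 0 := by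
  rw [AmPoly_eq, map_prod, Finset.prod_ne_zero_iff]
  intro β hβ
  rcases eq_or_ne β α with rfl | hne
  · simp
  · rw [map_pow, eval_linForm]
    exact pow_ne_zero _ (hx β hβ hne)

/-! ### Zero counts for the Taylor coefficients Q_j at a spectral parameter orthogonal to α -/

section Family

variable {𝒜 : Finset (Fin n → ℝ)} {m : (Fin n → ℝ) → ℕ} {α : Fin n → ℝ} {lam : Fin n → ℂ}
  {P : Polynomial (MvPolynomial (Fin n) ℂ)}

/-- A coefficient beyond degree |m| vanishes for every c, hence as a polynomial in c. -/
theorem totalDegree_coeff_le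
    (hP : ∀ c : ℂ, IsFactor 𝒜 m (lam + c • toComplex α) (P.eval (MvPolynomial.C c))) (j : ℕ) :
    (P.coeff j).totalDegree ≤ totalMult 𝒜 m := by
  refine Finset.sup_le fun d hd => ?_
  by_contra h
  refine MvPolynomial.mem_support_iff.1 hd ?_
  have := apply_coeff_eq (MvPolynomial.lcoeff ℂ d) (P := P) (q := 0) (fun c _ => ?_) j
  · simpa using this
  · simpa using coeff_eq_zero_of_degree (hP c).totalDegree_le (not_le.1 h)

/-- On a line leaving Π_α in direction α the form (x, α) is (α, α)t, so its r-th power shifts the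
coefficients by r. -/
theorem coeff_line_lamCoeff {x : Fin n → ℝ} (hx : x ∈ hyperplane α) {i N : ℕ} (hi : i ≤ N)
    (j : ℕ) : (line (toComplex x) (toComplex α)
        (MvPolynomial.homogeneousComponent N (lamCoeff P α j))).coeff i
      = ∑ r ∈ Finset.range (j + 1), (r.factorial : ℂ)⁻¹ * bilin (toComplex α) (toComplex α) ^ r *
        (if r ≤ i then (line (toComplex x) (toComplex α)
          (MvPolynomial.homogeneousComponent (N - r) (P.coeff (j - r)))).coeff (i - r) else 0) := by
  rw [lamCoeff, map_sum, map_sum, Polynomial.finsetSum_coeff]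
  refine Finset.sum_congr rfl fun r _ => ?_
  rw [map_smul, map_smul, Polynomial.coeff_smul, homogeneousComponent_linForm_pow_mul, smul_eq_mul,
    mul_assoc]
  congr 1
  split_ifs with h1 h2 h2
  · rw [map_mul, map_pow, line_linForm, bilin_eq_zero_of_mem_hyperplane hx, map_zero, zero_add,
      mul_pow, ← map_pow, mul_assoc, Polynomial.coeff_C_mul, Polynomial.coeff_X_pow_mul', if_pos h2]
  · rw [map_mul, map_pow, line_linForm, bilin_eq_zero_of_mem_hyperplane hx, map_zero, zero_add,
      mul_pow, ← map_pow, mul_assoc, Polynomial.coeff_C_mul, Polynomial.coeff_X_pow_mul', if_neg h2]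
  · omega
  · simp

theorem eval_homogeneousComponent_lamCoeff {x : Fin n → ℝ} (hx : x ∈ hyperplane α) (N j : ℕ) :
    MvPolynomial.eval (toComplex x) (MvPolynomial.homogeneousComponent N (lamCoeff P α j))
      = MvPolynomial.eval (toComplex x) (MvPolynomial.homogeneousComponent N (P.coeff j)) := by
  rw [← coeff_zero_line _ (toComplex α), coeff_line_lamCoeff hx (Nat.zero_le _),
    Finset.sum_range_succ', Finset.sum_eq_zero, zero_add]
  · simp [coeff_zero_line]
  · intro r _
    simp

/-- The odd coefficients of `t ↦ Q_j(x + tα)` vanish. -/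
theorem coeff_odd_lamCoeff (hlam : bilin lam (toComplex α) = 0)
    (hα : α ∈ 𝒜)
    (hP : ∀ c : ℂ, IsFactor 𝒜 m (lam + c • toComplex α) (P.eval (MvPolynomial.C c)))
    {x : Fin n → ℝ} (hx : x ∈ hyperplane α) {k : ℕ} (hk : k < m α) (N j : ℕ) :
    (line (toComplex x) (toComplex α)
      (MvPolynomial.homogeneousComponent N (lamCoeff P α j))).coeff (2 * k + 1) = 0 := by
  rcases lt_or_ge N (2 * k + 1) with h | h
  · exact coeff_line_eq_zero
      (MvPolynomial.homogeneousComponent_isHomogeneous _ _).totalDegree_le _ _ h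
  · have h1 := (quasiInv_lamCoeff (fun c => (hP c).quasiInv α hα) j).diagPoly hx hk
      (N - (2 * k + 1))
    -- With (λ, α) = 0 the exponential disappears and the derivative of order N is N! times the
    -- coefficient of t^N.
    rw [hlam, expDeriv_apply, Finset.sum_range_succ, Finset.sum_eq_zero, zero_add,
      coeff_diagPoly, Nat.sub_add_cancel h, Nat.sub_self, pow_zero, mul_one,
      Nat.descFactorial_self] at h1
    · exact (mul_eq_zero.1 h1).resolve_left (Nat.cast_ne_zero.2 (Nat.factorial_ne_zero _))
    · intro i hi
      have := Finset.mem_range.1 hi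
      rw [zero_pow (by omega)]; simp

/-- The coefficients of bidegree `(l, l + J - w)` in `(t, c)`, of degree `D` in `x`, of the family. -/
noncomputable def bidegPoly (P : Polynomial (MvPolynomial (Fin n) ℂ)) (x v : Fin n → ℂ)
    (M D J w : ℕ) : Polynomial ℂ :=
  ∑ l ∈ Finset.range (M + 1), Polynomial.monomial l (if w ≤ l + J then
    (line x v (MvPolynomial.homogeneousComponent (D + l) (P.coeff (l + J - w)))).coeff l else 0)

theorem coeff_bidegPoly {M : ℕ} (hM : ∀ j, (P.coeff j).totalDegree ≤ M) (x v : Fin n → ℂ)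
    (D J w l : ℕ) : (bidegPoly P x v M D J w).coeff l = if w ≤ l + J then
    (line x v (MvPolynomial.homogeneousComponent (D + l) (P.coeff (l + J - w)))).coeff l else 0 := by
  rw [bidegPoly, Polynomial.finsetSum_coeff]
  simp only [Polynomial.coeff_monomial]
  rw [Finset.sum_ite_eq']
  split_ifs with h1 h2 h2
  · rfl
  · rfl
  · rw [MvPolynomial.homogeneousComponent_eq_zero]
    · simp
    · have := hM (l + J - w)
      simp at h1; omega
  · rfl

theorem natDegree_bidegPoly_le {M : ℕ} (hM : ∀ j, (P.coeff j).totalDegree ≤ M) (x v : Fin n → ℂ)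
    (D J w : ℕ) : (bidegPoly P x v M D J w).natDegree ≤ M - D := by
  refine Polynomial.natDegree_le_iff_coeff_eq_zero.2 fun l hl => ?_
  rw [coeff_bidegPoly hM]
  split_ifs
  · rw [MvPolynomial.homogeneousComponent_eq_zero]
    · simp
    · have := hM (l + J - w); omega
  · rfl

/-- Write κ = (α, α). The coefficient of t^i c^{i+J-w} in the family times e^{κtc} is, as i varies,
the coefficient of order i of a polynomial in tc times e^{κtc}. Thus a single polynomial governs
coefficients of different Q_j, and vanishing can be transferred between them. -/
theorem expDeriv_bidegPoly {M : ℕ} (hM : ∀ j, (P.coeff j).totalDegree ≤ M) {x : Fin n → ℝ}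
    (hx : x ∈ hyperplane α) (D J w i : ℕ) :
    expDeriv i (bilin (toComplex α) (toComplex α))
      (bidegPoly P (toComplex x) (toComplex α) M D J w)
    = if w ≤ i + J then i.factorial * (line (toComplex x) (toComplex α)
      (MvPolynomial.homogeneousComponent (D + i) (lamCoeff P α (i + J - w)))).coeff i else 0 := by
  rw [expDeriv_apply]
  split_ifs with h
  · rw [coeff_line_lamCoeff hx (by omega), ← Finset.sum_range_reflect, Finset.mul_sum]
    set κ := bilin (toComplex α) (toComplex α)
    set f : ℕ → ℂ := fun r => (i.factorial : ℂ) * ((r.factorial : ℂ)⁻¹ * κ ^ r *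
        (if r ≤ i then (line (toComplex x) (toComplex α)
          (MvPolynomial.homogeneousComponent (D + i - r)
            (P.coeff (i + J - w - r)))).coeff (i - r) else 0)) with hf
    have h1 : ∑ r ∈ Finset.range (i + J - w + 1), f r
        = ∑ r ∈ (Finset.range (i + 1)).filter (fun r => r ≤ i + J - w), f r := by
      symm
      refine Finset.sum_subset_zero_on_sdiff ?_ ?_ fun _ _ => rfl
      · intro r hr
        simp only [Finset.mem_filter, Finset.mem_range] at hr ⊢
        omega
      · intro r hr
        simp only [Finset.mem_sdiff, Finset.mem_filter, Finset.mem_range] at hr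
        simp only [hf]
        rw [if_neg (by omega), mul_zero, mul_zero]
    rw [h1, Finset.sum_filter]
    refine Finset.sum_congr rfl fun r hr => ?_
    have hr' : r ≤ i := Nat.lt_succ_iff.1 (Finset.mem_range.1 hr)
    rw [show i + 1 - 1 - r = i - r by omega, coeff_bidegPoly hM]
    by_cases hc : r ≤ i + J - w
    · rw [if_pos hc, if_pos (by omega)]
      simp only [hf]
      rw [if_pos hr', show D + (i - r) = D + i - r by omega,
        show i - r + J - w = i + J - w - r by omega, show i - (i - r) = r by omega]
      have h2 : (r.factorial : ℂ) * (i.descFactorial (i - r) : ℂ) = i.factorial := by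
        have := Nat.factorial_mul_descFactorial (n := i) (k := i - r) (by omega)
        rw [show i - (i - r) = r by omega] at this
        exact_mod_cast this
      have h3 : (r.factorial : ℂ) ≠ 0 := Nat.cast_ne_zero.2 r.factorial_ne_zero
      rw [← h2]
      field_simp
    · rw [if_neg hc, if_neg (by omega), mul_zero]
  · refine Finset.sum_eq_zero fun l hl => ?_
    have := Finset.mem_range.1 hl
    rw [coeff_bidegPoly hM, if_neg (by omega), mul_zero]

/-- Vanishing of a coefficient of a component of `Q_J`, by counting zeros. -/
theorem coeff_lamCoeff_eq_zero (hα0 : α ≠ 0) (hlam : bilin lam (toComplex α) = 0) (hα : α ∈ 𝒜)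
    (hP : ∀ c : ℂ, IsFactor 𝒜 m (lam + c • toComplex α) (P.eval (MvPolynomial.C c)))
    {x : Fin n → ℝ} (hx : x ∈ hyperplane α) (hm : 0 < m α) {J N i : ℕ} (hi : i ≤ N)
    (hcount : totalMult 𝒜 m + i < N + m α + (i + 1) / 2)
    (heven : ∀ l, 2 * l < i → i - 2 * l ≤ J → (line (toComplex x) (toComplex α)
      (MvPolynomial.homogeneousComponent (N - (i - 2 * l))
        (lamCoeff P α (J - (i - 2 * l))))).coeff (2 * l) = 0) :
    (line (toComplex x) (toComplex α)
      (MvPolynomial.homogeneousComponent N (lamCoeff P α J))).coeff i = 0 := by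
  set M := totalMult 𝒜 m
  have hM := totalDegree_coeff_le hP
  set q := bidegPoly P (toComplex x) (toComplex α) M (N - i) J i with hq
  -- The orders known to vanish: the odd ones below 2m_α because (λ, α) = 0, and the even ones below
  -- i by `heven`. Together they exceed the degree bound |m| - (N - i), by `hcount`. The derivative
  -- of order i then gives the claim.
  let O : Finset ℕ := (Finset.range (m α)).image fun k => 2 * k + 1
  let E : Finset ℕ := (Finset.range ((i + 1) / 2)).image fun k => 2 * k
  have hO : O.card = m α := by
    rw [Finset.card_image_of_injective _ fun a b h => by simpa using h, Finset.card_range]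
  have hE : E.card = (i + 1) / 2 := by
    rw [Finset.card_image_of_injective _ fun a b h => by simpa using h, Finset.card_range]
  have hdisj : Disjoint O E := by
    rw [Finset.disjoint_left]
    intro a ha hb
    obtain ⟨k, -, rfl⟩ := Finset.mem_image.1 ha
    obtain ⟨l, -, hl⟩ := Finset.mem_image.1 hb
    omega
  have hq0 : q = 0 := by
    refine eq_zero_of_card_expDeriv (bilin_self_ne_zero hα0) (natDegree_bidegPoly_le hM _ _ _ _ _)
      (O.disjUnion E hdisj) ?_ ?_
    · rw [Finset.card_disjUnion, hO, hE]
      omega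
    · intro a ha
      rw [expDeriv_bidegPoly hM hx]
      split_ifs with hw
      · rcases Finset.mem_disjUnion.1 ha with ha | ha
        · obtain ⟨k, hk, rfl⟩ := Finset.mem_image.1 ha
          rw [coeff_odd_lamCoeff hlam hα hP hx (Finset.mem_range.1 hk), mul_zero]
        · obtain ⟨l, hl, rfl⟩ := Finset.mem_image.1 ha
          have hl' := Finset.mem_range.1 hl
          have := heven l (by omega) (by omega)
          rw [show N - i + 2 * l = N - (i - 2 * l) by omega,
            show 2 * l + J - i = J - (i - 2 * l) by omega, this, mul_zero]
      · rfl
  have h1 := expDeriv_bidegPoly hM hx (N - i) J i i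
  rw [← hq, hq0, map_zero, if_pos (by omega), Nat.sub_add_cancel hi, Nat.add_sub_cancel_left] at h1
  exact (mul_eq_zero.1 h1.symm).resolve_left (Nat.cast_ne_zero.2 (Nat.factorial_ne_zero _))

/-- Divisibility of the top component of `Q_J`. -/
theorem AmPoly_update_dvd_top (h_ne : ∀ α ∈ 𝒜, α ≠ 0)
    (h_nc : ∀ α ∈ 𝒜, ∀ β ∈ 𝒜, α ≠ β → LinearIndependent ℝ ![α, β])
    (hlam' : ∀ β ∈ 𝒜, β ≠ α → bilin lam (toComplex β) ≠ 0)
    (hP : ∀ c : ℂ, IsFactor 𝒜 m (lam + c • toComplex α) (P.eval (MvPolynomial.C c)))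
    {J N k : ℕ} (hN : (lamCoeff P α J).totalDegree ≤ N)
    (hk : ∀ x ∈ hyperplane α, ∀ i < k, i ≤ N → (line (toComplex x) (toComplex α)
      (MvPolynomial.homogeneousComponent N (lamCoeff P α J))).coeff i = 0) :
    AmPoly 𝒜 (Function.update m α k)
      ∣ MvPolynomial.homogeneousComponent N (lamCoeff P α J) := by
  refine AmPoly_dvd h_ne h_nc _ fun β hβ x hx i hi => ?_
  rcases eq_or_ne β α with rfl | hne
  · rw [Function.update_self] at hi
    rcases lt_or_ge N i with h | h
    · exact coeff_line_eq_zero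
        (MvPolynomial.homogeneousComponent_isHomogeneous _ _).totalDegree_le _ _ h
    · exact hk x hx i hi h
  · rw [Function.update_of_ne hne] at hi
    exact (quasiInv_lamCoeff (fun c => (hP c).quasiInv β hβ) J).coeff_top
      (hlam' β hβ hne) hN hx hi

/-- The degree of `Q_J` is at most `|m| - m_α + J`. -/
theorem totalDegree_lamCoeff_le (h_ne : ∀ α ∈ 𝒜, α ≠ 0)
    (h_nc : ∀ α ∈ 𝒜, ∀ β ∈ 𝒜, α ≠ β → LinearIndependent ℝ ![α, β]) (hα : α ∈ 𝒜)
    (hm : 0 < m α) (hlam : bilin lam (toComplex α) = 0)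
    (hlam' : ∀ β ∈ 𝒜, β ≠ α → bilin lam (toComplex β) ≠ 0)
    (hP : ∀ c : ℂ, IsFactor 𝒜 m (lam + c • toComplex α) (P.eval (MvPolynomial.C c))) (J : ℕ) :
    (lamCoeff P α J).totalDegree + m α ≤ totalMult 𝒜 m + J := by
  induction J using Nat.strong_induction_on with
  | _ J ih =>
    by_contra hlt
    set N := (lamCoeff P α J).totalDegree with hN
    have hne : lamCoeff P α J ≠ 0 := by
      intro h0
      have := totalMult_update hα m 0
      rw [h0, MvPolynomial.totalDegree_zero] at hN
      omega
    refine homogeneousComponent_totalDegree_ne_zero hne ?_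
    -- Put e = N + m_α - |m| > 0. The count works exactly for i < 2e, so the top component acquires
    -- the factor (x, α)^{2e}. The resulting divisor has degree |m| - m_α + 2e = N + e, which
    -- exceeds N.
    have hup := totalMult_update hα m (2 * (N + m α - totalMult 𝒜 m))
    have hup0 := totalMult_update hα m 0
    refine eq_zero_of_AmPoly_dvd (N := N)
      (MvPolynomial.homogeneousComponent_isHomogeneous _ _).totalDegree_le ?_ h_ne
      (AmPoly_update_dvd_top (k := 2 * (N + m α - totalMult 𝒜 m)) h_ne h_nc hlam' hP le_rfl
        fun x hx i hi hiN => ?_)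
    · omega
    · refine coeff_lamCoeff_eq_zero (h_ne α hα) hlam hα hP hx hm hiN (by omega)
        fun l hl hlJ => ?_
      -- By induction the earlier Taylor coefficients have degree below the component considered.
      rw [MvPolynomial.homogeneousComponent_eq_zero]
      · simp
      · have := ih (J - (i - 2 * l)) (by omega)
        omega

/-- On `Π_α` the component of degree `|m| - m_α` factorises. -/
theorem eval_homogeneousComponent_coeff (h_ne : ∀ α ∈ 𝒜, α ≠ 0) (hα : α ∈ 𝒜)
    (hlam : bilin lam (toComplex α) = 0)
    (hP : ∀ c : ℂ, IsFactor 𝒜 m (lam + c • toComplex α) (P.eval (MvPolynomial.C c)))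
    {x : Fin n → ℝ} (hx : x ∈ hyperplane α) (j : ℕ) :
    MvPolynomial.eval (toComplex x)
      (MvPolynomial.homogeneousComponent (totalMult 𝒜 (Function.update m α 0)) (P.coeff j))
    = oddProd (m α) * bilin (toComplex α) (toComplex α) ^ m α
      * MvPolynomial.eval (toComplex x) (AmPoly 𝒜 (Function.update m α 0))
      * (line lam (toComplex α) (AmPoly 𝒜 (Function.update m α 0))).coeff j := by
  set a₀ := totalMult 𝒜 (Function.update m α 0) with ha₀
  set κ := bilin (toComplex α) (toComplex α) with hκ
  set B := AmPoly 𝒜 (Function.update m α 0) with hB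
  have hκ0 : κ ≠ 0 := bilin_self_ne_zero (h_ne α hα)
  have hup : a₀ + m α = totalMult 𝒜 m := totalMult_update hα m 0
  have := apply_coeff_eq ((MvPolynomial.aeval (toComplex x)).toLinearMap.comp
    (MvPolynomial.homogeneousComponent a₀)) (P := P)
    (q := Polynomial.C (oddProd (m α) * κ ^ m α * MvPolynomial.eval (toComplex x) B)
      * line lam (toComplex α) B) (fun c hc => ?_) j
  · rw [Polynomial.coeff_C_mul] at this
    exact this
  · have hγ : bilin (lam + c • toComplex α) (toComplex α) = c * κ := by
      rw [bilin_add_left, bilin_smul_left, hlam, zero_add]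
    have hq := (hP c).quasiInv α hα
    rw [hγ] at hq
    -- In x-degree |m| - m_α the diagonal polynomial has degree at most m_α and satisfies m_α odd
    -- conditions. Its coefficient of t^{m_α} comes from the known top part A_m(x)A_m(λ + cα), and
    -- this determines its constant coefficient.
    have h1 := coeff_zero_of_expDeriv_odd (mul_ne_zero hc hκ0)
      (q := diagPoly (P.eval (MvPolynomial.C c)) (toComplex x) (toComplex α) a₀)
      ((natDegree_diagPoly_le (hP c).totalDegree_le _ _ _).trans (by omega))
      (fun k hk => hq.diagPoly hx hk a₀)
    have h2 : (line (toComplex x) (toComplex α) (linForm α ^ m α * B)).coeff (m α)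
        = κ ^ m α * MvPolynomial.eval (toComplex x) B := by
      rw [map_mul, map_pow, line_linForm, bilin_eq_zero_of_mem_hyperplane hx, map_zero, zero_add,
        mul_pow, ← map_pow, mul_assoc, Polynomial.coeff_C_mul, Polynomial.coeff_X_pow_mul',
        if_pos le_rfl, Nat.sub_self, coeff_zero_line]
    rw [coeff_diagPoly, coeff_diagPoly, add_zero, coeff_zero_line, hup, (hP c).top,
      ← MvPolynomial.smul_eq_C_mul, map_smul, Polynomial.coeff_smul,
      ← eval_AmPoly, AmPoly_eq_mul hα, ← hB, h2, map_mul, map_pow, eval_linForm, hγ,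
      smul_eq_mul] at h1
    change MvPolynomial.eval (toComplex x) (MvPolynomial.homogeneousComponent a₀
      (P.eval (MvPolynomial.C c))) = _
    rw [Polynomial.eval_mul, Polynomial.eval_C, eval_line]
    have hne : (c * κ) ^ m α ≠ 0 := pow_ne_zero _ (mul_ne_zero hc hκ0)
    refine mul_right_cancel₀ hne ?_
    rw [h1]; ring

end Family

/-! ### Vanishing of the odd Taylor coefficients -/

section Family

variable {𝒜 : Finset (Fin n → ℝ)} {m : (Fin n → ℝ) → ℕ} {α l : Fin n → ℝ}
  {P : Polynomial (MvPolynomial (Fin n) ℂ)}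

/-- A component of `Q_J` of degree `|m| - m_α` exceeding no other component is a multiple of
`∏_{β ≠ α} (x, β)^{m_β}`, with an explicit factor. -/
theorem homogeneousComponent_lamCoeff_eq (h_ne : ∀ α ∈ 𝒜, α ≠ 0)
    (h_nc : ∀ α ∈ 𝒜, ∀ β ∈ 𝒜, α ≠ β → LinearIndependent ℝ ![α, β]) (hα : α ∈ 𝒜)
    (hl : l ∈ hyperplane α)
    (hl' : ∀ β ∈ 𝒜, β ≠ α → bilin (toComplex l) (toComplex β) ≠ 0)
    (hP : ∀ c : ℂ, IsFactor 𝒜 m (toComplex l + c • toComplex α) (P.eval (MvPolynomial.C c)))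
    {J : ℕ} (hJ : (lamCoeff P α J).totalDegree ≤ totalMult 𝒜 (Function.update m α 0)) :
    MvPolynomial.homogeneousComponent (totalMult 𝒜 (Function.update m α 0)) (lamCoeff P α J)
      = MvPolynomial.C (oddProd (m α) * bilin (toComplex α) (toComplex α) ^ m α
        * (line (toComplex l) (toComplex α) (AmPoly 𝒜 (Function.update m α 0))).coeff J)
        * AmPoly 𝒜 (Function.update m α 0) := by
  obtain ⟨a, ha⟩ := eq_C_mul_of_AmPoly_dvd
    (MvPolynomial.homogeneousComponent_isHomogeneous _ _).totalDegree_le h_ne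
    (AmPoly_update_dvd_top (k := 0) h_ne h_nc hl' hP hJ fun x _ i hi => absurd hi (by omega))
  -- The scalar is found at the point l itself, where the product over β ≠ α is nonzero and Q_J
  -- agrees with the coefficient of c^J in the family.
  have hB := eval_AmPoly_update_ne_zero hl' m
  have h1 := eval_homogeneousComponent_lamCoeff (α := α) (P := P) hl
    (totalMult 𝒜 (Function.update m α 0)) J
  rw [eval_homogeneousComponent_coeff h_ne hα (bilin_eq_zero_of_mem_hyperplane hl) hP hl, ha,
    map_mul, MvPolynomial.eval_C] at h1
  rw [ha]
  congr 2
  refine mul_right_cancel₀ hB ?_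
  rw [h1]; ring

/-- For J = 0 the component of degree |m| - m_α is a nonzero multiple of ∏_{β≠α}(x, β)^{m_β}, and
the components of Q_0 have no odd normal coefficients of order below 2m_α. So the existence of a
Baker–Akhiezer function restricts the configuration itself. -/
theorem coeff_line_AmPoly_update (h_ne : ∀ α ∈ 𝒜, α ≠ 0)
    (h_nc : ∀ α ∈ 𝒜, ∀ β ∈ 𝒜, α ≠ β → LinearIndependent ℝ ![α, β]) (hα : α ∈ 𝒜)
    (hl : l ∈ hyperplane α)
    (hl' : ∀ β ∈ 𝒜, β ≠ α → bilin (toComplex l) (toComplex β) ≠ 0)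
    (hP : ∀ c : ℂ, IsFactor 𝒜 m (toComplex l + c • toComplex α) (P.eval (MvPolynomial.C c)))
    {k : ℕ} (hk : k < m α) {x : Fin n → ℝ} (hx : x ∈ hyperplane α) :
    (line (toComplex x) (toComplex α) (AmPoly 𝒜 (Function.update m α 0))).coeff (2 * k + 1)
      = 0 := by
  have hl0 := bilin_eq_zero_of_mem_hyperplane hl
  have hdeg := totalDegree_lamCoeff_le h_ne h_nc hα (by omega) hl0 hl' hP 0
  have hup := totalMult_update hα m 0
  have h1 := coeff_odd_lamCoeff hl0 hα hP hx hk (totalMult 𝒜 (Function.update m α 0)) 0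
  rw [homogeneousComponent_lamCoeff_eq h_ne h_nc hα hl hl' hP (by omega),
    ← MvPolynomial.smul_eq_C_mul, map_smul, Polynomial.coeff_smul, smul_eq_mul,
    coeff_zero_line] at h1
  exact (mul_eq_zero.1 h1).resolve_left (mul_ne_zero (mul_ne_zero (oddProd_ne_zero _)
    (pow_ne_zero _ (bilin_self_ne_zero (h_ne α hα)))) (eval_AmPoly_update_ne_zero hl' m))

/-- The odd Taylor coefficients in the spectral parameter vanish. -/
theorem lamCoeff_odd_eq_zero (h_ne : ∀ α ∈ 𝒜, α ≠ 0)
    (h_nc : ∀ α ∈ 𝒜, ∀ β ∈ 𝒜, α ≠ β → LinearIndependent ℝ ![α, β]) (hα : α ∈ 𝒜)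
    (hl : l ∈ hyperplane α)
    (hl' : ∀ β ∈ 𝒜, β ≠ α → bilin (toComplex l) (toComplex β) ≠ 0)
    (hP : ∀ c : ℂ, IsFactor 𝒜 m (toComplex l + c • toComplex α) (P.eval (MvPolynomial.C c)))
    {k : ℕ} (hk : k < m α) : lamCoeff P α (2 * k + 1) = 0 := by
  have hl0 := bilin_eq_zero_of_mem_hyperplane hl
  induction k using Nat.strong_induction_on with
  | _ k ih =>
    by_contra hne
    set N := (lamCoeff P α (2 * k + 1)).totalDegree with hN
    have hdeg := totalDegree_lamCoeff_le h_ne h_nc hα (by omega) hl0 hl' hP (2 * k + 1)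
    have hup := totalMult_update hα m 0
    refine homogeneousComponent_totalDegree_ne_zero hne ?_
    rcases lt_trichotomy N (totalMult 𝒜 (Function.update m α 0)) with h | h | h
    · exact eq_zero_of_AmPoly_dvd (N := N)
        (MvPolynomial.homogeneousComponent_isHomogeneous _ _).totalDegree_le h h_ne
        (AmPoly_update_dvd_top (k := 0) h_ne h_nc hl' hP le_rfl
          fun x _ i hi => absurd hi (by omega))
    -- The factor is an odd normal coefficient, of order 2k + 1, of the product over β ≠ α at l, so
    -- it vanishes.
    · rw [← hN, h, homogeneousComponent_lamCoeff_eq h_ne h_nc hα hl hl' hP (hN ▸ h.le),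
        coeff_line_AmPoly_update h_ne h_nc hα hl hl' hP hk hl]
      simp
    -- Here N = |m| - m_α + e with 0 < e ≤ 2k + 1 < 2m_α, so replacing m_α by min(2e, 2m_α) gives a
    -- divisor of degree greater than N. The bound 2e serves the count for even i, and 2m_α the
    -- quasi-invariance for odd i.
    · set e := N - totalMult 𝒜 (Function.update m α 0) with he
      have hup' := totalMult_update hα m (min (2 * e) (2 * m α))
      refine eq_zero_of_AmPoly_dvd (N := N)
        (k := Function.update m α (min (2 * e) (2 * m α)))
        (MvPolynomial.homogeneousComponent_isHomogeneous _ _).totalDegree_le (by omega) h_ne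
        (AmPoly_update_dvd_top h_ne h_nc hl' hP le_rfl fun x hx i hi hiN => ?_)
      rcases Nat.even_or_odd' i with ⟨i', rfl | rfl⟩
      -- Lowering the index by an even number keeps it odd, so the Taylor coefficients required by
      -- the count vanish by induction.
      · refine coeff_lamCoeff_eq_zero (h_ne α hα) hl0 hα hP hx (by omega) hiN (by omega)
          fun r hr hrJ => ?_
        rw [show 2 * k + 1 - (2 * i' - 2 * r) = 2 * (k - (i' - r)) + 1 by omega,
          ih (k - (i' - r)) (by omega) (by omega)]
        simp
      · exact coeff_odd_lamCoeff hl0 hα hP hx (by omega) _ _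

end Family

/-! ### Quasi-invariance in the spectral parameter -/

/-- The family of polynomials `F(·, l + c v)` as a polynomial in `c`. -/
noncomputable def paramLine (l v : Fin n → ℂ) :
    MvPolynomial (Fin n) (MvPolynomial (Fin n) ℂ) →+* Polynomial (MvPolynomial (Fin n) ℂ) :=
  MvPolynomial.eval₂Hom (MvPolynomial.eval₂Hom (Polynomial.C.comp MvPolynomial.C) fun j =>
    Polynomial.C (MvPolynomial.C (l j)) + Polynomial.C (MvPolynomial.C (v j)) * Polynomial.X)
    fun j => Polynomial.C (MvPolynomial.X j)

theorem eval_paramLine (l v : Fin n → ℂ) (F : MvPolynomial (Fin n) (MvPolynomial (Fin n) ℂ))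
    (c : ℂ) : (paramLine l v F).eval (MvPolynomial.C c)
      = MvPolynomial.map (MvPolynomial.eval (l + c • v)) F := by
  have : (Polynomial.evalRingHom (MvPolynomial.C c)).comp (paramLine l v)
      = MvPolynomial.map (MvPolynomial.eval (l + c • v)) := by
    refine MvPolynomial.ringHom_ext' (MvPolynomial.ringHom_ext (fun a => ?_) fun j => ?_)
      fun j => ?_
    · simp [paramLine]
    · simp [paramLine, -Polynomial.X_mul_C]
      ring
    · simp [paramLine]
  exact congrArg (fun f => f F) this

/-- The polynomial `F(x, ·)` in the spectral parameter. -/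
noncomputable def atPoint (F : MvPolynomial (Fin n) (MvPolynomial (Fin n) ℂ)) (x : Fin n → ℂ) :
    MvPolynomial (Fin n) ℂ :=
  MvPolynomial.eval (fun j => MvPolynomial.C (x j)) F

theorem eval_atPoint (F : MvPolynomial (Fin n) (MvPolynomial (Fin n) ℂ)) (x lam : Fin n → ℂ) :
    MvPolynomial.eval lam (atPoint F x)
      = MvPolynomial.eval x (MvPolynomial.map (MvPolynomial.eval lam) F) := by
  have : (MvPolynomial.eval lam).comp (MvPolynomial.eval (fun j => MvPolynomial.C (x j)))
      = (MvPolynomial.eval x).comp (MvPolynomial.map (MvPolynomial.eval lam)) := by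
    refine MvPolynomial.ringHom_ext' (MvPolynomial.ringHom_ext (fun a => ?_) fun j => ?_)
      fun j => ?_
    · simp
    · simp
    · simp
  exact congrArg (fun f => f F) this

/-- `expDeriv N γ` along the direction `α`, as a polynomial in the base point. -/
noncomputable def normalDeriv (N : ℕ) (γ : ℂ) (α : Fin n → ℝ) (Q : MvPolynomial (Fin n) ℂ) :
    MvPolynomial (Fin n) ℂ :=
  ∑ j ∈ Finset.range (N + 1), MvPolynomial.C (N.descFactorial j * γ ^ (N - j) : ℂ)
    * (lineMv (toComplex α) Q).coeff j

theorem eval_normalDeriv (N : ℕ) (γ : ℂ) (α : Fin n → ℝ) (Q : MvPolynomial (Fin n) ℂ)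
    (x : Fin n → ℂ) :
    MvPolynomial.eval x (normalDeriv N γ α Q) = expDeriv N γ (line x (toComplex α) Q) := by
  rw [normalDeriv, map_sum, expDeriv_apply]
  refine Finset.sum_congr rfl fun j _ => ?_
  rw [map_mul, MvPolynomial.eval_C, coeff_line]

theorem QuasiInv.of_bilin_eq_zero {α : Fin n → ℝ} (hα : α ≠ 0) {k : ℕ} {γ : ℂ}
    {Q : MvPolynomial (Fin n) ℂ} (hQ : QuasiInv α k γ Q) {x : Fin n → ℂ}
    (hx : bilin x (toComplex α) = 0) {j : ℕ} (hj : j < k) :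
    expDeriv (2 * j + 1) γ (line x (toComplex α) Q) = 0 := by
  rw [← eval_normalDeriv]
  refine eval_eq_zero_of_hyperplane hα (fun y hy => ?_) hx
  rw [eval_normalDeriv, hQ y hy j hj]

/-- A polynomial vanishing at the generic points of a hyperplane vanishes on it. -/
theorem eval_eq_zero_of_generic {𝒜 : Finset (Fin n → ℝ)} (h_ne : ∀ α ∈ 𝒜, α ≠ 0)
    (h_nc : ∀ α ∈ 𝒜, ∀ β ∈ 𝒜, α ≠ β → LinearIndependent ℝ ![α, β]) {α : Fin n → ℝ}
    (hα : α ∈ 𝒜) {S : MvPolynomial (Fin n) ℂ}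
    (hS : ∀ x ∈ hyperplane α, (∀ β ∈ 𝒜, β ≠ α → bilin (toComplex x) (toComplex β) ≠ 0) →
      MvPolynomial.eval (toComplex x) S = 0) {x : Fin n → ℝ} (hx : x ∈ hyperplane α) :
    MvPolynomial.eval (toComplex x) S = 0 := by
  have h1 : linForm α ∣ S * ∏ β ∈ 𝒜.erase α, linForm β := by
    rw [linForm_dvd_iff (h_ne α hα)]
    intro y hy
    rw [map_mul, map_prod]
    by_cases h : ∀ β ∈ 𝒜, β ≠ α → bilin (toComplex y) (toComplex β) ≠ 0
    · rw [hS y hy h, zero_mul]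
    · push Not at h
      obtain ⟨β, hβ, hne, h0⟩ := h
      rw [Finset.prod_eq_zero (Finset.mem_erase.2 ⟨hne, hβ⟩) (by rw [eval_linForm, h0]), mul_zero]
  have hp := prime_linForm (h_ne α hα)
  rcases hp.dvd_or_dvd h1 with h | h
  · exact (linForm_dvd_iff (h_ne α hα) S).1 h x hx
  · obtain ⟨β, hβ, hd⟩ := (hp.dvd_finsetProd_iff _).1 h
    rw [Finset.mem_erase] at hβ
    exact absurd hd (not_linForm_dvd (h_ne α hα) (h_nc α hα β hβ.2 hβ.1.symm))

/-- The Taylor coefficient in c is read in the other variable: for fixed x it is a normal derivative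
of F(x, ·)e^{(x, ·)} at l. -/
theorem factorial_mul_eval_lamCoeff (F : MvPolynomial (Fin n) (MvPolynomial (Fin n) ℂ))
    (l : Fin n → ℂ) (α : Fin n → ℝ) (x : Fin n → ℂ) (N : ℕ) :
    N.factorial * MvPolynomial.eval x (lamCoeff (paramLine l (toComplex α) F) α N)
      = expDeriv N (bilin x (toComplex α)) (line l (toComplex α) (atPoint F x)) := by
  have h1 : ∀ j, MvPolynomial.eval x ((paramLine l (toComplex α) F).coeff j)
      = (line l (toComplex α) (atPoint F x)).coeff j := by
    intro j
    exact apply_coeff_eq (MvPolynomial.aeval x).toLinearMap (fun c _ => by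
      rw [eval_paramLine, eval_line, eval_atPoint]; rfl) j
  rw [expDeriv_apply, ← Finset.sum_range_reflect, lamCoeff, map_sum, Finset.mul_sum]
  refine Finset.sum_congr rfl fun r hr => ?_
  have hr' : r ≤ N := Nat.lt_succ_iff.1 (Finset.mem_range.1 hr)
  rw [show N + 1 - 1 - r = N - r by omega, MvPolynomial.smul_eval, map_mul, map_pow, h1,
    eval_linForm, show N - (N - r) = r by omega]
  have h2 : (r.factorial : ℂ) * (N.descFactorial (N - r) : ℂ) = N.factorial := by
    have := Nat.factorial_mul_descFactorial (n := N) (k := N - r) (by omega)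
    rw [show N - (N - r) = r by omega] at this
    exact_mod_cast this
  have h3 : (r.factorial : ℂ) ≠ 0 := Nat.cast_ne_zero.2 r.factorial_ne_zero
  rw [← h2]
  field_simp

section Dual

variable {𝒜 : Finset (Fin n → ℝ)} {m : (Fin n → ℝ) → ℕ}
  {F : MvPolynomial (Fin n) (MvPolynomial (Fin n) ℂ)}

/-- This is the duality of the two arguments: at generic points of Π_α it is the vanishing of the
odd Taylor coefficients, and it extends to all of Π_α because the condition is polynomial in the
base point. -/
theorem quasiInv_atPoint (h_ne : ∀ α ∈ 𝒜, α ≠ 0)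
    (h_nc : ∀ α ∈ 𝒜, ∀ β ∈ 𝒜, α ≠ β → LinearIndependent ℝ ![α, β])
    (hF : ∀ lam, IsFactor 𝒜 m lam (MvPolynomial.map (MvPolynomial.eval lam) F))
    {α : Fin n → ℝ} (hα : α ∈ 𝒜) (x : Fin n → ℂ) :
    QuasiInv α (m α) (bilin x (toComplex α)) (atPoint F x) := by
  intro l hl j hj
  rw [← eval_normalDeriv]
  refine eval_eq_zero_of_generic h_ne h_nc hα (fun l hl hl' => ?_) hl
  rw [eval_normalDeriv, ← factorial_mul_eval_lamCoeff,
    lamCoeff_odd_eq_zero h_ne h_nc hα hl hl' (fun c => by rw [eval_paramLine]; exact hF _) hj]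
  simp

/-- The odd normal derivatives of `∏_{β ≠ α} (x, β)^{m_β}` of order less than `2 m_α` vanish on
`(x, α) = 0`. -/
theorem coeff_odd_line_AmPoly (h_ne : ∀ α ∈ 𝒜, α ≠ 0)
    (h_nc : ∀ α ∈ 𝒜, ∀ β ∈ 𝒜, α ≠ β → LinearIndependent ℝ ![α, β])
    (hF : ∀ lam, IsFactor 𝒜 m lam (MvPolynomial.map (MvPolynomial.eval lam) F))
    {α : Fin n → ℝ} (hα : α ∈ 𝒜) {k : ℕ} (hk : k < m α) {x : Fin n → ℂ}
    (hx : bilin x (toComplex α) = 0) :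
    (line x (toComplex α) (AmPoly 𝒜 (Function.update m α 0))).coeff (2 * k + 1) = 0 := by
  obtain ⟨l, hl, hl'⟩ := exists_generic_mem_hyperplane h_ne h_nc hα
  rw [coeff_line]
  refine eval_eq_zero_of_hyperplane (h_ne α hα) (fun y hy => ?_) hx
  rw [← coeff_line]
  exact coeff_line_AmPoly_update h_ne h_nc hα hl hl'
    (P := paramLine (toComplex l) (toComplex α) F) (fun c => by rw [eval_paramLine]; exact hF _)
    hk hy

end Dual

/-! ### Homogeneity -/

theorem expDeriv_comp_C_mul_X (N : ℕ) (γ s : ℂ) (q : Polynomial ℂ) :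
    expDeriv N (s * γ) (q.comp (Polynomial.C s * Polynomial.X)) = s ^ N * expDeriv N γ q := by
  rw [expDeriv_apply, expDeriv_apply, Finset.mul_sum]
  refine Finset.sum_congr rfl fun j hj => ?_
  have hj' : j ≤ N := Nat.lt_succ_iff.1 (Finset.mem_range.1 hj)
  rw [Polynomial.comp_C_mul_X_coeff, mul_pow, ← Nat.sub_add_cancel hj', pow_add,
    Nat.sub_add_cancel hj']
  ring

/-- The polynomial `Q(s x)`. -/
noncomputable def dilate (s : ℂ) (Q : MvPolynomial (Fin n) ℂ) : MvPolynomial (Fin n) ℂ :=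
  ∑ N ∈ Finset.range (Q.totalDegree + 1), s ^ N • MvPolynomial.homogeneousComponent N Q

theorem eval_dilate (s : ℂ) (Q : MvPolynomial (Fin n) ℂ) (x : Fin n → ℂ) :
    MvPolynomial.eval x (dilate s Q) = MvPolynomial.eval (s • x) Q := by
  conv_rhs => rw [← MvPolynomial.sum_homogeneousComponent Q]
  rw [dilate, map_sum, map_sum]
  refine Finset.sum_congr rfl fun N _ => ?_
  rw [MvPolynomial.smul_eval,
    eval_smul_of_isHomogeneous (MvPolynomial.homogeneousComponent_isHomogeneous _ _)]

theorem totalDegree_dilate_le (s : ℂ) (Q : MvPolynomial (Fin n) ℂ) :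
    (dilate s Q).totalDegree ≤ Q.totalDegree := by
  refine MvPolynomial.totalDegree_finsetSum_le fun N hN => ?_
  refine (MvPolynomial.totalDegree_smul_le _ _).trans ?_
  refine (MvPolynomial.homogeneousComponent_isHomogeneous _ _).totalDegree_le.trans ?_
  exact Nat.lt_succ_iff.1 (Finset.mem_range.1 hN)

theorem homogeneousComponent_dilate (s : ℂ) (Q : MvPolynomial (Fin n) ℂ) (N : ℕ) :
    MvPolynomial.homogeneousComponent N (dilate s Q)
      = s ^ N • MvPolynomial.homogeneousComponent N Q := by
  rw [dilate, map_sum]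
  simp only [map_smul, MvPolynomial.homogeneousComponent_of_mem
    (MvPolynomial.homogeneousComponent_mem _ _)]
  simp only [smul_ite, smul_zero]
  rw [Finset.sum_ite_eq]
  split_ifs with h
  · rfl
  · rw [MvPolynomial.homogeneousComponent_eq_zero, smul_zero]
    simp at h; omega

theorem Am_smul (𝒜 : Finset (Fin n → ℝ)) (m : (Fin n → ℝ) → ℕ) (s : ℂ) (x : Fin n → ℂ) :
    Am 𝒜 m (s • x) = s ^ totalMult 𝒜 m * Am 𝒜 m x := by
  rw [← eval_AmPoly, ← eval_AmPoly, eval_smul_of_isHomogeneous (isHomogeneous_AmPoly 𝒜 m)]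

theorem IsFactor.dilate {𝒜 : Finset (Fin n → ℝ)} {m : (Fin n → ℝ) → ℕ} {lam : Fin n → ℂ}
    {P : MvPolynomial (Fin n) ℂ} (hP : IsFactor 𝒜 m lam P) (s : ℝ) :
    IsFactor 𝒜 m ((s : ℂ) • lam) (dilate s P) := by
  refine ⟨(totalDegree_dilate_le _ _).trans hP.totalDegree_le, ?_, fun α hα x hx j hj => ?_⟩
  · rw [homogeneousComponent_dilate, hP.top, Am_smul, map_mul, mul_assoc,
      ← MvPolynomial.smul_eq_C_mul (_ * _)]
  · have : line (toComplex x) (toComplex α) (BakerAkhiezer.dilate s P)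
        = (line (toComplex (s • x)) (toComplex α) P).comp (Polynomial.C (s : ℂ) * Polynomial.X) := by
      refine Polynomial.funext fun t => ?_
      rw [eval_line, eval_dilate, Polynomial.eval_comp, eval_line, toComplex_smul, smul_add,
        smul_smul]
      simp
    rw [this, bilin_smul_left, expDeriv_comp_C_mul_X,
      hP.quasiInv α hα _ (smul_mem_hyperplane hx s) j hj, mul_zero]

/-- The dilated polynomial P(sx, λ) satisfies the defining properties at sλ, so uniqueness gives
P(x, sλ) = P(sx, λ). This is used for the limit λ → ∞. -/
theorem IsFactor.eval_smul {𝒜 : Finset (Fin n → ℝ)} (h_ne : ∀ α ∈ 𝒜, α ≠ 0)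
    (h_nc : ∀ α ∈ 𝒜, ∀ β ∈ 𝒜, α ≠ β → LinearIndependent ℝ ![α, β]) {m : (Fin n → ℝ) → ℕ}
    {lam : Fin n → ℂ} (hlam : ∀ α ∈ 𝒜, bilin lam (toComplex α) ≠ 0) {s : ℝ} (hs : s ≠ 0)
    {P P' : MvPolynomial (Fin n) ℂ} (hP : IsFactor 𝒜 m lam P)
    (hP' : IsFactor 𝒜 m ((s : ℂ) • lam) P') (x : Fin n → ℂ) :
    MvPolynomial.eval x P' = MvPolynomial.eval ((s : ℂ) • x) P := by
  rw [← eval_dilate, hP'.eq h_ne h_nc (fun α hα => ?_) (hP.dilate s)]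
  rw [bilin_smul_left]
  exact mul_ne_zero (by exact_mod_cast hs) (hlam α hα)

/-! ### Complex analysis in one variable -/

open Filter Topology in
/-- A function with a zero of order `k` at the centre of a disc is bounded by a multiple of the
`k`-th power of the distance to the centre. -/
theorem norm_le_mul_pow_of_iteratedDeriv_eq_zero {f : ℂ → ℂ} {R M : ℝ}
    (hf : Differentiable ℂ f) (hM : ∀ z ∈ Metric.ball (0 : ℂ) R, ‖f z‖ ≤ M) {k : ℕ}
    (hk : ∀ i < k, iteratedDeriv i f 0 = 0) {z : ℂ} (hz : ‖z‖ < R) :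
    ‖f z‖ ≤ M * (‖z‖ / R) ^ k := by
  cases k with
  | zero => simpa using hM z (by simpa using hz)
  | succ N =>
    have h0 : f 0 = 0 := by simpa using hk 0 (Nat.succ_pos N)
    have hA : AnalyticAt ℂ f 0 := hf.analyticAt 0
    obtain ⟨g, hg, hfg⟩ := (natCast_le_analyticOrderAt hA).1
      ((natCast_le_analyticOrderAt_iff_iteratedDeriv_eq_zero hA).2 hk)
    have hd := Complex.dist_le_mul_div_pow_of_mapsTo_ball_of_isLittleO (f := f) (c := 0) (z := z)
      (R₁ := R) (R₂ := M) (n := N) hf.differentiableOn ?_ ?_ (by simpa using hz)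
    · simpa [h0] using hd
    · intro w hw
      simpa [h0] using hM w hw
    · have h1 : (fun w : ℂ => w ^ (N + 1) • g w) =o[𝓝 0] fun w => ‖w‖ ^ N := by
        have h2 : (fun w : ℂ => w • g w) =o[𝓝 0] fun _ => (1 : ℝ) := by
          rw [Asymptotics.isLittleO_one_iff]
          have h3 : ContinuousAt (fun w : ℂ => w • g w) 0 := continuousAt_id.smul hg.continuousAt
          simpa [ContinuousAt] using h3
        have h3 : (fun w : ℂ => w ^ N) =O[𝓝 0] fun w => ‖w‖ ^ N :=
          Asymptotics.isBigO_of_le _ fun w => by simp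
        refine (h3.mul_isLittleO h2).congr (fun w => ?_) fun w => by simp
        simp only [smul_eq_mul]; ring
      simp only [h0, sub_zero]
      exact h1.congr' (hfg.mono fun w hw => by simpa using hw.symm) (Eventually.of_forall
        fun _ => rfl)

open Filter Topology in
theorem iteratedDeriv_eq_zero_of_norm_le {f : ℂ → ℂ} (hf : AnalyticAt ℂ f 0) {k : ℕ} {C : ℝ}
    (h : ∀ᶠ z in 𝓝 (0 : ℂ), ‖f z‖ ≤ C * ‖z‖ ^ k) {i : ℕ} (hi : i < k) :
    iteratedDeriv i f 0 = 0 := by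
  have h' : (k : ℕ∞) ≤ analyticOrderAt f 0 := by
    by_contra hlt
    push Not at hlt
    obtain ⟨p, hp⟩ := ENat.ne_top_iff_exists.1 hlt.ne_top
    rw [← hp, Nat.cast_lt] at hlt
    obtain ⟨g, hg, hg0, hfg⟩ := (hf.analyticOrderAt_eq_natCast).1 hp.symm
    refine hg0 ?_
    have h1 : ∀ᶠ z in 𝓝[≠] (0 : ℂ), ‖g z‖ ≤ C * ‖z‖ ^ (k - p) := by
      filter_upwards [nhdsWithin_le_nhds h, nhdsWithin_le_nhds hfg, self_mem_nhdsWithin]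
        with z h2 h3 h4
      rw [h3, sub_zero, norm_smul, norm_pow] at h2
      have h5 : 0 < ‖z‖ ^ p := pow_pos (norm_pos_iff.2 h4) p
      refine le_of_mul_le_mul_left (h2.trans_eq ?_) h5
      rw [← Nat.sub_add_cancel hlt.le, pow_add, Nat.add_sub_cancel]; ring
    have h2 : Tendsto (fun z : ℂ => C * ‖z‖ ^ (k - p)) (𝓝[≠] 0) (𝓝 0) := by
      have : Continuous fun z : ℂ => C * ‖z‖ ^ (k - p) := by fun_prop
      have h3 := (this.tendsto 0).mono_left (nhdsWithin_le_nhds (s := {0}ᶜ))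
      simpa [Nat.sub_ne_zero_of_lt hlt] using h3
    exact tendsto_nhds_unique (hg.continuousAt.tendsto.mono_left nhdsWithin_le_nhds)
      (squeeze_zero_norm' h1 h2)
  exact (natCast_le_analyticOrderAt_iff_iteratedDeriv_eq_zero hf).1 h' i hi

theorem iteratedDeriv_sub_comp_neg {f : ℂ → ℂ} (hf : Differentiable ℂ f) (i : ℕ) :
    iteratedDeriv i (fun z => f z - f (-z)) 0 = (1 - (-1) ^ i) * iteratedDeriv i f 0 := by
  have hc : ContDiff ℂ i f := hf.contDiff
  have h1 := iteratedDeriv_fun_sub (n := i) (x := (0 : ℂ)) (f := f) (g := fun z => f (-z))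
    hc.contDiffAt (hc.comp contDiff_neg).contDiffAt
  rw [h1, iteratedDeriv_comp_neg, neg_zero, smul_eq_mul]
  ring

/-- If the odd derivatives of order less than `2 * k` vanish then `f(z) - f(-z)` vanishes to order
`2 * k`. -/
theorem iteratedDeriv_sub_comp_neg_eq_zero {f : ℂ → ℂ} (hf : Differentiable ℂ f) {k : ℕ}
    (h : ∀ j < k, iteratedDeriv (2 * j + 1) f 0 = 0) {i : ℕ} (hi : i < 2 * k) :
    iteratedDeriv i (fun z => f z - f (-z)) 0 = 0 := by
  rw [iteratedDeriv_sub_comp_neg hf]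
  rcases Nat.even_or_odd' i with ⟨j, rfl | rfl⟩
  · simp
  · rw [h j (by omega), mul_zero]

/-- Liouville's theorem for functions of polynomial growth. -/
theorem exists_polynomial_of_growth {f : ℂ → ℂ} (hf : Differentiable ℂ f) {C : ℝ} {K : ℕ}
    (h : ∀ z, ‖f z‖ ≤ C * (1 + ‖z‖) ^ K) :
    ∃ p : Polynomial ℂ, p.natDegree ≤ K ∧ ∀ z, f z = p.eval z := by
  have h0 : ∀ i, K < i → iteratedDeriv i f 0 = 0 := by
    intro i hi
    have hC : 0 ≤ C := by simpa using (norm_nonneg _).trans (h 0)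
    have h1 : ∀ R : ℝ, 1 ≤ R → ‖iteratedDeriv i f 0‖ ≤ i.factorial * C * 2 ^ K * R⁻¹ := by
      intro R hR
      have hR0 : 0 < R := by linarith
      have h2 := Complex.norm_iteratedDeriv_le_of_forall_mem_sphere_norm_le (c := 0) (f := f)
        (C := C * (2 * R) ^ K) i hR0 hf.diffContOnCl fun z hz => by
          refine (h z).trans ?_
          have : ‖z‖ = R := by simpa using hz
          gcongr
          rw [this]; linarith
      refine h2.trans ?_
      rw [div_le_iff₀ (pow_pos hR0 i)]
      have h3 : R ^ K ≤ R⁻¹ * R ^ i := by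
        rw [inv_mul_eq_div, le_div_iff₀ hR0, ← pow_succ]
        exact pow_le_pow_right₀ hR hi
      rw [mul_pow]
      calc (i.factorial : ℝ) * (C * (2 ^ K * R ^ K)) = i.factorial * C * 2 ^ K * R ^ K := by ring
        _ ≤ i.factorial * C * 2 ^ K * (R⁻¹ * R ^ i) := by gcongr
        _ = _ := by ring
    have h2 : ‖iteratedDeriv i f 0‖ ≤ 0 := by
      refine ge_of_tendsto (x := Filter.atTop) (f := fun R : ℝ => i.factorial * C * 2 ^ K * R⁻¹)
        ?_ (Filter.eventually_atTop.2 ⟨1, h1⟩)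
      simpa using tendsto_inv_atTop_zero.const_mul ((i.factorial : ℝ) * C * 2 ^ K)
    exact norm_le_zero_iff.1 h2
  refine ⟨∑ i ∈ Finset.range (K + 1), Polynomial.monomial i
    ((i.factorial : ℂ)⁻¹ * iteratedDeriv i f 0), ?_, fun z => ?_⟩
  · refine Polynomial.natDegree_sum_le_of_forall_le _ _ fun i hi => ?_
    exact (Polynomial.natDegree_monomial_le _).trans (Nat.lt_succ_iff.1 (Finset.mem_range.1 hi))
  · have h1 := Complex.taylorSeries_eq_of_entire' (c := 0) (z := z) hf
    rw [← h1, tsum_eq_sum (s := Finset.range (K + 1)), Polynomial.eval_finsetSum]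
    · refine Finset.sum_congr rfl fun i _ => ?_
      rw [Polynomial.eval_monomial, sub_zero]
    · intro i hi
      rw [h0 i (by simpa using hi)]; simp

open Filter Topology in
/-- Differentiability of integrals depending holomorphically on a parameter. -/
theorem differentiableOn_integral {X : Type*} [MeasurableSpace X] {ν : Measure X}
    {H : ℂ → X → ℂ} {W : X → ℝ} {U : Set ℂ} (hU : IsOpen U)
    (hd : ∀ y, DifferentiableOn ℂ (fun z => H z y) U)
    (hm : ∀ z ∈ U, AEStronglyMeasurable (H z) ν) (hW : Integrable W ν)
    (hb : ∀ z ∈ U, ∀ y, ‖H z y‖ ≤ W y) :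
    DifferentiableOn ℂ (fun z => ∫ y, H z y ∂ν) U := by
  intro z₀ hz₀
  refine DifferentiableAt.differentiableWithinAt ?_
  obtain ⟨R, hR, hRU⟩ := Metric.isOpen_iff.1 hU z₀ hz₀
  have hR2 : 0 < R / 2 := by positivity
  have hsub : Metric.ball z₀ (R / 2) ⊆ U :=
    (Metric.ball_subset_ball (by linarith)).trans hRU
  have hda : ∀ z ∈ Metric.ball z₀ (R / 2), ∀ y, HasDerivAt (fun z => H z y)
      (deriv (fun z => H z y) z) z := fun z hz y =>
    ((hd y z (hsub hz)).differentiableAt (hU.mem_nhds (hsub hz))).hasDerivAt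
  refine (hasDerivAt_integral_of_dominated_loc_of_deriv_le
    (F' := fun z y => deriv (fun z => H z y) z) (bound := fun y => W y / (R / 2))
    (Metric.ball_mem_nhds z₀ hR2) ?_ ?_ ?_ ?_ (hW.div_const _) ?_).2.differentiableAt
  · filter_upwards [hU.mem_nhds hz₀] with z hz using hm z hz
  · exact hW.mono' (hm z₀ hz₀) (Eventually.of_forall (hb z₀ hz₀))
  -- Measurability of the derivative at z₀ comes from difference quotients along a sequence; the
  -- bound below is Cauchy's estimate on circles of radius R/2.
  · have hseq : Tendsto (fun k : ℕ => ((R / 4 / (k + 1) : ℝ) : ℂ)) atTop (𝓝[≠] 0) := by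
      refine tendsto_nhdsWithin_iff.2 ⟨?_, Eventually.of_forall fun k => ?_⟩
      · have : Tendsto (fun k : ℕ => (R / 4 * (1 / ((k : ℝ) + 1)) : ℝ)) atTop (𝓝 0) := by
          simpa using tendsto_one_div_add_atTop_nhds_zero_nat.const_mul (R / 4)
        have h2 := (Complex.continuous_ofReal.tendsto 0).comp this
        refine h2.congr' (Eventually.of_forall fun k => ?_) |>.trans (by simp)
        simp only [Function.comp]
        congr 1; ring
      · have : (0 : ℝ) < R / 4 / (k + 1) := by positivity
        simpa using (by exact_mod_cast this.ne' : ((R / 4 / (k + 1) : ℝ) : ℂ) ≠ 0)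
    refine aestronglyMeasurable_of_tendsto_ae atTop
      (f := fun (k : ℕ) y => ((R / 4 / (k + 1) : ℝ) : ℂ)⁻¹ •
        (H (z₀ + ((R / 4 / (k + 1) : ℝ) : ℂ)) y - H z₀ y)) (fun k => ?_)
      (Eventually.of_forall fun y => ?_)
    · have hU' : z₀ + ((R / 4 / (k + 1) : ℝ) : ℂ) ∈ U := by
        refine hRU ?_
        have : (0 : ℝ) < R / 4 / (k + 1) := by positivity
        rw [Metric.mem_ball, dist_eq_norm, add_sub_cancel_left, Complex.norm_real,
          Real.norm_of_nonneg this.le]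
        have : R / 4 / ((k : ℝ) + 1) ≤ R / 4 :=
          div_le_self (by positivity) (by linarith [k.cast_nonneg (α := ℝ)])
        linarith
      have h1 : AEStronglyMeasurable
          (fun y => H (z₀ + ((R / 4 / (k + 1) : ℝ) : ℂ)) y - H z₀ y) ν := (hm _ hU').sub (hm _ hz₀)
      exact h1.const_smul (((R / 4 / (k + 1) : ℝ) : ℂ)⁻¹)
    · exact (hda z₀ (Metric.mem_ball_self hR2) y).tendsto_slope_zero.comp hseq
  · refine Eventually.of_forall fun y z hz => ?_
    refine Complex.norm_deriv_le_of_forall_mem_sphere_norm_le hR2 ?_ fun w hw => ?_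
    · refine DifferentiableOn.diffContOnCl_ball (U := U) (hd y) fun w hw => hRU ?_
      rw [Metric.mem_ball]
      have h1 := Metric.mem_closedBall.1 hw
      have h2 := Metric.mem_ball.1 hz
      linarith [dist_triangle w z z₀]
    · refine hb w (hRU ?_) y
      have h1 := Metric.mem_sphere.1 hw
      have h2 := Metric.mem_ball.1 hz
      rw [Metric.mem_ball]
      linarith [dist_triangle w z z₀]
  · exact Eventually.of_forall fun y z hz => hda z hz y

/-! ### Growth estimates -/

theorem norm_prod_pow_le (x : Fin n → ℂ) (d : Fin n →₀ ℕ) {N : ℕ} (hd : d.degree ≤ N) :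
    ‖∏ j ∈ d.support, x j ^ d j‖ ≤ (1 + ‖x‖) ^ N := by
  rw [norm_prod]
  calc ∏ j ∈ d.support, ‖x j ^ d j‖ ≤ ∏ j ∈ d.support, (1 + ‖x‖) ^ d j := by
        refine Finset.prod_le_prod (fun _ _ => norm_nonneg _) fun j _ => ?_
        rw [norm_pow]
        have := norm_le_pi_norm x j
        gcongr
        linarith
    _ = (1 + ‖x‖) ^ d.degree := by rw [Finset.prod_pow_eq_pow_sum]; rfl
    _ ≤ _ := pow_le_pow_right₀ (by linarith [norm_nonneg x]) hd

theorem degree_le_totalDegree {R : Type*} [CommSemiring R] {Q : MvPolynomial (Fin n) R}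
    {d : Fin n →₀ ℕ} (hd : d ∈ Q.support) : d.degree ≤ Q.totalDegree := by
  have := MvPolynomial.le_totalDegree hd
  rwa [Finsupp.sum] at this

theorem exists_norm_eval_le (Q : MvPolynomial (Fin n) ℂ) {N : ℕ} (hN : Q.totalDegree ≤ N) :
    ∃ C : ℝ, 0 ≤ C ∧ ∀ x, ‖MvPolynomial.eval x Q‖ ≤ C * (1 + ‖x‖) ^ N := by
  refine ⟨∑ d ∈ Q.support, ‖Q.coeff d‖, Finset.sum_nonneg fun _ _ => norm_nonneg _, fun x => ?_⟩
  rw [MvPolynomial.eval_eq, Finset.sum_mul]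
  refine norm_sum_le_of_le _ fun d hd => ?_
  rw [norm_mul]
  exact mul_le_mul_of_nonneg_left (norm_prod_pow_le x d ((degree_le_totalDegree hd).trans hN))
    (norm_nonneg _)

theorem exists_norm_eval_map_le (F : MvPolynomial (Fin n) (MvPolynomial (Fin n) ℂ)) :
    ∃ C : ℝ, ∃ N : ℕ, 0 ≤ C ∧ ∀ x lam,
      ‖MvPolynomial.eval x (MvPolynomial.map (MvPolynomial.eval lam) F)‖
        ≤ C * ((1 + ‖x‖) ^ N * (1 + ‖lam‖) ^ N) := by
  choose C hC0 hC using fun d => exists_norm_eval_le (F.coeff d) le_rfl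
  set N := max F.totalDegree (F.support.sup fun d => (F.coeff d).totalDegree) with hN
  refine ⟨∑ d ∈ F.support, C d, N, Finset.sum_nonneg fun _ _ => hC0 _, fun x lam => ?_⟩
  rw [MvPolynomial.eval_map, MvPolynomial.eval₂_eq, Finset.sum_mul]
  refine norm_sum_le_of_le _ fun d hd => ?_
  rw [norm_mul, mul_comm ((1 + ‖x‖) ^ N), ← mul_assoc]
  have h1 : (F.coeff d).totalDegree ≤ N :=
    (Finset.le_sup (f := fun d => (F.coeff d).totalDegree) hd).trans (le_max_right _ _)
  refine mul_le_mul ((hC d lam).trans ?_)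
    (norm_prod_pow_le x d ((degree_le_totalDegree hd).trans (le_max_left _ _)))
    (norm_nonneg _) (mul_nonneg (hC0 d) (by positivity))
  exact mul_le_mul_of_nonneg_left
    (pow_le_pow_right₀ (by linarith [norm_nonneg lam]) h1) (hC0 d)

theorem one_add_pow_le_exp {r : ℝ} (hr : 0 ≤ r) (N : ℕ) : (1 + r) ^ N ≤ Real.exp (N * r) := by
  rw [Real.exp_nat_mul]
  have := Real.add_one_le_exp r
  gcongr
  linarith

theorem norm_bilin_le (x y : Fin n → ℂ) : ‖bilin x y‖ ≤ n * (‖x‖ * ‖y‖) := by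
  rw [bilin]
  refine (norm_sum_le_of_le _ fun j _ => ?_).trans_eq (b := ∑ _j : Fin n, ‖x‖ * ‖y‖) ?_
  · rw [norm_mul]
    exact mul_le_mul (norm_le_pi_norm x j) (norm_le_pi_norm y j) (norm_nonneg _) (norm_nonneg _)
  · simp

theorem norm_toComplex (x : Fin n → ℝ) : ‖toComplex x‖ = ‖x‖ := by
  simp only [Pi.norm_def, toComplex, Complex.nnnorm_real]

theorem norm_contour_le (η y : Fin n → ℝ) : ‖contour η y‖ ≤ ‖η‖ + ‖y‖ := by
  rw [contour]
  refine (norm_add_le _ _).trans ?_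
  rw [norm_smul, Complex.norm_I, one_mul, norm_toComplex, norm_toComplex]

/-- `∑ⱼ yⱼ²`. -/
def sqSum (y : Fin n → ℝ) : ℝ := ∑ j, y j ^ 2

theorem norm_sq_le_sqSum (y : Fin n → ℝ) : ‖y‖ ^ 2 ≤ sqSum y := by
  have h0 : 0 ≤ sqSum y := Finset.sum_nonneg fun _ _ => sq_nonneg _
  rw [← Real.sqrt_le_sqrt_iff h0, Real.sqrt_sq (norm_nonneg _)]
  refine (pi_norm_le_iff_of_nonneg (Real.sqrt_nonneg _)).2 fun j => ?_
  refine Real.le_sqrt_of_sq_le ?_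
  rw [Real.norm_eq_abs, sq_abs]
  exact Finset.single_le_sum (f := fun j => y j ^ 2) (fun _ _ => sq_nonneg _) (Finset.mem_univ j)

theorem sqSum_le (y : Fin n → ℝ) : sqSum y ≤ n * ‖y‖ ^ 2 := by
  refine (Finset.sum_le_sum (g := fun _ => ‖y‖ ^ 2) fun j _ => ?_).trans_eq (by simp)
  rw [← sq_abs, ← Real.norm_eq_abs]
  have := norm_le_pi_norm y j
  gcongr

theorem continuous_sqSum : Continuous (sqSum : (Fin n → ℝ) → ℝ) := by
  unfold sqSum; fun_prop

/-- The weight `e^{K|y| - y²/2}`. -/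
noncomputable def weight (K : ℝ) (y : Fin n → ℝ) : ℝ := Real.exp (K * ‖y‖ - sqSum y / 2)

theorem weight_pos (K : ℝ) (y : Fin n → ℝ) : 0 < weight K y := Real.exp_pos _

theorem continuous_weight (K : ℝ) : Continuous (weight K : (Fin n → ℝ) → ℝ) := by
  unfold weight
  have := continuous_sqSum (n := n)
  fun_prop

theorem integrable_weight (K : ℝ) : Integrable (weight K : (Fin n → ℝ) → ℝ) := by
  have h1 := (GaussianFourier.integrable_cexp_neg_mul_sum_add (ι := Fin n) (b := (1 / 4 : ℝ))
    (by rw [Complex.ofReal_re]; norm_num) 0).norm.const_mul (Real.exp (K ^ 2))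
  refine h1.mono' (continuous_weight K).aestronglyMeasurable (Filter.Eventually.of_forall
    fun y => ?_)
  rw [Real.norm_of_nonneg (weight_pos K y).le, Complex.norm_exp, ← Real.exp_add, weight]
  refine Real.exp_le_exp.2 ?_
  have h2 := norm_sq_le_sqSum y
  have h3 : (-((1 / 4 : ℝ) : ℂ) * ∑ i, (y i : ℂ) ^ 2 + ∑ i, (0 : Fin n → ℂ) i * (y i : ℂ)).re
      = -(1 / 4) * sqSum y := by
    have : (∑ i, (y i : ℂ) ^ 2) = ((sqSum y : ℝ) : ℂ) := by simp [sqSum]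
    rw [this]
    simp [-Complex.ofReal_div]
  rw [h3]
  -- Since K‖y‖ ≤ K² + ‖y‖²/4, half of the Gaussian absorbs the exponential and e^{-y²/4} remains.
  nlinarith [sq_nonneg (K - ‖y‖ / 2)]

theorem weight_add_le {K R : ℝ} (hK : 0 ≤ K) (y : Fin n → ℝ) {v : Fin n → ℝ} (hv : ‖v‖ ≤ R) :
    weight K (y + v) ≤ Real.exp (K * R) * weight (K + n * R) y := by
  rw [weight, weight, ← Real.exp_add]
  refine Real.exp_le_exp.2 ?_
  have h1 : ‖y + v‖ ≤ ‖y‖ + R := (norm_add_le _ _).trans (by linarith)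
  have h2 : sqSum y - 2 * (n * (‖y‖ * R)) ≤ sqSum (y + v) := by
    have h3 : ∀ j, y j ^ 2 - 2 * (‖y‖ * R) ≤ (y + v) j ^ 2 := by
      intro j
      have h4 : -(y j * v j) ≤ ‖y‖ * R := by
        refine (neg_le_abs _).trans ?_
        rw [abs_mul]
        exact mul_le_mul (norm_le_pi_norm y j) ((norm_le_pi_norm v j).trans hv) (abs_nonneg _)
          (norm_nonneg _)
      rw [Pi.add_apply]
      nlinarith [sq_nonneg (v j)]
    have := Finset.sum_le_sum fun j (_ : j ∈ Finset.univ) => h3 j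
    rw [Finset.sum_sub_distrib] at this
    simp only [Finset.sum_const, Finset.card_univ, Fintype.card_fin, nsmul_eq_mul] at this
    unfold sqSum
    linarith
  nlinarith

theorem continuous_toComplex : Continuous (toComplex : (Fin n → ℝ) → Fin n → ℂ) := by
  unfold toComplex; fun_prop

theorem continuous_contour (η : Fin n → ℝ) : Continuous (contour η) := by
  unfold contour
  have := continuous_toComplex (n := n)
  fun_prop

theorem bilin_contour (η y β : Fin n → ℝ) :
    bilin (contour η y) (toComplex β)
      = ((∑ j, y j * β j : ℝ) : ℂ) + ((∑ j, η j * β j : ℝ) : ℂ) * Complex.I := by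
  rw [contour, bilin_add_left, bilin_smul_left, bilin_toComplex, bilin_toComplex]
  ring

/-- The imaginary part of (iη + y, β) is (η, β), independently of y. Hence the denominator is
bounded below uniformly along a contour. -/
theorem norm_bilin_le_bilin_contour (η y β : Fin n → ℝ) :
    ‖bilin (toComplex η) (toComplex β)‖ ≤ ‖bilin (contour η y) (toComplex β)‖ := by
  rw [bilin_contour, bilin_toComplex, Complex.norm_real, Real.norm_eq_abs]
  refine le_trans (le_of_eq ?_) (Complex.abs_im_le_norm _)
  simp

theorem norm_Am_le_contour (𝒜 : Finset (Fin n → ℝ)) (m : (Fin n → ℝ) → ℕ) (η y : Fin n → ℝ) :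
    ‖Am 𝒜 m (toComplex η)‖ ≤ ‖Am 𝒜 m (contour η y)‖ := by
  rw [Am, Am, norm_prod, norm_prod]
  refine Finset.prod_le_prod (fun _ _ => norm_nonneg _) fun β _ => ?_
  rw [norm_pow, norm_pow]
  exact pow_le_pow_left₀ (norm_nonneg _) (norm_bilin_le_bilin_contour _ _ _) _

theorem norm_gaussDensity_contour (η y : Fin n → ℝ) :
    ‖gaussDensity (contour η y)‖
      = (2 * Real.pi) ^ (-(n : ℝ) / 2) * Real.exp (sqSum η / 2) * Real.exp (-sqSum y / 2) := by
  have h1 : (bilin (contour η y) (contour η y)).re = sqSum y - sqSum η := by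
    rw [bilin, Complex.re_sum, sqSum, sqSum, ← Finset.sum_sub_distrib]
    refine Finset.sum_congr rfl fun j _ => ?_
    simp [contour, toComplex]
    ring
  rw [gaussDensity, norm_mul, Complex.norm_real, Real.norm_of_nonneg (by positivity),
    Complex.norm_exp, mul_assoc, ← Real.exp_add]
  congr 2
  rw [neg_div, Complex.neg_re, Complex.div_ofNat_re, h1]
  ring

/-- The constant in `norm_mul_gaussDensity_le`. -/
noncomputable def gaussConst (n : ℕ) (K R : ℝ) : ℝ :=
  (2 * Real.pi) ^ (-(n : ℝ) / 2) * Real.exp (n * R ^ 2 / 2) * Real.exp (K * (1 + R))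

theorem gaussConst_pos (n : ℕ) (K R : ℝ) : 0 < gaussConst n K R := by
  unfold gaussConst; positivity

/-- A function of exponential growth times the Gaussian density is dominated by a weight. -/
theorem norm_mul_gaussDensity_le {f : ℂ} {K R : ℝ} {η y : Fin n → ℝ} (hK : 0 ≤ K) (hη : ‖η‖ ≤ R)
    (hf : ‖f‖ ≤ Real.exp (K * (1 + ‖contour η y‖))) :
    ‖f * gaussDensity (contour η y)‖ ≤ gaussConst n K R * weight K y := by
  have hR : 0 ≤ R := (norm_nonneg _).trans hη
  have h1 : sqSum η ≤ n * R ^ 2 := (sqSum_le η).trans (by gcongr)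
  have h2 : ‖f‖ ≤ Real.exp (K * (1 + R)) * Real.exp (K * ‖y‖) := by
    refine hf.trans ?_
    rw [← Real.exp_add]
    refine Real.exp_le_exp.2 ?_
    nlinarith [norm_contour_le η y]
  rw [norm_mul, norm_gaussDensity_contour]
  calc _ ≤ (Real.exp (K * (1 + R)) * Real.exp (K * ‖y‖)) *
        ((2 * Real.pi) ^ (-(n : ℝ) / 2) * Real.exp (n * R ^ 2 / 2) * Real.exp (-sqSum y / 2)) := by
        gcongr
    _ = _ := by rw [gaussConst, weight, sub_eq_add_neg, Real.exp_add, neg_div]; ring_nf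

/-- Uniform exponential growth of a Baker-Akhiezer function. -/
theorem exists_norm_le_exp {φ : (Fin n → ℂ) → (Fin n → ℂ) → ℂ}
    {F : MvPolynomial (Fin n) (MvPolynomial (Fin n) ℂ)}
    (hF : ∀ x lam, φ x lam = MvPolynomial.eval x (MvPolynomial.map (MvPolynomial.eval lam) F)
        * Complex.exp (bilin x lam)) (R : ℝ) :
    ∃ K : ℝ, 0 ≤ K ∧ ∀ x lam, ‖lam‖ ≤ R → ‖φ x lam‖ ≤ Real.exp (K * (1 + ‖x‖)) := by
  obtain ⟨C, N, hC, hb⟩ := exists_norm_eval_map_le F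
  set R' := max R 0
  refine ⟨C + N * R' + N + n * R', by positivity, fun x lam hlam => ?_⟩
  have hlam' : ‖lam‖ ≤ R' := hlam.trans (le_max_left _ _)
  have h1 : ‖Complex.exp (bilin x lam)‖ ≤ Real.exp (n * (‖x‖ * R')) := by
    rw [Complex.norm_exp]
    refine Real.exp_le_exp.2 ((Complex.re_le_norm _).trans ((norm_bilin_le _ _).trans ?_))
    gcongr
  have h2 : C ≤ Real.exp C := by linarith [Real.add_one_le_exp C]
  have h3 := one_add_pow_le_exp (norm_nonneg x) N
  have h4 := (one_add_pow_le_exp (norm_nonneg lam) N).trans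
    (Real.exp_le_exp.2 (mul_le_mul_of_nonneg_left hlam' (Nat.cast_nonneg N)))
  rw [hF, norm_mul]
  calc _ ≤ (Real.exp C * (Real.exp (N * ‖x‖) * Real.exp (N * R')))
        * Real.exp (n * (‖x‖ * R')) := by
        refine mul_le_mul ((hb x lam).trans ?_) h1 (norm_nonneg _) (by positivity)
        gcongr
    _ = Real.exp (C + (N * ‖x‖ + N * R') + n * (‖x‖ * R')) := by simp only [Real.exp_add]
    _ ≤ _ := by
      refine Real.exp_le_exp.2 ?_
      have := norm_nonneg x
      have hR' : 0 ≤ R' := le_max_right _ _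
      have e1 : (0 : ℝ) ≤ C * ‖x‖ := by positivity
      have e2 : (0 : ℝ) ≤ N * R' * ‖x‖ := by positivity
      have e3 : (0 : ℝ) ≤ (N : ℝ) := by positivity
      have e4 : (0 : ℝ) ≤ n * R' := by positivity
      nlinarith

/-! ### Local independence of the contour -/

theorem contour_add_smul (η v y : Fin n → ℝ) (z : ℂ) :
    contour η y + z • toComplex v = contour (η + z.im • v) (y + z.re • v) := by
  ext j
  simp only [contour, toComplex, Pi.add_apply, Pi.smul_apply, smul_eq_mul, Complex.ofReal_add,
    Complex.ofReal_mul]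
  conv_lhs => rw [← Complex.re_add_im z]
  ring

-- With v = η - η₀, the function g(z) = ∫ h(iη₀ + y + zv) dy is holomorphic in a disc and unchanged
-- by real shifts of z, by translation invariance of Lebesgue measure. So g' = 0 and g(i) = g(0).
open Filter Topology in
theorem eventually_integral_contour_eq {h : (Fin n → ℂ) → ℂ} {U : Set (Fin n → ℝ)}
    (hU : IsOpen U) (hd : ∀ η ∈ U, ∀ y, DifferentiableAt ℂ h (contour η y))
    (hb : ∀ η₀ ∈ U, ∃ C K : ℝ, 0 ≤ C ∧ 0 ≤ K ∧ ∀ᶠ η in 𝓝 η₀, ∀ y,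
      ‖h (contour η y)‖ ≤ C * weight K y) {η₀ : Fin n → ℝ} (hη₀ : η₀ ∈ U) :
    ∀ᶠ η in 𝓝 η₀, ∫ y, h (contour η y) = ∫ y, h (contour η₀ y) := by
  obtain ⟨C, K, hC, hK, hev⟩ := hb η₀ hη₀
  obtain ⟨r, hr, hball⟩ := Metric.eventually_nhds_iff_ball.1 (hev.and (hU.eventually_mem hη₀))
  refine Metric.eventually_nhds_iff_ball.2 ⟨r / 2, by positivity, fun η hη => ?_⟩
  set v := η - η₀ with hv
  have hvn : ‖v‖ < r / 2 := by rwa [Metric.mem_ball, dist_eq_norm] at hη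
  have hin : ∀ z ∈ Metric.ball (0 : ℂ) 2, η₀ + z.im • v ∈ Metric.ball η₀ r := by
    intro z hz
    rw [Metric.mem_ball, dist_eq_norm, add_sub_cancel_left, norm_smul]
    have h1 : ‖z.im‖ ≤ 2 := (Complex.abs_im_le_norm z).trans (by simpa using (mem_ball_zero_iff.1 hz).le)
    have h2 := norm_nonneg v
    nlinarith
  set g : ℂ → ℂ := fun z => ∫ y, h (contour η₀ y + z • toComplex v) with hg
  have hgd : DifferentiableOn ℂ g (Metric.ball 0 2) := by
    refine differentiableOn_integral (W := fun y => C * (Real.exp (K * r) * weight (K + n * r) y))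
      Metric.isOpen_ball (fun y z hz => ?_) (fun z hz => ?_)
      (((integrable_weight _).const_mul _).const_mul _) (fun z hz y => ?_)
    · refine DifferentiableAt.differentiableWithinAt ?_
      have h1 : DifferentiableAt ℂ h (contour η₀ y + z • toComplex v) := by
        rw [contour_add_smul]
        exact hd _ (hball _ (hin z hz)).2 _
      exact h1.comp z (f := fun z : ℂ => contour η₀ y + z • toComplex v) (by fun_prop)
    · refine Continuous.aestronglyMeasurable (continuous_iff_continuousAt.2 fun y => ?_)
      have h1 : ContinuousAt h (contour η₀ y + z • toComplex v) := by
        rw [contour_add_smul]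
        exact (hd _ (hball _ (hin z hz)).2 _).continuousAt
      have h2 := continuous_contour η₀
      exact ContinuousAt.comp (f := fun y => contour η₀ y + z • toComplex v) h1
        (by fun_prop)
    · rw [contour_add_smul]
      refine ((hball _ (hin z hz)).1 _).trans ?_
      refine mul_le_mul_of_nonneg_left (weight_add_le hK y ?_) hC
      rw [norm_smul]
      have h1 : ‖z.re‖ ≤ 2 :=
        (Complex.abs_re_le_norm z).trans (by simpa using (mem_ball_zero_iff.1 hz).le)
      have h2 := norm_nonneg v
      nlinarith
  have hinv : ∀ (z : ℂ) (t : ℝ), g (z + t) = g z := by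
    intro z t
    simp only [hg]
    rw [← integral_add_right_eq_self (fun y => h (contour η₀ y + z • toComplex v)) (t • v)]
    congr 1
    ext y
    rw [contour_add_smul, contour_add_smul]
    simp [add_smul, add_assoc, add_comm (t • v)]
  have hderiv : Set.EqOn (deriv g) 0 (Metric.ball 0 2) := by
    intro z hz
    have h1 := (hgd.differentiableAt (Metric.isOpen_ball.mem_nhds hz)).hasDerivAt
    have h2 : HasDerivAt (fun t : ℝ => g (z + t)) (deriv g z) 0 := by
      have h3 : HasDerivAt (fun t : ℂ => g (z + t)) (deriv g z) ((0 : ℝ) : ℂ) := by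
        have := HasDerivAt.comp_const_add z ((0 : ℝ) : ℂ) (f := g) (f' := deriv g z)
          (by simpa using h1)
        exact this
      exact h3.comp_ofReal
    have h3 : HasDerivAt (fun t : ℝ => g (z + t)) 0 0 := by
      simp only [hinv]
      exact hasDerivAt_const _ _
    exact h2.unique h3
  have hI : (Complex.I : ℂ) ∈ Metric.ball (0 : ℂ) 2 := by simp
  have h0 : (0 : ℂ) ∈ Metric.ball (0 : ℂ) 2 := by simp
  have := Metric.isOpen_ball.is_const_of_deriv_eq_zero
    (convex_ball (0 : ℂ) 2).isPreconnected hgd hderiv hI h0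
  simp only [hg, contour_add_smul] at this
  simpa [hv] using this

/-! ### Generic contours and the Gaussian kernel -/

/-- The set of generic points. -/
def generic (𝒜 : Finset (Fin n → ℝ)) : Set (Fin n → ℝ) :=
  {η | ∀ α ∈ 𝒜, bilin (toComplex η) (toComplex α) ≠ 0}

theorem mem_hyperplane_iff {η α : Fin n → ℝ} :
    η ∈ hyperplane α ↔ bilin (toComplex η) (toComplex α) = 0 := by
  rw [bilin_toComplex, Complex.ofReal_eq_zero]; rfl

theorem continuous_bilin_toComplex (β : Fin n → ℂ) :
    Continuous fun x : Fin n → ℂ => bilin x β := by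
  unfold bilin; fun_prop

theorem isOpen_generic (𝒜 : Finset (Fin n → ℝ)) : IsOpen (generic 𝒜) := by
  have : generic 𝒜 = ⋂ α ∈ 𝒜, {η | bilin (toComplex η) (toComplex α) ≠ 0} := by
    ext η; simp [generic]
  rw [this]
  refine isOpen_biInter_finset fun α _ => ?_
  exact isOpen_ne_fun ((continuous_bilin_toComplex _).comp continuous_toComplex) continuous_const

theorem Am_ne_zero {𝒜 : Finset (Fin n → ℝ)} (m : (Fin n → ℝ) → ℕ) {x : Fin n → ℂ}
    (hx : ∀ α ∈ 𝒜, bilin x (toComplex α) ≠ 0) : Am 𝒜 m x ≠ 0 :=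
  Finset.prod_ne_zero_iff.2 fun α hα => pow_ne_zero _ (hx α hα)

theorem Am_contour_ne_zero {𝒜 : Finset (Fin n → ℝ)} (m : (Fin n → ℝ) → ℕ) {η : Fin n → ℝ}
    (hη : η ∈ generic 𝒜) (y : Fin n → ℝ) : Am 𝒜 m (contour η y) ≠ 0 := by
  have h1 := norm_pos_iff.2 (Am_ne_zero m hη)
  exact norm_pos_iff.1 (h1.trans_le (norm_Am_le_contour 𝒜 m η y))

theorem differentiable_eval (Q : MvPolynomial (Fin n) ℂ) :
    Differentiable ℂ fun x => MvPolynomial.eval x Q := by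
  induction Q using MvPolynomial.induction_on with
  | C a => simp
  | add p q hp hq => simpa using hp.fun_add hq
  | mul_X p j hp => simpa using hp.fun_mul (differentiable_apply j)

theorem differentiable_Am (𝒜 : Finset (Fin n → ℝ)) (m : (Fin n → ℝ) → ℕ) :
    Differentiable ℂ (Am 𝒜 m) := by
  have := differentiable_eval (AmPoly 𝒜 m)
  simpa only [eval_AmPoly] using this

theorem continuous_Am (𝒜 : Finset (Fin n → ℝ)) (m : (Fin n → ℝ) → ℕ) :
    Continuous (Am 𝒜 m) := (differentiable_Am 𝒜 m).continuous

theorem differentiable_gaussDensity : Differentiable ℂ (gaussDensity (n := n)) := by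
  unfold gaussDensity bilin
  fun_prop

/-- The function `f(x) / A_m(x)²` times the Gaussian density. -/
noncomputable def kernel (𝒜 : Finset (Fin n → ℝ)) (m : (Fin n → ℝ) → ℕ)
    (f : (Fin n → ℂ) → ℂ) (x : Fin n → ℂ) : ℂ := f x / Am 𝒜 m x ^ 2 * gaussDensity x

section Kernel

variable {𝒜 : Finset (Fin n → ℝ)} {m : (Fin n → ℝ) → ℕ} {f : (Fin n → ℂ) → ℂ} {K : ℝ}

theorem norm_kernel_contour_le (hK : 0 ≤ K) {η y : Fin n → ℝ} {δ R : ℝ} (hη : ‖η‖ ≤ R)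
    (hδ : 0 < δ) (hA : δ ≤ ‖Am 𝒜 m (contour η y)‖)
    (hf : ‖f (contour η y)‖ ≤ Real.exp (K * (1 + ‖contour η y‖))) :
    ‖kernel 𝒜 m f (contour η y)‖ ≤ (gaussConst n K R / δ ^ 2) * weight K y := by
  rw [kernel, div_mul_eq_mul_div, norm_div, norm_pow, div_mul_eq_mul_div]
  refine div_le_div₀ ?_ (norm_mul_gaussDensity_le hK hη hf) (by positivity) (by gcongr)
  exact mul_nonneg (gaussConst_pos n K R).le (weight_pos K y).le

theorem differentiableAt_kernel (hf : Differentiable ℂ f) {η : Fin n → ℝ} (hη : η ∈ generic 𝒜)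
    (y : Fin n → ℝ) : DifferentiableAt ℂ (kernel 𝒜 m f) (contour η y) := by
  unfold kernel
  have h1 : DifferentiableAt ℂ (fun x => Am 𝒜 m x ^ 2) (contour η y) :=
    (differentiable_Am 𝒜 m _).fun_pow 2
  have h2 : DifferentiableAt ℂ (fun x => f x / Am 𝒜 m x ^ 2) (contour η y) := by
    simp only [div_eq_mul_inv]
    exact (hf _).fun_mul (h1.fun_inv (pow_ne_zero 2 (Am_contour_ne_zero m hη y)))
  exact h2.fun_mul (differentiable_gaussDensity _)

theorem continuous_kernel_contour (hf : Continuous f) {η : Fin n → ℝ} (hη : η ∈ generic 𝒜) :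
    Continuous fun y => kernel 𝒜 m f (contour η y) := by
  unfold kernel
  have h1 := continuous_contour η
  refine ((hf.comp h1).div (((continuous_Am 𝒜 m).comp h1).pow 2) fun y =>
    pow_ne_zero 2 (Am_contour_ne_zero m hη y)).mul
    (differentiable_gaussDensity.continuous.comp h1)

theorem integrable_kernel_contour (hf : Continuous f) (hK : 0 ≤ K)
    (hfb : ∀ x, ‖f x‖ ≤ Real.exp (K * (1 + ‖x‖))) {η : Fin n → ℝ} (hη : η ∈ generic 𝒜) :
    Integrable fun y => kernel 𝒜 m f (contour η y) :=
  ((integrable_weight K).const_mul _).mono' (continuous_kernel_contour hf hη).aestronglyMeasurable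
    (Filter.Eventually.of_forall fun y => norm_kernel_contour_le hK le_rfl
      (norm_pos_iff.2 (Am_ne_zero m hη)) (norm_Am_le_contour 𝒜 m η y) (hfb _))

open Filter Topology in
theorem eventually_integral_kernel_eq (hf : Differentiable ℂ f) (hK : 0 ≤ K)
    (hfb : ∀ x, ‖f x‖ ≤ Real.exp (K * (1 + ‖x‖))) {η₀ : Fin n → ℝ} (hη₀ : η₀ ∈ generic 𝒜) :
    ∀ᶠ η in 𝓝 η₀, ∫ y, kernel 𝒜 m f (contour η y) = ∫ y, kernel 𝒜 m f (contour η₀ y) := by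
  refine eventually_integral_contour_eq (isOpen_generic 𝒜)
    (fun η hη y => differentiableAt_kernel hf hη y) (fun η₀ hη₀ => ?_) hη₀
  have hpos := norm_pos_iff.2 (Am_ne_zero m hη₀)
  have hcont : Continuous fun η : Fin n → ℝ => ‖Am 𝒜 m (toComplex η)‖ :=
    ((continuous_Am 𝒜 m).comp continuous_toComplex).norm
  refine ⟨gaussConst n K (‖η₀‖ + 1) / (‖Am 𝒜 m (toComplex η₀)‖ / 2) ^ 2, K,
    div_nonneg (gaussConst_pos _ _ _).le (by positivity), hK, ?_⟩
  · filter_upwards [hcont.continuousAt.eventually_const_lt (half_lt_self hpos),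
      continuous_norm.continuousAt.eventually_lt_const (lt_add_one ‖η₀‖)] with η h1 h2 y
    exact norm_kernel_contour_le hK h2.le (half_pos hpos)
      (h1.le.trans (norm_Am_le_contour 𝒜 m η y)) (hfb _)

end Kernel

/-! ### Functions with vanishing odd derivatives -/

/-- The odd derivatives of `f` at `0` of order less than `2 * k` vanish. -/
def OddVanish (k : ℕ) (f : ℂ → ℂ) : Prop := ∀ j < k, iteratedDeriv (2 * j + 1) f 0 = 0

theorem OddVanish.mul {k : ℕ} {f g : ℂ → ℂ} (hf : OddVanish k f) (hg : OddVanish k g)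
    (hfd : Differentiable ℂ f) (hgd : Differentiable ℂ g) : OddVanish k fun t => f t * g t := by
  intro j hj
  have h := iteratedDeriv_mul (n := 2 * j + 1) (x := (0 : ℂ)) hfd.contDiff.contDiffAt
    hgd.contDiff.contDiffAt
  refine h.trans (Finset.sum_eq_zero fun i hi => ?_)
  have hi' := Finset.mem_range.1 hi
  rcases Nat.even_or_odd' i with ⟨i', rfl | rfl⟩
  · rw [show 2 * j + 1 - 2 * i' = 2 * (j - i') + 1 by omega, hg _ (by omega), mul_zero]
  · rw [hf _ (by omega), mul_zero, zero_mul]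

theorem OddVanish.comp_neg {k : ℕ} {f : ℂ → ℂ} (hf : OddVanish k f) :
    OddVanish k fun t => f (-t) := by
  intro j hj
  rw [iteratedDeriv_comp_neg, neg_zero, hf j hj, smul_zero]

theorem norm_add_smul_le {x₀ : Fin n → ℂ} {α : Fin n → ℝ} {w t : ℂ} {r : ℝ} (h : ‖t - w‖ ≤ r) :
    ‖x₀ + t • toComplex α‖ ≤ ‖x₀ + w • toComplex α‖ + r * ‖α‖ := by
  have h1 : x₀ + t • toComplex α = (x₀ + w • toComplex α) + (t - w) • toComplex α := by
    rw [sub_smul]; abel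
  rw [h1]
  refine (norm_add_le _ _).trans ?_
  rw [norm_smul, norm_toComplex]
  gcongr

theorem norm_le_of_bilin_eq_zero {x₀ : Fin n → ℂ} {α : Fin n → ℝ}
    (hx₀ : bilin x₀ (toComplex α) = 0) (w : ℂ) :
    ‖w‖ * ‖bilin (toComplex α) (toComplex α)‖ ≤ n * (‖x₀ + w • toComplex α‖ * ‖α‖) := by
  rw [← norm_mul, ← norm_toComplex α]
  refine le_trans (le_of_eq ?_) (norm_bilin_le _ _)
  rw [bilin_add_left, hx₀, zero_add, bilin_smul_left]

/-- If `f` and `b` have vanishing odd normal derivatives on a hyperplane, the function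
`f(x) b(σx) - f(σx) b(x)` vanishes to order `2 * k` there. -/
theorem exists_norm_sub_reflect_le {f b : (Fin n → ℂ) → ℂ} {K : ℝ} (hK : 0 ≤ K)
    (hf : Differentiable ℂ f) (hb : Differentiable ℂ b)
    (hfb : ∀ x, ‖f x‖ ≤ Real.exp (K * (1 + ‖x‖))) (hbb : ∀ x, ‖b x‖ ≤ Real.exp (K * (1 + ‖x‖)))
    {α : Fin n → ℝ} (hα : α ≠ 0) {k : ℕ}
    (hfo : ∀ x, bilin x (toComplex α) = 0 → OddVanish k fun t => f (x + t • toComplex α))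
    (hbo : ∀ x, bilin x (toComplex α) = 0 → OddVanish k fun t => b (x + t • toComplex α)) :
    ∃ K' : ℝ, 0 ≤ K' ∧ ∀ x₀, bilin x₀ (toComplex α) = 0 → ∀ w : ℂ,
      ‖f (x₀ + w • toComplex α) * b (x₀ - w • toComplex α)
        - f (x₀ - w • toComplex α) * b (x₀ + w • toComplex α)‖
      ≤ ‖w‖ ^ (2 * k) * Real.exp (K' * (1 + ‖x₀ + w • toComplex α‖)) := by
  set κ := ‖bilin (toComplex α) (toComplex α)‖ with hκ
  have hκ0 : 0 < κ := norm_pos_iff.2 (bilin_self_ne_zero hα)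
  -- Chosen so that 1 + ‖x₀ ± tα‖ ≤ c(1 + ‖x₀ + wα‖) in both cases below: for |t|, |w| < 1 the
  -- displacement is at most 2‖α‖, and for t = w it is at most 2|w|‖α‖, where |w| ≤ n‖α‖‖x₀ + wα‖/κ.
  set c := 1 + 3 * ‖α‖ + 2 * (n * ‖α‖ / κ) * ‖α‖ with hc
  have hc1 : 1 ≤ c := by
    have : 0 ≤ 3 * ‖α‖ + 2 * (n * ‖α‖ / κ) * ‖α‖ := by positivity
    linarith
  refine ⟨2 * (K * c) + 1, by positivity, fun x₀ hx₀ w => ?_⟩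
  set v := toComplex α with hv
  set X := ‖x₀ + w • v‖ with hX
  have hX0 : 0 ≤ X := norm_nonneg _
  set E := Real.exp (K * c * (1 + X)) with hE
  have hbd : ∀ t : ℂ, ‖x₀ + t • v‖ ≤ c * (1 + X) - 1 → ‖x₀ + (-t) • v‖ ≤ c * (1 + X) - 1 →
      ‖f (x₀ + t • v) * b (x₀ - t • v) - f (x₀ - t • v) * b (x₀ + t • v)‖
        ≤ Real.exp ((2 * (K * c) + 1) * (1 + X)) := by
    intro t h1 h2
    have hle : ∀ x : Fin n → ℂ, ‖x‖ ≤ c * (1 + X) - 1 → Real.exp (K * (1 + ‖x‖)) ≤ E := by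
      intro x hx
      refine Real.exp_le_exp.2 ?_
      rw [mul_assoc]
      exact mul_le_mul_of_nonneg_left (by linarith) hK
    rw [neg_smul, ← sub_eq_add_neg] at h2
    have e1 := (hfb _).trans (hle _ h1)
    have e2 := (hfb _).trans (hle _ h2)
    have e3 := (hbb _).trans (hle _ h1)
    have e4 := (hbb _).trans (hle _ h2)
    have hE0 : 0 ≤ E := (Real.exp_pos _).le
    calc _ ≤ E * E + E * E := by
          refine (norm_sub_le _ _).trans (add_le_add ?_ ?_)
          · rw [norm_mul]; exact mul_le_mul e1 e4 (norm_nonneg _) hE0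
          · rw [norm_mul]; exact mul_le_mul e2 e3 (norm_nonneg _) hE0
      _ ≤ Real.exp (1 + X) * (E * E) := by
          have : 2 ≤ Real.exp (1 + X) := by linarith [Real.add_one_le_exp (1 + X)]
          nlinarith [mul_nonneg hE0 hE0]
      _ = _ := by rw [hE, ← Real.exp_add, ← Real.exp_add]; ring_nf
  have hα0 := norm_nonneg α
  have hn0 : 0 ≤ 2 * (n * ‖α‖ / κ) * ‖α‖ := by positivity
  -- For |w| < 1 the function g(t) - g(-t), with g(t) = f(x₀ + tα)b(x₀ - tα), has a zero of order 2k
  -- and is bounded on the unit disc. For |w| ≥ 1 the factor |w|^{2k} is at least 1 and plain growth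
  -- suffices.
  rcases lt_or_ge ‖w‖ 1 with hw | hw
  · set N : ℂ → ℂ := fun t => (fun t => f (x₀ + t • v) * b (x₀ + (-t) • v)) t
      - (fun t => f (x₀ + t • v) * b (x₀ + (-t) • v)) (-t) with hN
    have hNeq : ∀ t, N t = f (x₀ + t • v) * b (x₀ - t • v) - f (x₀ - t • v) * b (x₀ + t • v) := by
      intro t
      simp only [hN, neg_neg, neg_smul, ← sub_eq_add_neg]
    have hd1 : Differentiable ℂ fun t : ℂ => f (x₀ + t • v) := hf.comp (by fun_prop)
    have hd2 : Differentiable ℂ fun t : ℂ => b (x₀ + t • v) := hb.comp (by fun_prop)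
    have hd3 : Differentiable ℂ fun t : ℂ => b (x₀ + (-t) • v) := hb.comp (by fun_prop)
    have hd4 : Differentiable ℂ fun t : ℂ => f (x₀ + t • v) * b (x₀ + (-t) • v) := hd1.fun_mul hd3
    have hd5 : Differentiable ℂ N := hd4.fun_sub (hd4.comp differentiable_neg)
    have hodd : OddVanish k fun t => f (x₀ + t • v) * b (x₀ + (-t) • v) :=
      (hfo x₀ hx₀).mul (hbo x₀ hx₀).comp_neg hd1 hd3
    have h1 := norm_le_mul_pow_of_iteratedDeriv_eq_zero (R := 1)
      (M := Real.exp ((2 * (K * c) + 1) * (1 + X))) hd5 (fun t ht => ?_)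
      (fun i hi => iteratedDeriv_sub_comp_neg_eq_zero hd4 hodd hi) hw
    · rw [hNeq] at h1
      refine h1.trans_eq ?_
      rw [div_one, mul_comm]
    · rw [hNeq]
      have ht' : ‖t‖ < 1 := mem_ball_zero_iff.1 ht
      refine hbd t ?_ ?_
      · refine (norm_add_smul_le (w := w) (r := 2) ((norm_sub_le _ _).trans (by linarith))).trans ?_
        nlinarith
      · refine (norm_add_smul_le (w := w) (r := 2) ((norm_sub_le _ _).trans ?_)).trans ?_
        · rw [norm_neg]; linarith
        · nlinarith
  · have h1 := norm_le_of_bilin_eq_zero hx₀ w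
    have h2 : ‖w‖ ≤ n * ‖α‖ / κ * X := by
      rw [div_mul_eq_mul_div, le_div_iff₀ hκ0]
      linarith
    refine (hbd w (by nlinarith) ?_).trans ?_
    · refine (norm_add_smul_le (w := w) (r := 2 * ‖w‖) ((norm_sub_le _ _).trans ?_)).trans ?_
      · rw [norm_neg]; linarith
      · have h3 : 2 * ‖w‖ * ‖α‖ ≤ 2 * (n * ‖α‖ / κ) * ‖α‖ * X := by
          have := mul_le_mul_of_nonneg_right h2 hα0
          linarith
        nlinarith
    · exact le_mul_of_one_le_left (Real.exp_pos _).le (one_le_pow₀ hw)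

/-! ### Reflections -/

/-- The reflection in the hyperplane `(x, α) = 0` of `ℂⁿ`. -/
noncomputable def reflC (α : Fin n → ℝ) (x : Fin n → ℂ) : Fin n → ℂ :=
  x - (2 * (bilin x (toComplex α) / bilin (toComplex α) (toComplex α))) • toComplex α

/-- The reflection in the hyperplane `Π_α`. -/
noncomputable def refl (α : Fin n → ℝ) : (Fin n → ℝ) →ₗ[ℝ] (Fin n → ℝ) where
  toFun x := x - (2 * ((∑ j, x j * α j) / ∑ j, α j * α j)) • α
  map_add' x y := by
    simp only [Pi.add_apply, add_mul, Finset.sum_add_distrib, add_div, mul_add, add_smul]; abel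
  map_smul' c x := by
    simp only [Pi.smul_apply, smul_eq_mul, mul_assoc, ← Finset.mul_sum, RingHom.id_apply,
      smul_sub, smul_smul]
    congr 2; ring

theorem refl_apply (α x : Fin n → ℝ) :
    refl α x = x - (2 * ((∑ j, x j * α j) / ∑ j, α j * α j)) • α := rfl

theorem toComplex_refl (α x : Fin n → ℝ) : toComplex (refl α x) = reflC α (toComplex x) := by
  rw [refl_apply, reflC, bilin_toComplex, bilin_toComplex]
  ext j
  simp [toComplex]

theorem reflC_add (α : Fin n → ℝ) (x y : Fin n → ℂ) :
    reflC α (x + y) = reflC α x + reflC α y := by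
  simp only [reflC, bilin_add_left, add_div, mul_add, add_smul]; abel

theorem reflC_smul (α : Fin n → ℝ) (c : ℂ) (x : Fin n → ℂ) :
    reflC α (c • x) = c • reflC α x := by
  simp only [reflC, bilin_smul_left, smul_sub, smul_smul]
  congr 2; ring

theorem reflC_contour (α η y : Fin n → ℝ) :
    reflC α (contour η y) = contour (refl α η) (refl α y) := by
  rw [contour, contour, reflC_add, reflC_smul, toComplex_refl, toComplex_refl]

theorem bilin_reflC {α : Fin n → ℝ} (hα : α ≠ 0) (x : Fin n → ℂ) :
    bilin (reflC α x) (toComplex α) = -bilin x (toComplex α) := by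
  have h := bilin_self_ne_zero hα
  rw [reflC, sub_eq_add_neg, ← neg_smul, bilin_add_left, bilin_smul_left]
  field_simp
  ring

theorem reflC_reflC {α : Fin n → ℝ} (hα : α ≠ 0) (x : Fin n → ℂ) : reflC α (reflC α x) = x := by
  rw [reflC, bilin_reflC hα, reflC, neg_div, mul_neg, neg_smul]
  abel

theorem bilin_reflC_self {α : Fin n → ℝ} (hα : α ≠ 0) (x : Fin n → ℂ) :
    bilin (reflC α x) (reflC α x) = bilin x x := by
  have h := bilin_self_ne_zero hα
  nth_rewrite 2 [reflC]
  rw [sub_eq_add_neg, ← neg_smul, bilin_add_right, bilin_smul_right, bilin_reflC hα, reflC,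
    sub_eq_add_neg, ← neg_smul, bilin_add_left, bilin_smul_left, bilin_comm (toComplex α) x]
  field_simp
  ring

theorem gaussDensity_reflC {α : Fin n → ℝ} (hα : α ≠ 0) (x : Fin n → ℂ) :
    gaussDensity (reflC α x) = gaussDensity x := by
  rw [gaussDensity, gaussDensity, bilin_reflC_self hα]

theorem toComplex_injective : Function.Injective (toComplex : (Fin n → ℝ) → Fin n → ℂ) := by
  intro x y h
  ext j
  exact Complex.ofReal_injective (congrFun h j)

theorem refl_refl {α : Fin n → ℝ} (hα : α ≠ 0) (x : Fin n → ℝ) : refl α (refl α x) = x := by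
  refine toComplex_injective ?_
  rw [toComplex_refl, toComplex_refl, reflC_reflC hα]

theorem refl_add_smul {α x : Fin n → ℝ} (hα : α ≠ 0) (hx : x ∈ hyperplane α) (s : ℝ) :
    refl α (x + s • α) = x - s • α := by
  have hx' : ∑ j, x j * α j = 0 := hx
  have h := (normSq_pos hα).ne'
  rw [map_add, map_smul, refl_apply, refl_apply, hx']
  rw [div_self h, smul_sub, smul_smul]
  simp only [zero_div, mul_zero, zero_smul, sub_zero]
  module

/-- Reflections preserve Lebesgue measure. -/
theorem integral_comp_refl {α : Fin n → ℝ} (hα : α ≠ 0) (g : (Fin n → ℝ) → ℂ) :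
    ∫ y, g (refl α y) = ∫ y, g y := by
  have hcomp : (refl α).comp (refl α) = LinearMap.id := LinearMap.ext fun x => refl_refl hα x
  have hdet : LinearMap.det (refl α) * LinearMap.det (refl α) = 1 := by
    rw [← LinearMap.det_comp, hcomp, LinearMap.det_id]
  have habs : |(LinearMap.det (refl α))⁻¹| = 1 := by
    -- The reflection is an involution, so its determinant is 1 or -1.
    rcases mul_self_eq_one_iff.1 hdet with h | h <;> rw [h] <;> simp
  have hcont : Continuous (refl α) := LinearMap.continuous_of_finiteDimensional _
  have hmp : MeasurePreserving (refl α) volume volume := by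
    refine ⟨hcont.measurable, ?_⟩
    rw [Real.map_linearMap_volume_pi_eq_smul_volume_pi, habs]
    · simp
    · intro h; rw [h] at hdet; simp at hdet
  let e : (Fin n → ℝ) ≃ₜ (Fin n → ℝ) :=
    { toFun := refl α, invFun := refl α, left_inv := refl_refl hα, right_inv := refl_refl hα
      continuous_toFun := hcont, continuous_invFun := hcont }
  exact hmp.integral_comp e.measurableEmbedding g

/-! ### Crossing a hyperplane -/

theorem Am_eq_mul {𝒜 : Finset (Fin n → ℝ)} {α : Fin n → ℝ} (hα : α ∈ 𝒜)
    (m : (Fin n → ℝ) → ℕ) (x : Fin n → ℂ) :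
    Am 𝒜 m x = bilin x (toComplex α) ^ m α * Am 𝒜 (Function.update m α 0) x := by
  rw [← eval_AmPoly, AmPoly_eq_mul hα, map_mul, map_pow, eval_linForm, eval_AmPoly]

theorem exists_norm_le_exp_of_eval (Q : MvPolynomial (Fin n) ℂ) :
    ∃ K : ℝ, 0 ≤ K ∧ ∀ x, ‖MvPolynomial.eval x Q‖ ≤ Real.exp (K * (1 + ‖x‖)) := by
  obtain ⟨C, hC, h⟩ := exists_norm_eval_le Q le_rfl
  refine ⟨C + Q.totalDegree, by positivity, fun x => (h x).trans ?_⟩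
  have h1 := one_add_pow_le_exp (norm_nonneg x) Q.totalDegree
  have h2 : C ≤ Real.exp C := by linarith [Real.add_one_le_exp C]
  calc _ ≤ Real.exp C * Real.exp (Q.totalDegree * ‖x‖) := by gcongr
    _ ≤ _ := by
      rw [← Real.exp_add]
      refine Real.exp_le_exp.2 ?_
      have := norm_nonneg x
      have : (0 : ℝ) ≤ Q.totalDegree := by positivity
      nlinarith

theorem exp_growth_mono {K K' : ℝ} (h : K ≤ K') (x : Fin n → ℂ) :
    Real.exp (K * (1 + ‖x‖)) ≤ Real.exp (K' * (1 + ‖x‖)) := by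
  have := norm_nonneg x
  gcongr

/-- `f(x) / A_m(x)²` can be integrated over all contours, and the result is independent of the
contour, if `f` has exponential growth and vanishing odd normal derivatives on the hyperplanes. -/
structure IsAdmissible (𝒜 : Finset (Fin n → ℝ)) (m : (Fin n → ℝ) → ℕ)
    (f : (Fin n → ℂ) → ℂ) (K : ℝ) : Prop where
  differentiable : Differentiable ℂ f
  nonneg : 0 ≤ K
  growth : ∀ x, ‖f x‖ ≤ Real.exp (K * (1 + ‖x‖))
  odd : ∀ α ∈ 𝒜, ∀ x, bilin x (toComplex α) = 0 →
    OddVanish (m α) fun t => f (x + t • toComplex α)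
  odd_Am : ∀ α ∈ 𝒜, ∀ x, bilin x (toComplex α) = 0 →
    OddVanish (m α) fun t => Am 𝒜 (Function.update m α 0) (x + t • toComplex α)

section Crossing

variable {𝒜 : Finset (Fin n → ℝ)} {m : (Fin n → ℝ) → ℕ} {f : (Fin n → ℂ) → ℂ} {K : ℝ}

/-- The Gaussian and (x, α)^{2m_α} are invariant under the reflection, so the whole difference sits
in a numerator to which `exists_norm_sub_reflect_le` applies. -/
theorem kernel_sub_kernel_reflC {α : Fin n → ℝ} (hα : α ∈ 𝒜) (hα0 : α ≠ 0) (x : Fin n → ℂ)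
    (h0 : bilin x (toComplex α) ≠ 0) (h1 : Am 𝒜 (Function.update m α 0) x ≠ 0)
    (h2 : Am 𝒜 (Function.update m α 0) (reflC α x) ≠ 0) :
    kernel 𝒜 m f x - kernel 𝒜 m f (reflC α x)
      = (f x * Am 𝒜 (Function.update m α 0) (reflC α x) ^ 2
          - f (reflC α x) * Am 𝒜 (Function.update m α 0) x ^ 2) * gaussDensity x
        / (bilin x (toComplex α) ^ (2 * m α) * (Am 𝒜 (Function.update m α 0) x ^ 2
          * Am 𝒜 (Function.update m α 0) (reflC α x) ^ 2)) := by
  rw [kernel, kernel, gaussDensity_reflC hα0, Am_eq_mul hα m x, Am_eq_mul hα m (reflC α x), bilin_reflC hα0,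
    mul_pow, mul_pow, ← pow_mul, ← pow_mul, mul_comm (m α) 2, pow_mul (-_) 2, neg_sq, ← pow_mul]
  have h3 := pow_ne_zero (2 * m α) h0
  field_simp

/-- The difference of the kernel and its reflection is bounded near the hyperplane. -/
theorem IsAdmissible.exists_norm_sub_le (h : IsAdmissible 𝒜 m f K) {α : Fin n → ℝ}
    (hα : α ∈ 𝒜) (hα0 : α ≠ 0) {δ R : ℝ} (hδ : 0 < δ) :
    ∃ C K' : ℝ, ∀ η, ‖η‖ ≤ R → δ ≤ ‖Am 𝒜 (Function.update m α 0) (toComplex η)‖ →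
      δ ≤ ‖Am 𝒜 (Function.update m α 0) (toComplex (refl α η))‖ → ∀ y,
      bilin (contour η y) (toComplex α) ≠ 0 →
      ‖kernel 𝒜 m f (contour η y) - kernel 𝒜 m f (reflC α (contour η y))‖ ≤ C * weight K' y := by
  set B := Am 𝒜 (Function.update m α 0) with hB
  obtain ⟨K₁, hK₁, hB1⟩ := exists_norm_le_exp_of_eval
    (AmPoly 𝒜 (Function.update m α 0) * AmPoly 𝒜 (Function.update m α 0))
  have hBd : Differentiable ℂ B := differentiable_Am _ _
  have hb : ∀ x, B x ^ 2 = MvPolynomial.eval x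
      (AmPoly 𝒜 (Function.update m α 0) * AmPoly 𝒜 (Function.update m α 0)) := by
    intro x
    rw [map_mul, eval_AmPoly, sq]
  obtain ⟨K', hK', hN⟩ := exists_norm_sub_reflect_le (f := f) (b := fun x => B x ^ 2)
    (K := max K K₁) (k := m α) (le_max_of_le_left h.nonneg) h.differentiable (hBd.fun_pow 2)
    (fun x => (h.growth x).trans (exp_growth_mono (le_max_left _ _) x))
    (fun x => by rw [hb]; exact (hB1 x).trans (exp_growth_mono (le_max_right _ _) x)) hα0
    (h.odd α hα) (fun x hx => by
      have h1 : Differentiable ℂ fun t : ℂ => B (x + t • toComplex α) := hBd.comp (by fun_prop)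
      have h2 := (h.odd_Am α hα x hx).mul (h.odd_Am α hα x hx) h1 h1
      simpa only [sq] using h2)
  set κ := bilin (toComplex α) (toComplex α) with hκ
  have hκ0 : κ ≠ 0 := bilin_self_ne_zero hα0
  refine ⟨gaussConst n K' R / (‖κ‖ ^ (2 * m α) * δ ^ 4), K', fun η hη h1 h2 y hy => ?_⟩
  set x := contour η y with hx
  have hA1 : δ ≤ ‖B x‖ := h1.trans (norm_Am_le_contour _ _ _ _)
  have hA2 : δ ≤ ‖B (reflC α x)‖ := by
    rw [hx, reflC_contour]
    exact h2.trans (norm_Am_le_contour _ _ _ _)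
  -- The normal coordinate: x = x₀ + wα with (x₀, α) = 0, and the reflection changes w to -w.
  set w := bilin x (toComplex α) / κ with hw
  set x₀ := x - w • toComplex α with hx₀
  have hx₀0 : bilin x₀ (toComplex α) = 0 := by
    rw [hx₀, sub_eq_add_neg, ← neg_smul, bilin_add_left, bilin_smul_left, hw, ← hκ]
    field_simp
    ring
  have hx1 : x₀ + w • toComplex α = x := by rw [hx₀]; abel
  have hx2 : x₀ - w • toComplex α = reflC α x := by
    rw [hx₀, reflC, two_mul, add_smul]; abel
  have h3 := hN x₀ hx₀0 w
  rw [hx1, hx2] at h3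
  have hw0 : w ≠ 0 := div_ne_zero hy hκ0
  have hwp : 0 < ‖w‖ ^ (2 * m α) := pow_pos (norm_pos_iff.2 hw0) _
  set N := f x * B (reflC α x) ^ 2 - f (reflC α x) * B x ^ 2 with hNdef
  have h4 : ‖N / w ^ (2 * m α)‖ ≤ Real.exp (K' * (1 + ‖x‖)) := by
    rw [norm_div, norm_pow, div_le_iff₀ hwp, mul_comm]
    exact h3
  have h5 := norm_mul_gaussDensity_le hK' hη h4
  rw [kernel_sub_kernel_reflC hα hα0 x hy (norm_pos_iff.1 (hδ.trans_le hA1))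
    (norm_pos_iff.1 (hδ.trans_le hA2)), ← hB, ← hNdef]
  have h6 : bilin x (toComplex α) = w * κ := by rw [hw]; field_simp
  have h7 : N * gaussDensity x / (bilin x (toComplex α) ^ (2 * m α) *
      (B x ^ 2 * B (reflC α x) ^ 2)) = (N / w ^ (2 * m α) * gaussDensity x) /
      (κ ^ (2 * m α) * (B x ^ 2 * B (reflC α x) ^ 2)) := by
    rw [h6, mul_pow, div_mul_eq_mul_div, div_div]
    ring_nf
  rw [h7, norm_div, div_mul_eq_mul_div (gaussConst n K' R)]
  refine div_le_div₀ (mul_nonneg (gaussConst_pos _ _ _).le (weight_pos _ _).le) h5 ?_ ?_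
  · have := norm_pos_iff.2 hκ0
    positivity
  · rw [norm_mul, norm_mul, norm_pow, norm_pow, norm_pow]
    refine mul_le_mul_of_nonneg_left ?_ (by positivity)
    calc δ ^ 4 = δ ^ 2 * δ ^ 2 := by ring
      _ ≤ _ := by gcongr

theorem volume_hyperplane {α : Fin n → ℝ} (hα : α ≠ 0) : volume (hyperplane α) = 0 := by
  let S : Submodule ℝ (Fin n → ℝ) :=
    { carrier := hyperplane α
      add_mem' := add_mem_hyperplane
      zero_mem' := by simp [hyperplane]
      smul_mem' := fun c x hx => smul_mem_hyperplane hx c }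
  refine Measure.addHaar_submodule volume S fun htop => ?_
  have : α ∈ S := htop ▸ Submodule.mem_top
  exact (normSq_pos hα).ne' this

theorem mem_generic_of_Am {α η : Fin n → ℝ} (hη : ∀ β ∈ 𝒜, β ≠ α → bilin (toComplex η) (toComplex β) ≠ 0)
    (h : bilin (toComplex η) (toComplex α) ≠ 0) : η ∈ generic 𝒜 := by
  intro β hβ
  rcases eq_or_ne β α with rfl | hne
  · exact h
  · exact hη β hβ hne

open Filter Topology in
/-- The jump of the integral across a hyperplane tends to zero. -/
theorem IsAdmissible.tendsto_sub (h : IsAdmissible 𝒜 m f K) {α : Fin n → ℝ} (hα : α ∈ 𝒜)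
    (hα0 : α ≠ 0) {ξ : Fin n → ℝ} (hξ : ξ ∈ hyperplane α)
    (hξ' : ∀ β ∈ 𝒜, β ≠ α → bilin (toComplex ξ) (toComplex β) ≠ 0) :
    Tendsto (fun s : ℝ => (∫ y, kernel 𝒜 m f (contour (ξ + s • α) y))
      - ∫ y, kernel 𝒜 m f (contour (ξ - s • α) y)) (𝓝[>] 0) (𝓝 0) := by
  set B := Am 𝒜 (Function.update m α 0) with hB
  have hBξ : 0 < ‖B (toComplex ξ)‖ := by
    refine norm_pos_iff.2 ?_
    rw [hB, ← eval_AmPoly]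
    exact eval_AmPoly_update_ne_zero hξ' m
  set δ := ‖B (toComplex ξ)‖ / 2
  have hδ : 0 < δ := half_pos hBξ
  obtain ⟨C, K', hC⟩ := h.exists_norm_sub_le hα hα0 (δ := δ) (R := ‖ξ‖ + 1) hδ
  have hBcont : Continuous fun η : Fin n → ℝ => ‖B (toComplex η)‖ :=
    ((continuous_Am _ _).comp continuous_toComplex).norm
  have hc1 : Continuous fun s : ℝ => ξ + s • α := by fun_prop
  have hc2 : Continuous fun s : ℝ => ξ - s • α := by fun_prop
  -- the parameters close to zero
  have hev : ∀ᶠ s : ℝ in 𝓝 0, ‖ξ + s • α‖ ≤ ‖ξ‖ + 1 ∧ δ ≤ ‖B (toComplex (ξ + s • α))‖ ∧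
      δ ≤ ‖B (toComplex (ξ - s • α))‖ ∧
      (∀ β ∈ 𝒜, β ≠ α → bilin (toComplex (ξ + s • α)) (toComplex β) ≠ 0) ∧
      (∀ β ∈ 𝒜, β ≠ α → bilin (toComplex (ξ - s • α)) (toComplex β) ≠ 0) := by
    have hδ' : δ < ‖B (toComplex ξ)‖ := half_lt_self hBξ
    refine (hc1.norm.continuousAt.eventually_le_const (by simp)).and
      (((hBcont.comp hc1).continuousAt.eventually_const_le (by simpa using hδ')).and
      (((hBcont.comp hc2).continuousAt.eventually_const_le (by simpa using hδ')).and
      (((Finset.eventually_all 𝒜).2 fun β hβ => ?_).and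
        ((Finset.eventually_all 𝒜).2 fun β hβ => ?_))))
    · by_cases hne : β = α
      · exact Eventually.of_forall fun s hs => absurd hne hs
      · have hc := (continuous_bilin_toComplex (toComplex β)).comp (continuous_toComplex.comp hc1)
        exact (hc.continuousAt.eventually_ne (by simpa using hξ' β hβ hne)).mono fun s hs _ => hs
    · by_cases hne : β = α
      · exact Eventually.of_forall fun s hs => absurd hne hs
      · have hc := (continuous_bilin_toComplex (toComplex β)).comp (continuous_toComplex.comp hc2)
        exact (hc.continuousAt.eventually_ne (by simpa using hξ' β hβ hne)).mono fun s hs _ => hs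
  have hαξ := bilin_eq_zero_of_mem_hyperplane hξ
  have hne1 : ∀ s : ℝ, s ≠ 0 → bilin (toComplex (ξ + s • α)) (toComplex α) ≠ 0 := by
    intro s hs
    rw [toComplex_add, toComplex_smul, bilin_add_left, hαξ, zero_add, bilin_smul_left]
    exact mul_ne_zero (by exact_mod_cast hs) (bilin_self_ne_zero hα0)
  have hne2 : ∀ s : ℝ, s ≠ 0 → bilin (toComplex (ξ - s • α)) (toComplex α) ≠ 0 := by
    intro s hs
    have := hne1 (-s) (neg_ne_zero.2 hs)
    rwa [neg_smul, ← sub_eq_add_neg] at this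
  -- The reflection carries the contour through ξ + sα to the one through ξ - sα, so the integral of
  -- D over the former is the jump. Unlike the two kernels, D stays dominated as s tends to 0.
  set D : (Fin n → ℂ) → ℂ := fun x => kernel 𝒜 m f x - kernel 𝒜 m f (reflC α x) with hD
  have hint : ∀ η ∈ generic 𝒜, Integrable fun y => kernel 𝒜 m f (contour η y) := fun η hη =>
    integrable_kernel_contour h.differentiable.continuous h.nonneg h.growth hη
  have hrefl : ∀ s : ℝ, refl α (ξ + s • α) = ξ - s • α := refl_add_smul hα0 hξ
  have hrefl0 : refl α ξ = ξ := by simpa using hrefl 0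
  have hJ : ∀ᶠ s : ℝ in 𝓝[>] 0, ∫ y, D (contour (ξ + s • α) y)
      = (∫ y, kernel 𝒜 m f (contour (ξ + s • α) y))
        - ∫ y, kernel 𝒜 m f (contour (ξ - s • α) y) := by
    filter_upwards [nhdsWithin_le_nhds hev, self_mem_nhdsWithin] with s hs hs0
    have hs0' : s ≠ 0 := ne_of_gt hs0
    have hg1 := mem_generic_of_Am hs.2.2.2.1 (hne1 s hs0')
    have hg2 := mem_generic_of_Am hs.2.2.2.2 (hne2 s hs0')
    have h1 := integral_comp_refl hα0 fun y => kernel 𝒜 m f (contour (ξ - s • α) y)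
    have h2 : (fun y => kernel 𝒜 m f (reflC α (contour (ξ + s • α) y)))
        = fun y => kernel 𝒜 m f (contour (ξ - s • α) (refl α y)) := by
      ext y
      rw [reflC_contour, hrefl]
    have h3 : Integrable fun y => kernel 𝒜 m f (reflC α (contour (ξ + s • α) y)) := by
      have hc : Continuous fun y => kernel 𝒜 m f (reflC α (contour (ξ + s • α) y)) := by
        rw [h2]
        exact (continuous_kernel_contour h.differentiable.continuous hg2).comp
          (LinearMap.continuous_of_finiteDimensional _)
      have h4 : Integrable fun y => D (contour (ξ + s • α) y) := by
        refine ((integrable_weight K').const_mul C).mono'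
          ((continuous_kernel_contour h.differentiable.continuous hg1).sub hc).aestronglyMeasurable
          (Eventually.of_forall fun y => hC _ hs.1 hs.2.1 (by rw [hrefl]; exact hs.2.2.1) y ?_)
        exact norm_pos_iff.1 ((norm_pos_iff.2 (hne1 s hs0')).trans_le
          (norm_bilin_le_bilin_contour _ _ _))
      have := (hint _ hg1).sub h4
      refine this.congr (Eventually.of_forall fun y => ?_)
      simp [hD]
    simp only [hD]
    rw [integral_sub (hint _ hg1) h3, h2, h1]
  -- At s = 0 the contour is invariant under the reflection and D is odd.
  have h0 : ∫ y, D (contour ξ y) = 0 := by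
    have h1 := integral_comp_refl hα0 fun y => D (contour ξ y)
    have h2 : ∀ y, D (contour ξ (refl α y)) = -D (contour ξ y) := by
      intro y
      have : contour ξ (refl α y) = reflC α (contour ξ y) := by rw [reflC_contour, hrefl0]
      simp only [hD, this, reflC_reflC hα0]
      ring
    simp only [h2] at h1
    rw [integral_neg] at h1
    exact self_eq_neg.1 h1.symm
  rw [← h0]
  refine Tendsto.congr' hJ ?_
  refine tendsto_integral_filter_of_dominated_convergence (fun y => C * weight K' y) ?_ ?_
    ((integrable_weight K').const_mul C) ?_
  · filter_upwards [nhdsWithin_le_nhds hev, self_mem_nhdsWithin] with s hs hs0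
    have hs0' : s ≠ 0 := ne_of_gt hs0
    have hg1 := mem_generic_of_Am hs.2.2.2.1 (hne1 s hs0')
    have hg2 := mem_generic_of_Am hs.2.2.2.2 (hne2 s hs0')
    refine Continuous.aestronglyMeasurable
      ((continuous_kernel_contour h.differentiable.continuous hg1).sub ?_)
    simp only [reflC_contour, hrefl]
    exact (continuous_kernel_contour h.differentiable.continuous hg2).comp
      (LinearMap.continuous_of_finiteDimensional _)
  · filter_upwards [nhdsWithin_le_nhds hev, self_mem_nhdsWithin] with s hs hs0
    refine Eventually.of_forall fun y => hC _ hs.1 hs.2.1 (by rw [hrefl]; exact hs.2.2.1) y ?_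
    exact norm_pos_iff.1 ((norm_pos_iff.2 (hne1 s (ne_of_gt hs0))).trans_le
      (norm_bilin_le_bilin_contour _ _ _))
  -- On the limiting contour the denominator vanishes only for y in Π_α, a null set.
  · have hae : ∀ᵐ y : Fin n → ℝ, y ∉ hyperplane α := by
      rw [← measure_eq_zero_iff_ae_notMem]
      exact volume_hyperplane hα0
    filter_upwards [hae] with y hy
    have hA : ∀ y, y ∉ hyperplane α → Am 𝒜 m (contour ξ y) ≠ 0 := by
      intro y hy
      refine Am_ne_zero m fun β hβ => ?_
      rcases eq_or_ne β α with rfl | hne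
      · rw [bilin_contour]
        have h1 : ∑ j, ξ j * β j = 0 := hξ
        rw [h1]
        have h2 : ∑ j, y j * β j ≠ 0 := hy
        simpa using (by exact_mod_cast h2 : ((∑ j, y j * β j : ℝ) : ℂ) ≠ 0)
      · exact norm_pos_iff.1 ((norm_pos_iff.2 (hξ' β hβ hne)).trans_le
          (norm_bilin_le_bilin_contour _ _ _))
    have hkc : ∀ x, Am 𝒜 m x ≠ 0 → ContinuousAt (kernel 𝒜 m f) x := fun x hx =>
      (h.differentiable.continuous.continuousAt.div ((continuous_Am 𝒜 m).continuousAt.pow 2)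
        (pow_ne_zero 2 hx)).mul differentiable_gaussDensity.continuous.continuousAt
    have hy' : refl α y ∉ hyperplane α := by
      intro hmem
      refine hy (mem_hyperplane_iff.2 ?_)
      have h1 := mem_hyperplane_iff.1 hmem
      rw [toComplex_refl, bilin_reflC hα0] at h1
      exact neg_eq_zero.1 h1
    have hreflc : Continuous (reflC α) := by
      unfold reflC
      have := continuous_bilin_toComplex (toComplex α)
      fun_prop
    have hDc : ContinuousAt D (contour ξ y) := by
      refine (hkc _ (hA y hy)).sub (ContinuousAt.comp (g := kernel 𝒜 m f) (hkc _ ?_)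
        hreflc.continuousAt)
      rw [reflC_contour, hrefl0]
      exact hA _ hy'
    have hcc : Continuous fun s : ℝ => contour (ξ + s • α) y := by
      unfold contour
      have := continuous_toComplex (n := n)
      fun_prop
    have h1 := hcc.tendsto 0
    simp only [zero_smul, add_zero] at h1
    exact (hDc.tendsto.comp h1).mono_left nhdsWithin_le_nhds

end Crossing

/-! ### Independence of the contour -/

section Independence

variable {𝒜 : Finset (Fin n → ℝ)} {m : (Fin n → ℝ) → ℕ} {f : (Fin n → ℂ) → ℂ} {K : ℝ}

open Filter Topology in
theorem IsAdmissible.exists_const_of_convex (h : IsAdmissible 𝒜 m f K) {V : Set (Fin n → ℝ)}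
    (hV : IsOpen V) (hc : Convex ℝ V) (hsub : V ⊆ generic 𝒜) :
    ∃ a, ∀ η ∈ V, ∫ y, kernel 𝒜 m f (contour η y) = a := by
  have hd : ∀ η ∈ V, HasFDerivAt (fun η => ∫ y, kernel 𝒜 m f (contour η y))
      (0 : (Fin n → ℝ) →L[ℝ] ℂ) η := fun η hη =>
    (hasFDerivAt_const (∫ y, kernel 𝒜 m f (contour η y)) η).congr_of_eventuallyEq
      (eventually_integral_kernel_eq h.differentiable h.nonneg h.growth (hsub hη))
  exact hV.exists_is_const_of_fderiv_eq_zero (𝕜 := ℝ) hc.isPreconnected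
    (fun η hη => (hd η hη).differentiableAt.differentiableWithinAt) fun η hη => (hd η hη).fderiv

-- At most one hyperplane passes through ξ. A small ball is cut by it into two convex halves of
-- generic points, on each of which the integral is constant, and the vanishing jump identifies the
-- two constants.
open Filter Topology in
theorem IsAdmissible.exists_eventually_eq (h : IsAdmissible 𝒜 m f K)
    (h_ne : ∀ α ∈ 𝒜, α ≠ 0) {ξ : Fin n → ℝ}
    (hξ : ∀ α ∈ 𝒜, ∀ β ∈ 𝒜, α ≠ β → bilin (toComplex ξ) (toComplex α) = 0 →
      bilin (toComplex ξ) (toComplex β) ≠ 0) :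
    ∃ c, ∀ᶠ η in 𝓝 ξ, η ∈ generic 𝒜 → ∫ y, kernel 𝒜 m f (contour η y) = c := by
  by_cases hg : ξ ∈ generic 𝒜
  · exact ⟨_, (eventually_integral_kernel_eq h.differentiable h.nonneg h.growth hg).mono
      fun η hη _ => hη⟩
  obtain ⟨α, hα, hα0⟩ : ∃ α ∈ 𝒜, bilin (toComplex ξ) (toComplex α) = 0 := by
    simpa [generic] using hg
  have hξ' : ∀ β ∈ 𝒜, β ≠ α → bilin (toComplex ξ) (toComplex β) ≠ 0 := fun β hβ hne =>
    hξ α hα β hβ hne.symm hα0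
  have hmem : ξ ∈ hyperplane α := mem_hyperplane_iff.2 hα0
  have hev : ∀ᶠ η in 𝓝 ξ, ∀ β ∈ 𝒜, β ≠ α → bilin (toComplex η) (toComplex β) ≠ 0 := by
    refine (Finset.eventually_all 𝒜).2 fun β hβ => ?_
    by_cases hne : β = α
    · exact Eventually.of_forall fun s hs => absurd hne hs
    · have hc := (continuous_bilin_toComplex (toComplex β)).comp (continuous_toComplex (n := n))
      exact (hc.continuousAt.eventually_ne (hξ' β hβ hne)).mono fun s hs _ => hs
  obtain ⟨r, hr, hball⟩ := Metric.eventually_nhds_iff_ball.1 hev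
  let L : (Fin n → ℝ) →ₗ[ℝ] ℝ := ∑ j, α j • LinearMap.proj j
  have hL : ∀ η, L η = ∑ j, η j * α j := fun η => by
    simp [L, LinearMap.sum_apply, mul_comm]
  have hLc : Continuous L := LinearMap.continuous_of_finiteDimensional _
  have hL0 : ∀ η, L η ≠ 0 → bilin (toComplex η) (toComplex α) ≠ 0 := by
    intro η hη
    rw [bilin_toComplex, ← hL]
    exact_mod_cast hη
  obtain ⟨a, ha⟩ := h.exists_const_of_convex (V := Metric.ball ξ r ∩ {η | 0 < L η})
    (Metric.isOpen_ball.inter (isOpen_lt continuous_const hLc))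
    ((convex_ball _ _).inter (convex_halfSpace_gt L.isLinear 0))
    fun η hη => mem_generic_of_Am (hball η hη.1) (hL0 η (ne_of_gt hη.2))
  obtain ⟨b, hb⟩ := h.exists_const_of_convex (V := Metric.ball ξ r ∩ {η | L η < 0})
    (Metric.isOpen_ball.inter (isOpen_lt hLc continuous_const))
    ((convex_ball _ _).inter (convex_halfSpace_lt L.isLinear 0))
    fun η hη => mem_generic_of_Am (hball η hη.1) (hL0 η (ne_of_lt hη.2))
  have hab : a - b = 0 := by
    refine tendsto_nhds_unique_of_eventuallyEq tendsto_const_nhds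
      (h.tendsto_sub hα (h_ne α hα) hmem hξ') ?_
    have hc1 : Continuous fun s : ℝ => ξ + s • α := by fun_prop
    have hc2 : Continuous fun s : ℝ => ξ - s • α := by fun_prop
    have h1 : ∀ᶠ s : ℝ in 𝓝 0, ξ + s • α ∈ Metric.ball ξ r :=
      hc1.continuousAt.eventually_mem (Metric.isOpen_ball.mem_nhds (by simpa using hr))
    have h2 : ∀ᶠ s : ℝ in 𝓝 0, ξ - s • α ∈ Metric.ball ξ r :=
      hc2.continuousAt.eventually_mem (Metric.isOpen_ball.mem_nhds (by simpa using hr))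
    have hLξ : L ξ = 0 := by rw [hL]; exact hmem
    have hLα : 0 < L α := by rw [hL]; exact normSq_pos (h_ne α hα)
    filter_upwards [nhdsWithin_le_nhds h1, nhdsWithin_le_nhds h2, self_mem_nhdsWithin]
      with s hs1 hs2 hs0
    have hs0' : 0 < s := hs0
    rw [ha _ ⟨hs1, ?_⟩, hb _ ⟨hs2, ?_⟩]
    · change L (ξ - s • α) < 0
      rw [map_sub, map_smul, hLξ, smul_eq_mul]
      linarith [mul_pos hs0' hLα]
    · change 0 < L (ξ + s • α)
      rw [map_add, map_smul, hLξ, smul_eq_mul]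
      linarith [mul_pos hs0' hLα]
  refine ⟨a, Metric.eventually_nhds_iff_ball.2 ⟨r, hr, fun η hη hgη => ?_⟩⟩
  rcases lt_trichotomy (L η) 0 with h1 | h1 | h1
  · rw [hb η ⟨hη, h1⟩, sub_eq_zero.1 hab]
  · refine absurd ?_ (hgη α hα)
    rw [bilin_toComplex, ← hL, h1, Complex.ofReal_zero]
  · exact ha η ⟨hη, h1⟩

open Filter Topology in
theorem eventually_polynomial_ne_zero {p : Polynomial ℂ} (hp : p ≠ 0) (t : ℝ) :
    ∀ᶠ s : ℝ in 𝓝[≠] t, p.eval (s : ℂ) ≠ 0 := by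
  have hfin : {s : ℝ | p.eval (s : ℂ) = 0}.Finite := by
    refine Set.Finite.preimage Complex.ofReal_injective.injOn
      (s := {z : ℂ | p.eval z = 0}) ?_
    exact (p.rootSet_finite ℂ).subset fun z hz => by
      rw [Polynomial.mem_rootSet]
      exact ⟨hp, by simpa using hz⟩
  exact nhdsNE_le_cofinite t hfin.compl_mem_cofinite

theorem eval_line_ofReal (x y : Fin n → ℝ) (Q : MvPolynomial (Fin n) ℂ) (t : ℝ) :
    (line (toComplex x) (toComplex (y - x)) Q).eval (t : ℂ)
      = MvPolynomial.eval (toComplex (x + t • (y - x))) Q := by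
  rw [eval_line, toComplex_add, toComplex_smul]

open Filter Topology in
/-- The integral does not depend on the contour. -/
theorem IsAdmissible.integral_eq (h : IsAdmissible 𝒜 m f K) (h_ne : ∀ α ∈ 𝒜, α ≠ 0)
    (h_nc : ∀ α ∈ 𝒜, ∀ β ∈ 𝒜, α ≠ β → LinearIndependent ℝ ![α, β]) {ξ₀ ξ₁ : Fin n → ℝ}
    (h₀ : ξ₀ ∈ generic 𝒜) (h₁ : ξ₁ ∈ generic 𝒜) :
    ∫ y, kernel 𝒜 m f (contour ξ₀ y) = ∫ y, kernel 𝒜 m f (contour ξ₁ y) := by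
  -- a generic end point near `ξ₁`
  let r : (Fin n → ℝ) → ℝ := fun α => ∑ j, ξ₀ j * α j
  have hr : ∀ α ∈ 𝒜, r α ≠ 0 := by
    intro α hα h0
    refine h₀ α hα ?_
    rw [bilin_toComplex]
    exact_mod_cast h0
  -- If the segment from ξ₀ to η met Π_α and Π_β at the same point, eliminating the contribution of
  -- ξ₀ would give (η, r_β α - r_α β) = 0. Nonvanishing of S at η therefore makes it cross the
  -- hyperplanes one at a time.
  let S : MvPolynomial (Fin n) ℂ :=
    ∏ α ∈ 𝒜, ∏ β ∈ 𝒜.erase α, linForm (r β • α - r α • β)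
  have hS0 : S ≠ 0 := by
    refine Finset.prod_ne_zero_iff.2 fun α hα => Finset.prod_ne_zero_iff.2 fun β hβ => ?_
    rw [Finset.mem_erase] at hβ
    refine linForm_ne_zero fun h0 => hr β hβ.2 ?_
    have := (LinearIndependent.pair_iff.1 (h_nc α hα β hβ.2 hβ.1.symm)) (r β) (-r α) (by
      rw [neg_smul, ← sub_eq_add_neg, h0])
    exact this.1
  obtain ⟨x, hx⟩ := exists_eval_ne_zero hS0
  have hSx : line (toComplex ξ₁) (toComplex (x - ξ₁)) S ≠ 0 := by
    intro h0
    have := eval_line_ofReal ξ₁ x S 1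
    rw [h0, Polynomial.eval_zero, one_smul, add_sub_cancel] at this
    exact hx this.symm
  have hcont : Continuous fun t : ℝ => ξ₁ + t • (x - ξ₁) := by fun_prop
  have hlim : Tendsto (fun t : ℝ => ξ₁ + t • (x - ξ₁)) (𝓝[≠] 0) (𝓝 ξ₁) := by
    have := hcont.tendsto 0
    simp only [zero_smul, add_zero] at this
    exact this.mono_left nhdsWithin_le_nhds
  obtain ⟨t, ht1, ht2⟩ := ((eventually_polynomial_ne_zero hSx 0).and (hlim.eventually
    ((eventually_integral_kernel_eq h.differentiable h.nonneg h.growth h₁).and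
      ((isOpen_generic 𝒜).eventually_mem h₁)))).exists
  rw [eval_line_ofReal] at ht1
  set η := ξ₁ + t • (x - ξ₁) with hη
  rw [← ht2.1]
  -- the segment from `ξ₀` to `η`
  have hηS : ∀ α ∈ 𝒜, ∀ β ∈ 𝒜, α ≠ β →
      bilin (toComplex η) (toComplex (r β • α - r α • β)) ≠ 0 := by
    intro α hα β hβ hne
    have h1 := ht1
    rw [map_prod, Finset.prod_ne_zero_iff] at h1
    have h2 := h1 α hα
    rw [map_prod, Finset.prod_ne_zero_iff] at h2
    have h3 := h2 β (Finset.mem_erase.2 ⟨hne.symm, hβ⟩)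
    rwa [eval_linForm] at h3
  set γ : ℝ → Fin n → ℝ := fun s => ξ₀ + s • (η - ξ₀) with hγ
  have hγc : Continuous γ := by fun_prop
  have hγb : ∀ s α, bilin (toComplex (γ s)) (toComplex α)
      = (1 - s) * r α + s * bilin (toComplex η) (toComplex α) := by
    intro s α
    have hsub : toComplex (η - ξ₀) = toComplex η + (-1 : ℂ) • toComplex ξ₀ := by
      ext j; simp [toComplex, sub_eq_add_neg]
    have h1 : bilin (toComplex ξ₀) (toComplex α) = r α := bilin_toComplex _ _
    rw [hγ, toComplex_add, toComplex_smul, bilin_add_left, bilin_smul_left, hsub, bilin_add_left,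
      bilin_smul_left, h1]
    ring
  have hone : ∀ s, ∀ α ∈ 𝒜, ∀ β ∈ 𝒜, α ≠ β → bilin (toComplex (γ s)) (toComplex α) = 0 →
      bilin (toComplex (γ s)) (toComplex β) ≠ 0 := by
    intro s α hα β hβ hne h1 h2
    rw [hγb] at h1 h2
    have h3 : (s : ℂ) * bilin (toComplex η) (toComplex (r β • α - r α • β)) = 0 := by
      have hsub : toComplex (r β • α - r α • β)
          = (r β : ℂ) • toComplex α + (-(r α : ℂ)) • toComplex β := by
        ext j; simp [toComplex, sub_eq_add_neg]
      rw [hsub, bilin_add_right, bilin_smul_right, bilin_smul_right]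
      linear_combination (r β : ℂ) * h1 - (r α : ℂ) * h2
    rcases mul_eq_zero.1 h3 with h4 | h4
    · rw [h4] at h1
      simp only [sub_zero, one_mul, zero_mul, add_zero, Complex.ofReal_eq_zero] at h1
      exact hr α hα h1
    · exact hηS α hα β hβ hne h4
  have hgen : ∀ s, ∀ᶠ s' in 𝓝[≠] s, γ s' ∈ generic 𝒜 := by
    intro s
    have hp : line (toComplex ξ₀) (toComplex (η - ξ₀)) (AmPoly 𝒜 fun _ => 1) ≠ 0 := by
      intro h0
      have h1 := eval_line_ofReal ξ₀ η (AmPoly 𝒜 fun _ => 1) 0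
      rw [h0, Polynomial.eval_zero, zero_smul, add_zero, eval_AmPoly] at h1
      exact Am_ne_zero _ h₀ h1.symm
    filter_upwards [eventually_polynomial_ne_zero hp s] with s' hs' α hα h0
    rw [eval_line_ofReal, eval_AmPoly] at hs'
    refine hs' (Finset.prod_eq_zero hα ?_)
    rw [pow_one]; exact h0
  choose c hc using fun s => h.exists_eventually_eq h_ne (hone s)
  have hc' : ∀ s, ∀ᶠ s' in 𝓝 s, γ s' ∈ generic 𝒜 →
      ∫ y, kernel 𝒜 m f (contour (γ s') y) = c s := fun s =>
    hγc.continuousAt.eventually (hc s)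
  -- The local constants at two nearby parameters both equal the integral at some generic point of
  -- the segment; the nongeneric parameters are isolated.
  have hloc : IsLocallyConstant c := by
    rw [IsLocallyConstant.iff_eventually_eq]
    intro s
    filter_upwards [(hc' s).eventually_nhds] with s' hs'
    obtain ⟨s'', h1, h2, h3⟩ :=
      ((hgen s').and ((hs'.filter_mono nhdsWithin_le_nhds).and
        ((hc' s').filter_mono nhdsWithin_le_nhds))).exists
    rw [← h2 h1, h3 h1]
  have hγ0 : γ 0 = ξ₀ := by simp [hγ]
  have hγ1 : γ 1 = η := by simp [hγ]
  have e0 := (hc' 0).self_of_nhds (by rwa [hγ0])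
  have e1 := (hc' 1).self_of_nhds (by rw [hγ1]; exact ht2.2)
  rw [hγ0] at e0
  rw [hγ1] at e1
  rw [e0, e1]
  exact hloc.apply_eq_of_preconnectedSpace 0 1

end Independence

/-! ### The integral as a function of the spectral parameters -/

/-- A function with a polynomial factor `F` satisfying the defining properties of a Baker-Akhiezer
function. -/
structure IsModel (𝒜 : Finset (Fin n → ℝ)) (m : (Fin n → ℝ) → ℕ)
    (φ : (Fin n → ℂ) → (Fin n → ℂ) → ℂ)
    (F : MvPolynomial (Fin n) (MvPolynomial (Fin n) ℂ)) : Prop where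
  ne_zero : ∀ α ∈ 𝒜, α ≠ 0
  linearIndependent : ∀ α ∈ 𝒜, ∀ β ∈ 𝒜, α ≠ β → LinearIndependent ℝ ![α, β]
  factor : ∀ lam, IsFactor 𝒜 m lam (MvPolynomial.map (MvPolynomial.eval lam) F)
  eq : ∀ x lam, φ x lam = MvPolynomial.eval x (MvPolynomial.map (MvPolynomial.eval lam) F)
    * Complex.exp (bilin x lam)

/-- The function `φ(-ix, lam) φ(ix, mu)`. -/
noncomputable def pairing (φ : (Fin n → ℂ) → (Fin n → ℂ) → ℂ) (lam mu x : Fin n → ℂ) : ℂ :=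
  φ (-Complex.I • x) lam * φ (Complex.I • x) mu

theorem differentiable_bilin (β : Fin n → ℂ) : Differentiable ℂ fun x => bilin x β := by
  unfold bilin; fun_prop

theorem oddVanish_polynomial_mul_exp {q : Polynomial ℂ} {k : ℕ} {γ : ℂ}
    (h : ∀ j < k, expDeriv (2 * j + 1) γ q = 0) (a : ℂ) :
    OddVanish k fun t => q.eval t * Complex.exp (a + t * γ) := fun j hj => by
  rw [iteratedDeriv_polynomial_mul_exp, h j hj, mul_zero]

section Model

variable {𝒜 : Finset (Fin n → ℝ)} {m : (Fin n → ℝ) → ℕ} {φ : (Fin n → ℂ) → (Fin n → ℂ) → ℂ}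
  {F : MvPolynomial (Fin n) (MvPolynomial (Fin n) ℂ)}

theorem IsModel.eq_atPoint (h : IsModel 𝒜 m φ F) (x lam : Fin n → ℂ) :
    φ x lam = MvPolynomial.eval lam (atPoint F x) * Complex.exp (bilin lam x) := by
  rw [h.eq, eval_atPoint, bilin_comm]

theorem IsModel.differentiable_left (h : IsModel 𝒜 m φ F) (lam : Fin n → ℂ) :
    Differentiable ℂ fun x => φ x lam := by
  simp only [h.eq]
  exact (differentiable_eval _).fun_mul (differentiable_bilin lam).cexp

theorem IsModel.differentiable_right (h : IsModel 𝒜 m φ F) (x : Fin n → ℂ) :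
    Differentiable ℂ (φ x) := by
  have : φ x = fun lam => MvPolynomial.eval lam (atPoint F x) * Complex.exp (bilin lam x) :=
    funext (h.eq_atPoint x)
  rw [this]
  exact (differentiable_eval _).fun_mul (differentiable_bilin x).cexp

theorem IsModel.oddVanish_left (h : IsModel 𝒜 m φ F) {α : Fin n → ℝ} (hα : α ∈ 𝒜)
    (lam : Fin n → ℂ) {x : Fin n → ℂ} (hx : bilin x (toComplex α) = 0) :
    OddVanish (m α) fun t => φ (x + t • toComplex α) lam := by
  simp only [h.eq, bilin_add_left, bilin_smul_left, ← eval_line]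
  refine oddVanish_polynomial_mul_exp (fun j hj => ?_) _
  rw [bilin_comm]
  exact ((h.factor lam).quasiInv α hα).of_bilin_eq_zero (h.ne_zero α hα) hx hj

theorem IsModel.oddVanish_right (h : IsModel 𝒜 m φ F) {α : Fin n → ℝ} (hα : α ∈ 𝒜)
    (x : Fin n → ℂ) {lam : Fin n → ℂ} (hlam : bilin lam (toComplex α) = 0) :
    OddVanish (m α) fun c => φ x (lam + c • toComplex α) := by
  simp only [h.eq_atPoint, bilin_add_left, bilin_smul_left, ← eval_line]
  refine oddVanish_polynomial_mul_exp (fun j hj => ?_) _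
  rw [bilin_comm]
  exact (quasiInv_atPoint h.ne_zero h.linearIndependent h.factor hα x).of_bilin_eq_zero
    (h.ne_zero α hα) hlam hj

theorem OddVanish.comp_const_mul {k : ℕ} {f : ℂ → ℂ} (hf : OddVanish k f)
    (hd : Differentiable ℂ f) (c : ℂ) : OddVanish k fun t => f (c * t) := by
  intro j hj
  rw [iteratedDeriv_comp_const_mul hd.contDiff]
  simp [hf j hj]

/-- Uniform exponential growth of the pairing. -/
theorem IsModel.exists_norm_pairing_le (h : IsModel 𝒜 m φ F) (R : ℝ) :
    ∃ K : ℝ, 0 ≤ K ∧ ∀ lam mu x, ‖lam‖ ≤ R → ‖mu‖ ≤ R →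
      ‖pairing φ lam mu x‖ ≤ Real.exp (K * (1 + ‖x‖)) := by
  obtain ⟨K, hK, hb⟩ := exists_norm_le_exp h.eq R
  refine ⟨2 * K, by positivity, fun lam mu x hlam hmu => ?_⟩
  have h1 := hb (-Complex.I • x) lam hlam
  have h2 := hb (Complex.I • x) mu hmu
  rw [norm_smul, norm_neg, Complex.norm_I, one_mul] at h1
  rw [norm_smul, Complex.norm_I, one_mul] at h2
  rw [pairing, norm_mul, two_mul, add_mul, Real.exp_add]
  gcongr

theorem IsModel.differentiable_pairing (h : IsModel 𝒜 m φ F) (lam mu : Fin n → ℂ) :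
    Differentiable ℂ (pairing φ lam mu) := by
  unfold pairing
  have h1 : Differentiable ℂ fun x : Fin n → ℂ => φ (-Complex.I • x) lam :=
    (h.differentiable_left lam).comp (by fun_prop)
  have h2 : Differentiable ℂ fun x : Fin n → ℂ => φ (Complex.I • x) mu :=
    (h.differentiable_left mu).comp (by fun_prop)
  exact h1.fun_mul h2

/-- Vanishing of odd derivatives survives products and the scaling of x by ±i. The condition on A_m
is the restriction on the configuration from `coeff_odd_line_AmPoly`. -/
theorem IsModel.exists_isAdmissible (h : IsModel 𝒜 m φ F) (lam mu : Fin n → ℂ) :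
    ∃ K, IsAdmissible 𝒜 m (pairing φ lam mu) K := by
  obtain ⟨K, hK, hb⟩ := h.exists_norm_pairing_le (max ‖lam‖ ‖mu‖)
  refine ⟨K, h.differentiable_pairing lam mu, hK,
    fun x => hb lam mu x (le_max_left _ _) (le_max_right _ _), fun α hα x hx => ?_,
    fun α hα x hx k hk => ?_⟩
  · have hc : ∀ c : ℂ, bilin (c • x) (toComplex α) = 0 := fun c => by
      rw [bilin_smul_left, hx, mul_zero]
    have hd : ∀ (c : ℂ) (nu : Fin n → ℂ),
        Differentiable ℂ fun t : ℂ => φ (c • x + t • toComplex α) nu := fun c nu =>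
      (h.differentiable_left nu).comp (by fun_prop)
    have h1 : ∀ (c : ℂ) (nu : Fin n → ℂ),
        OddVanish (m α) fun t : ℂ => φ (c • (x + t • toComplex α)) nu := by
      intro c nu
      simp only [smul_add, smul_smul]
      exact (h.oddVanish_left hα nu (hc c)).comp_const_mul (hd c nu) c
    have h2 : ∀ (c : ℂ) (nu : Fin n → ℂ),
        Differentiable ℂ fun t : ℂ => φ (c • (x + t • toComplex α)) nu := fun c nu =>
      (h.differentiable_left nu).comp (by fun_prop)
    exact (h1 _ lam).mul (h1 _ mu) (h2 _ lam) (h2 _ mu)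
  · simp only [← eval_AmPoly, ← eval_line]
    rw [iteratedDeriv_polynomial_eval,
      coeff_odd_line_AmPoly h.ne_zero h.linearIndependent h.factor hα hk hx, mul_zero]

/-- The integral along the contour `iξ + ℝⁿ`. -/
noncomputable def contourInt (𝒜 : Finset (Fin n → ℝ)) (m : (Fin n → ℝ) → ℕ)
    (φ : (Fin n → ℂ) → (Fin n → ℂ) → ℂ) (ξ : Fin n → ℝ) (lam mu : Fin n → ℂ) : ℂ :=
  ∫ y, kernel 𝒜 m (pairing φ lam mu) (contour ξ y)

theorem IsModel.contourInt_eq (h : IsModel 𝒜 m φ F) {ξ₀ ξ₁ : Fin n → ℝ} (h₀ : ξ₀ ∈ generic 𝒜)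
    (h₁ : ξ₁ ∈ generic 𝒜) (lam mu : Fin n → ℂ) :
    contourInt 𝒜 m φ ξ₀ lam mu = contourInt 𝒜 m φ ξ₁ lam mu := by
  obtain ⟨K, hK⟩ := h.exists_isAdmissible lam mu
  exact hK.integral_eq h.ne_zero h.linearIndependent h₀ h₁

theorem IsModel.integrable (h : IsModel 𝒜 m φ F) {ξ : Fin n → ℝ} (hξ : ξ ∈ generic 𝒜)
    (lam mu : Fin n → ℂ) :
    Integrable fun y => kernel 𝒜 m (pairing φ lam mu) (contour ξ y) := by
  obtain ⟨K, hK⟩ := h.exists_isAdmissible lam mu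
  exact integrable_kernel_contour hK.differentiable.continuous hK.nonneg hK.growth hξ

/-- A bound that is uniform for bounded spectral parameters. -/
theorem IsModel.exists_norm_kernel_le (h : IsModel 𝒜 m φ F) {ξ : Fin n → ℝ}
    (hξ : ξ ∈ generic 𝒜) (R : ℝ) :
    ∃ C K : ℝ, ∀ lam mu, ‖lam‖ ≤ R → ‖mu‖ ≤ R → ∀ y,
      ‖kernel 𝒜 m (pairing φ lam mu) (contour ξ y)‖ ≤ C * weight K y := by
  obtain ⟨K, hK, hb⟩ := h.exists_norm_pairing_le R
  exact ⟨_, K, fun lam mu hlam hmu y => norm_kernel_contour_le hK le_rfl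
    (norm_pos_iff.2 (Am_ne_zero m hξ)) (norm_Am_le_contour 𝒜 m ξ y) (hb lam mu _ hlam hmu)⟩

theorem IsModel.differentiable_contourInt (h : IsModel 𝒜 m φ F) {ξ : Fin n → ℝ}
    (hξ : ξ ∈ generic 𝒜) (lam v mu : Fin n → ℂ) :
    Differentiable ℂ fun c : ℂ => contourInt 𝒜 m φ ξ (lam + c • v) mu := by
  intro c₀
  obtain ⟨C, K, hb⟩ := h.exists_norm_kernel_le hξ (max (‖lam‖ + (‖c₀‖ + 1) * ‖v‖) ‖mu‖)
  refine (differentiableOn_integral (W := fun y => C * weight K y) (U := Metric.ball 0 (‖c₀‖ + 1))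
    Metric.isOpen_ball (fun y => ?_) (fun c _ => ?_) ((integrable_weight K).const_mul C)
    fun c hc y => hb _ _ ?_ (le_max_right _ _) y).differentiableAt
    (Metric.isOpen_ball.mem_nhds (by simp))
  · refine Differentiable.differentiableOn ?_
    unfold kernel pairing
    have h1 : Differentiable ℂ fun c : ℂ => φ (-Complex.I • contour ξ y) (lam + c • v) :=
      (h.differentiable_right _).comp (by fun_prop)
    simp only [div_eq_mul_inv]
    exact ((h1.mul_const _).mul_const _).mul_const _
  · exact (h.integrable hξ _ _).aestronglyMeasurable
  · refine le_max_of_le_left ((norm_add_le _ _).trans ?_)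
    rw [norm_smul]
    have : ‖c‖ ≤ ‖c₀‖ + 1 := (mem_ball_zero_iff.1 hc).le
    gcongr

theorem IsModel.continuous_contourInt (h : IsModel 𝒜 m φ F) {ξ : Fin n → ℝ}
    (hξ : ξ ∈ generic 𝒜) (lam : Fin n → ℂ) :
    Continuous fun mu => contourInt 𝒜 m φ ξ lam mu := by
  refine continuous_iff_continuousAt.2 fun mu₀ => ?_
  obtain ⟨C, K, hb⟩ := h.exists_norm_kernel_le hξ (max ‖lam‖ (‖mu₀‖ + 1))
  refine continuousAt_of_dominated (bound := fun y => C * weight K y) ?_ ?_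
    ((integrable_weight K).const_mul C) ?_
  · exact Filter.Eventually.of_forall fun mu => (h.integrable hξ _ _).aestronglyMeasurable
  · filter_upwards [continuous_norm.continuousAt.eventually_lt_const (lt_add_one ‖mu₀‖)]
      with mu hmu
    exact Filter.Eventually.of_forall fun y =>
      hb lam mu (le_max_left _ _) (le_max_of_le_right hmu.le) y
  · refine Filter.Eventually.of_forall fun y => Continuous.continuousAt ?_
    unfold kernel pairing
    have h1 : Continuous fun mu => φ (Complex.I • contour ξ y) mu :=
      (h.differentiable_right _).continuous
    exact ((continuous_const.mul h1).div_const _).mul continuous_const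

/-- The integrand after completing the square. -/
noncomputable def shifted (𝒜 : Finset (Fin n → ℝ)) (m : (Fin n → ℝ) → ℕ)
    (F : MvPolynomial (Fin n) (MvPolynomial (Fin n) ℂ)) (lam mu w : Fin n → ℂ) : ℂ :=
  MvPolynomial.eval (-Complex.I • w + (mu - lam)) (MvPolynomial.map (MvPolynomial.eval lam) F)
    * MvPolynomial.eval (Complex.I • w - (mu - lam)) (MvPolynomial.map (MvPolynomial.eval mu) F)
    / Am 𝒜 m (w + Complex.I • (mu - lam)) ^ 2 * gaussDensity w

/-- The normalised integral. -/
noncomputable def normInt (𝒜 : Finset (Fin n → ℝ)) (m : (Fin n → ℝ) → ℕ)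
    (φ : (Fin n → ℂ) → (Fin n → ℂ) → ℂ) (ξ : Fin n → ℝ) (mu lam : Fin n → ℂ) : ℂ :=
  Complex.exp ((bilin lam lam + bilin mu mu) / 2 - bilin lam mu) * contourInt 𝒜 m φ ξ lam mu

/-- Completing the square: for x = w + i(μ - λ) the two exponentials of the pairing, the Gaussian in
x and the normalising factor combine into the Gaussian in w. -/
theorem IsModel.exp_mul_kernel (h : IsModel 𝒜 m φ F) (lam mu w : Fin n → ℂ) :
    Complex.exp ((bilin lam lam + bilin mu mu) / 2 - bilin lam mu)
      * kernel 𝒜 m (pairing φ lam mu) (w + Complex.I • (mu - lam)) = shifted 𝒜 m F lam mu w := by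
  have e1 : -Complex.I • (w + Complex.I • (mu - lam)) = -Complex.I • w + (mu - lam) := by
    rw [smul_add, smul_smul]; simp
  have e2 : Complex.I • (w + Complex.I • (mu - lam)) = Complex.I • w - (mu - lam) := by
    rw [smul_add, smul_smul]; simp [sub_eq_add_neg, add_comm]
  have e3 : mu - lam = mu + (-1 : ℂ) • lam := by rw [neg_smul, one_smul, sub_eq_add_neg]
  rw [kernel, pairing, shifted, h.eq, h.eq, e1, e2, gaussDensity, gaussDensity]
  set A := Am 𝒜 m (w + Complex.I • (mu - lam))
  set p := MvPolynomial.eval (-Complex.I • w + (mu - lam))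
    (MvPolynomial.map (MvPolynomial.eval lam) F)
  set q := MvPolynomial.eval (Complex.I • w - (mu - lam))
    (MvPolynomial.map (MvPolynomial.eval mu) F)
  set g : ℂ := (((2 * Real.pi) ^ (-(n : ℝ) / 2) : ℝ) : ℂ)
  have hexp : Complex.exp (-bilin w w / 2)
      = Complex.exp ((bilin lam lam + bilin mu mu) / 2 - bilin lam mu)
        * (Complex.exp (bilin (-Complex.I • w + (mu - lam)) lam)
          * Complex.exp (bilin (Complex.I • w - (mu - lam)) mu)
          * Complex.exp (-bilin (w + Complex.I • (mu - lam)) (w + Complex.I • (mu - lam)) / 2)) := by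
    rw [← Complex.exp_add, ← Complex.exp_add, ← Complex.exp_add]
    congr 1
    have e4 : Complex.I • w - (mu - lam) = Complex.I • w + (-1 : ℂ) • (mu - lam) := by
      rw [neg_smul, one_smul, sub_eq_add_neg]
    rw [e4, e3]
    simp only [bilin_add_left, bilin_add_right, bilin_smul_left, bilin_smul_right]
    rw [bilin_comm mu w, bilin_comm lam w, bilin_comm mu lam]
    linear_combination ((bilin mu mu - 2 * bilin lam mu + bilin lam lam) / 2) * Complex.I_sq
  rw [hexp]
  ring

/-- The real part of a vector. -/
def rePart (u : Fin n → ℂ) : Fin n → ℝ := fun j => (u j).re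

theorem contour_add_I_smul (η y : Fin n → ℝ) (u : Fin n → ℂ) :
    contour η y + Complex.I • u = contour (η + rePart u) (y - fun j => (u j).im) := by
  ext j
  simp only [contour, toComplex, rePart, Pi.add_apply, Pi.smul_apply, Pi.sub_apply, smul_eq_mul,
    Complex.ofReal_add, Complex.ofReal_sub]
  conv_lhs => rw [← Complex.re_add_im (u j)]
  linear_combination (u j).im * Complex.I_sq

/-- Independence of the contour permits a base point adapted to λ: the real part of μ - λ moves the
base point, and the imaginary part is a real translation of the variable of integration. -/
theorem IsModel.normInt_eq (h : IsModel 𝒜 m φ F) {ξ : Fin n → ℝ} (hξ : ξ ∈ generic 𝒜)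
    {lam mu : Fin n → ℂ} {η : Fin n → ℝ} (hη : η + rePart (mu - lam) ∈ generic 𝒜) :
    normInt 𝒜 m φ ξ mu lam = ∫ y, shifted 𝒜 m F lam mu (contour η y) := by
  rw [normInt, h.contourInt_eq hξ hη, contourInt]
  simp only [← h.exp_mul_kernel, contour_add_I_smul]
  rw [integral_const_mul, integral_sub_right_eq_self
    (fun y => kernel 𝒜 m (pairing φ lam mu) (contour (η + rePart (mu - lam)) y))]

end Model

/-! ### Functions that are polynomial in each variable -/

/-- Induction on the variables on which f depends. Lagrange interpolation in one of them at the
nodes 0, ..., K expresses f through restrictions depending on fewer variables; the uniform bound K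
allows fixed nodes. -/
theorem exists_mvPolynomial_of_finset (K : ℕ) (s : Finset (Fin n)) :
    ∀ f : (Fin n → ℂ) → ℂ,
      (∀ x j, ∃ p : Polynomial ℂ, p.natDegree ≤ K ∧ ∀ t, f (Function.update x j t) = p.eval t) →
      (∀ x y, (∀ j ∈ s, x j = y j) → f x = f y) →
      ∃ Q : MvPolynomial (Fin n) ℂ, ∀ x, f x = MvPolynomial.eval x Q := by
  induction s using Finset.induction_on with
  | empty =>
    intro f _ hs
    exact ⟨MvPolynomial.C (f 0), fun x => by
      rw [MvPolynomial.eval_C]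
      exact hs _ _ fun j hj => absurd hj (Finset.notMem_empty j)⟩
  | insert j s hj ih =>
    intro f hf hs
    have hg : ∀ i : ℕ, ∃ Q : MvPolynomial (Fin n) ℂ, ∀ x,
        f (Function.update x j (i : ℂ)) = MvPolynomial.eval x Q := by
      intro i
      refine ih _ (fun x j' => ?_) fun x y hxy => hs _ _ fun j' hj' => ?_
      · rcases eq_or_ne j' j with rfl | hne
        · exact ⟨Polynomial.C (f (Function.update x j' (i : ℂ))), by simp, by simp⟩
        · obtain ⟨p, hp, hpe⟩ := hf (Function.update x j (i : ℂ)) j'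
          exact ⟨p, hp, fun t => by rw [← hpe, Function.update_comm hne]⟩
      · rcases eq_or_ne j' j with rfl | hne
        · simp
        · rw [Function.update_of_ne hne, Function.update_of_ne hne]
          exact hxy j' ((Finset.mem_insert.1 hj').resolve_left hne)
    choose Q hQ using hg
    refine ⟨∑ i ∈ Finset.range (K + 1), Q i * Polynomial.aeval (MvPolynomial.X j)
      (Lagrange.basis (Finset.range (K + 1)) (fun i : ℕ => (i : ℂ)) i), fun x => ?_⟩
    obtain ⟨p, hp, hpe⟩ := hf x j
    have h1 : p = Lagrange.interpolate (Finset.range (K + 1)) (fun i : ℕ => (i : ℂ))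
        fun i => p.eval (i : ℂ) := by
      refine Lagrange.eq_interpolate (fun a _ b _ hab => Nat.cast_injective hab) ?_
      rw [Finset.card_range]
      exact (Polynomial.degree_le_of_natDegree_le hp).trans_lt (by exact_mod_cast Nat.lt_succ_self K)
    have h2 := hpe (x j)
    rw [Function.update_eq_self] at h2
    rw [h2, h1, Lagrange.interpolate_apply, Polynomial.eval_finsetSum, map_sum]
    refine Finset.sum_congr rfl fun i _ => ?_
    rw [Polynomial.eval_mul, Polynomial.eval_C, map_mul, ← hQ, hpe]
    congr 1
    have h3 := Polynomial.hom_eval₂ (Lagrange.basis (Finset.range (K + 1))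
      (fun i : ℕ => (i : ℂ)) i) (algebraMap ℂ (MvPolynomial (Fin n) ℂ)) (MvPolynomial.eval x)
      (MvPolynomial.X j)
    rw [Polynomial.aeval_def, h3, MvPolynomial.eval_X]
    have h4 : (MvPolynomial.eval x).comp (algebraMap ℂ (MvPolynomial (Fin n) ℂ)) = RingHom.id ℂ := by
      ext; simp [MvPolynomial.algebraMap_eq]
    rw [h4, Polynomial.eval₂_id]

theorem exists_mvPolynomial {f : (Fin n → ℂ) → ℂ} {K : ℕ}
    (hf : ∀ x j, ∃ p : Polynomial ℂ, p.natDegree ≤ K ∧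
      ∀ t, f (Function.update x j t) = p.eval t) :
    ∃ Q : MvPolynomial (Fin n) ℂ, ∀ x, f x = MvPolynomial.eval x Q :=
  exists_mvPolynomial_of_finset K Finset.univ f hf fun x y hxy => by
    rw [funext fun j => hxy j (Finset.mem_univ j)]

/-! ### Polynomial growth in the spectral parameter -/

/-- Every point can be moved away from the hyperplanes by a vector of bounded length. -/
theorem exists_shift {𝒜 : Finset (Fin n → ℝ)} (h_ne : ∀ α ∈ 𝒜, α ≠ 0) :
    ∃ R : ℝ, ∀ u : Fin n → ℝ, ∃ η : Fin n → ℝ, ‖η‖ ≤ R ∧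
      ∀ α ∈ 𝒜, 1 ≤ ‖bilin (toComplex (η + u)) (toComplex α)‖ := by
  obtain ⟨x, hx⟩ := exists_generic h_ne
  set v : (Fin n → ℝ) → ℝ := fun α => ‖bilin (toComplex x) (toComplex α)‖
  have hv : ∀ α ∈ 𝒜, 0 < v α := fun α hα => norm_pos_iff.2 (hx α hα)
  set c := ∑ α ∈ 𝒜, (v α)⁻¹ with hc
  have hc0 : 0 ≤ c := Finset.sum_nonneg fun α hα => (inv_pos.2 (hv α hα)).le
  have hcv : ∀ α ∈ 𝒜, 1 ≤ c * v α := by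
    intro α hα
    rw [← inv_mul_cancel₀ (hv α hα).ne']
    refine mul_le_mul_of_nonneg_right ?_ (hv α hα).le
    exact Finset.single_le_sum (f := fun α => (v α)⁻¹)
      (fun β hβ => (inv_pos.2 (hv β hβ)).le) hα
  refine ⟨2 * 𝒜.card * (c * ‖x‖), fun u => ?_⟩
  by_contra hcon
  push Not at hcon
  -- Pigeonhole: of the points u + 2kcx with 0 ≤ k ≤ |𝒜|, each α can be within 1 of zero on at most
  -- one, since two of them differ by at least 2 in (·, α).
  have hk : ∀ k : ℕ, k < 𝒜.card + 1 → ∃ α ∈ 𝒜,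
      ‖bilin (toComplex ((2 * k * c : ℝ) • x + u)) (toComplex α)‖ < 1 := by
    intro k hk
    refine hcon _ ?_
    rw [norm_smul, Real.norm_of_nonneg (by positivity), mul_assoc]
    have : (k : ℝ) ≤ 𝒜.card := by exact_mod_cast Nat.lt_succ_iff.1 hk
    gcongr
  choose! a ha hlt using hk
  obtain ⟨k, hk, l, hl, hne, hkl⟩ := Finset.exists_ne_map_eq_of_card_lt_of_maps_to
    (s := Finset.range (𝒜.card + 1)) (t := 𝒜) (f := a) (by simp)
    (fun k hk => ha k (Finset.mem_range.1 hk))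
  have h1 := hlt k (Finset.mem_range.1 hk)
  have h2 := hlt l (Finset.mem_range.1 hl)
  rw [← hkl] at h2
  have h3 : bilin (toComplex ((2 * k * c : ℝ) • x + u)) (toComplex (a k))
      - bilin (toComplex ((2 * l * c : ℝ) • x + u)) (toComplex (a k))
      = ((2 * ((k : ℝ) - l) * c : ℝ) : ℂ) * bilin (toComplex x) (toComplex (a k)) := by
    simp only [toComplex_add, toComplex_smul, bilin_add_left, bilin_smul_left]
    push_cast; ring
  have h4 := norm_sub_le (bilin (toComplex ((2 * k * c : ℝ) • x + u)) (toComplex (a k)))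
    (bilin (toComplex ((2 * l * c : ℝ) • x + u)) (toComplex (a k)))
  rw [h3, norm_mul, Complex.norm_real, norm_mul, norm_mul, Real.norm_of_nonneg hc0,
    Real.norm_ofNat, Real.norm_eq_abs, mul_assoc] at h4
  have h5 : (1 : ℝ) ≤ |(k : ℝ) - l| := by
    have : (1 : ℤ) ≤ |(k : ℤ) - l| := Int.one_le_abs (by omega)
    exact_mod_cast this
  have h6 := hcv (a k) (ha k (Finset.mem_range.1 hk))
  change 2 * |(k : ℝ) - l| * (c * v (a k)) ≤ _ at h4
  nlinarith

theorem one_le_norm_Am {𝒜 : Finset (Fin n → ℝ)} (m : (Fin n → ℝ) → ℕ) {x : Fin n → ℂ}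
    (h : ∀ α ∈ 𝒜, 1 ≤ ‖bilin x (toComplex α)‖) : 1 ≤ ‖Am 𝒜 m x‖ := by
  rw [Am, norm_prod]
  calc (1 : ℝ) = ∏ _α ∈ 𝒜, 1 := by simp
    _ ≤ _ := Finset.prod_le_prod (fun _ _ => zero_le_one) fun α hα => by
      rw [norm_pow]; exact one_le_pow₀ (h α hα)

theorem norm_mul_exp_gaussDensity_le {f : ℂ} {T K R : ℝ} {η y : Fin n → ℝ} (hK : 0 ≤ K)
    (hη : ‖η‖ ≤ R) (hT : 0 ≤ T) (hf : ‖f‖ ≤ T * Real.exp (K * (1 + ‖contour η y‖))) :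
    ‖f * gaussDensity (contour η y)‖ ≤ T * (gaussConst n K R * weight K y) := by
  have h1 := norm_mul_gaussDensity_le
    (f := ((Real.exp (K * (1 + ‖contour η y‖)) : ℝ) : ℂ)) (y := y) hK hη (by
    rw [Complex.norm_real, Real.norm_of_nonneg (Real.exp_pos _).le])
  rw [norm_mul, Complex.norm_real, Real.norm_of_nonneg (Real.exp_pos _).le] at h1
  rw [norm_mul]
  calc _ ≤ T * Real.exp (K * (1 + ‖contour η y‖)) * ‖gaussDensity (contour η y)‖ := by gcongr
    _ = T * (Real.exp (K * (1 + ‖contour η y‖)) * ‖gaussDensity (contour η y)‖) := by ring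
    _ ≤ _ := by gcongr

section Model

variable {𝒜 : Finset (Fin n → ℝ)} {m : (Fin n → ℝ) → ℕ} {φ : (Fin n → ℂ) → (Fin n → ℂ) → ℂ}
  {F : MvPolynomial (Fin n) (MvPolynomial (Fin n) ℂ)}

/-- For each λ a displacement η of bounded length makes |A_m| ≥ 1 along the contour. What remains is
polynomial in λ and w against a Gaussian whose bound is uniform in η. -/
theorem IsModel.exists_norm_normInt_le (h : IsModel 𝒜 m φ F) {ξ : Fin n → ℝ}
    (hξ : ξ ∈ generic 𝒜) (mu : Fin n → ℂ) :
    ∃ C : ℝ, ∃ K : ℕ, 0 ≤ C ∧ ∀ lam, ‖normInt 𝒜 m φ ξ mu lam‖ ≤ C * (1 + ‖lam‖) ^ K := by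
  obtain ⟨R, hR⟩ := exists_shift h.ne_zero
  obtain ⟨C, N, hC, hb⟩ := exists_norm_eval_map_le F
  set E := (gaussConst n (2 * N) R) * ∫ y : Fin n → ℝ, weight (2 * N) y with hE
  refine ⟨C ^ 2 * (1 + ‖mu‖) ^ (3 * N) * E, 3 * N, ?_, fun lam => ?_⟩
  · have := (gaussConst_pos n (2 * N) R).le
    have : 0 ≤ ∫ y : Fin n → ℝ, weight (2 * N) y :=
      integral_nonneg fun y => (weight_pos _ y).le
    positivity
  obtain ⟨η, hη, hη1⟩ := hR (rePart (mu - lam))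
  have hgen : η + rePart (mu - lam) ∈ generic 𝒜 := fun α hα h0 => by
    have := hη1 α hα
    rw [h0, norm_zero] at this
    linarith
  rw [h.normInt_eq hξ hgen]
  set T := C ^ 2 * (1 + ‖mu‖) ^ (3 * N) * (1 + ‖lam‖) ^ (3 * N) with hT
  have hT0 : 0 ≤ T := by positivity
  have hpt : ∀ y, ‖shifted 𝒜 m F lam mu (contour η y)‖
      ≤ T * (gaussConst n (2 * N) R * weight (2 * N) y) := by
    intro y
    set w := contour η y
    have hA : 1 ≤ ‖Am 𝒜 m (w + Complex.I • (mu - lam))‖ := by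
      rw [contour_add_I_smul]
      exact (one_le_norm_Am m hη1).trans (norm_Am_le_contour _ _ _ _)
    refine norm_mul_exp_gaussDensity_le (by positivity) hη hT0 ?_
    rw [norm_div, norm_pow]
    refine (div_le_self (norm_nonneg _) (one_le_pow₀ hA)).trans ?_
    have hu : ‖mu - lam‖ ≤ ‖mu‖ + ‖lam‖ := norm_sub_le _ _
    have hw := norm_nonneg w
    have hm := norm_nonneg mu
    have hl := norm_nonneg lam
    have hX : ∀ x : Fin n → ℂ, ‖x‖ ≤ ‖w‖ + ‖mu - lam‖ →
        1 + ‖x‖ ≤ (1 + ‖w‖) * ((1 + ‖mu‖) * (1 + ‖lam‖)) := by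
      intro x hx
      nlinarith [mul_nonneg hw hm, mul_nonneg hw hl, mul_nonneg hm hl,
        mul_nonneg hw (mul_nonneg hm hl)]
    have h1 : 1 + ‖-Complex.I • w + (mu - lam)‖ ≤ (1 + ‖w‖) * ((1 + ‖mu‖) * (1 + ‖lam‖)) := by
      refine hX _ ((norm_add_le _ _).trans_eq ?_)
      rw [norm_smul, norm_neg, Complex.norm_I, one_mul]
    have h2 : 1 + ‖Complex.I • w - (mu - lam)‖ ≤ (1 + ‖w‖) * ((1 + ‖mu‖) * (1 + ‖lam‖)) := by
      refine hX _ ((norm_sub_le _ _).trans_eq ?_)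
      rw [norm_smul, Complex.norm_I, one_mul]
    have h3 : (1 + ‖w‖) ^ (2 * N) ≤ Real.exp (2 * N * (1 + ‖w‖)) := by
      refine (one_add_pow_le_exp hw (2 * N)).trans (Real.exp_le_exp.2 ?_)
      push_cast
      have : (0 : ℝ) ≤ 2 * N := by positivity
      nlinarith
    rw [norm_mul]
    calc _ ≤ (C * (((1 + ‖w‖) * ((1 + ‖mu‖) * (1 + ‖lam‖))) ^ N * (1 + ‖lam‖) ^ N))
          * (C * (((1 + ‖w‖) * ((1 + ‖mu‖) * (1 + ‖lam‖))) ^ N * (1 + ‖mu‖) ^ N)) := by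
          refine mul_le_mul ((hb _ _).trans ?_) ((hb _ _).trans ?_) (norm_nonneg _) (by positivity)
          · gcongr
          · gcongr
      _ = T * (1 + ‖w‖) ^ (2 * N) := by
          rw [hT, mul_comm 3 N, mul_comm 2 N, pow_mul, pow_mul, pow_mul, mul_pow, mul_pow]
          ring
      _ ≤ _ := by gcongr
  refine (norm_integral_le_of_norm_le (((integrable_weight _).const_mul _).const_mul _)
    (Filter.Eventually.of_forall hpt)).trans_eq ?_
  rw [integral_const_mul, integral_const_mul, hT, hE]
  ring

theorem IsModel.differentiable_normInt (h : IsModel 𝒜 m φ F) {ξ : Fin n → ℝ}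
    (hξ : ξ ∈ generic 𝒜) (lam v mu : Fin n → ℂ) :
    Differentiable ℂ fun c : ℂ => normInt 𝒜 m φ ξ mu (lam + c • v) := by
  have h1 := h.differentiable_contourInt hξ lam v mu
  unfold normInt
  refine Differentiable.fun_mul ?_ h1
  simp only [bilin_add_left, bilin_add_right, bilin_smul_left, bilin_smul_right]
  fun_prop

/-- The normalised integral is a polynomial in the spectral parameter. -/
theorem IsModel.exists_normInt_eq_eval (h : IsModel 𝒜 m φ F) {ξ : Fin n → ℝ}
    (hξ : ξ ∈ generic 𝒜) (mu : Fin n → ℂ) :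
    ∃ Q : MvPolynomial (Fin n) ℂ, ∀ lam, normInt 𝒜 m φ ξ mu lam = MvPolynomial.eval lam Q := by
  obtain ⟨C, K, hC, hb⟩ := h.exists_norm_normInt_le hξ mu
  refine exists_mvPolynomial (K := K) fun x j => ?_
  set x₀ := Function.update x j 0
  have hline : ∀ t : ℂ, Function.update x j t = x₀ + t • Pi.single j (1 : ℂ) := by
    intro t
    ext i
    rcases eq_or_ne i j with rfl | hne
    · simp [x₀]
    · simp [x₀, hne]
  obtain ⟨p, hp, hpe⟩ := exists_polynomial_of_growth
    (h.differentiable_normInt hξ x₀ (Pi.single j (1 : ℂ)) mu)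
    (C := C * (1 + ‖x₀‖ + ‖(Pi.single j (1 : ℂ) : Fin n → ℂ)‖) ^ K) (K := K) (fun t => by
      refine (hb _).trans ?_
      rw [mul_assoc, ← mul_pow]
      have h1 := norm_add_le x₀ (t • (Pi.single j (1 : ℂ) : Fin n → ℂ))
      rw [norm_smul] at h1
      have h2 := norm_nonneg x₀
      have h3 := norm_nonneg (Pi.single j (1 : ℂ) : Fin n → ℂ)
      have h4 := norm_nonneg t
      gcongr
      nlinarith [mul_nonneg h2 h4])
  exact ⟨p, hp, fun t => by rw [hline, ← hpe]⟩

end Model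

/-! ### The leading term -/

open Filter Topology in
theorem tendsto_ofReal_inv : Tendsto (fun s : ℝ => ((s⁻¹ : ℝ) : ℂ)) atTop (𝓝 0) := by
  have h := (Complex.continuous_ofReal.tendsto 0).comp tendsto_inv_atTop_zero
  rwa [Complex.ofReal_zero] at h

open Filter Topology in
theorem tendsto_polynomial_div_pow {p : Polynomial ℂ} {D : ℕ} (hp : p.natDegree ≤ D) :
    Tendsto (fun s : ℝ => p.eval (s : ℂ) / (s : ℂ) ^ D) atTop (𝓝 (p.coeff D)) := by
  have h1 : ∀ᶠ s : ℝ in atTop, ∑ i ∈ Finset.range (D + 1), p.coeff i * ((s⁻¹ : ℝ) : ℂ) ^ (D - i)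
      = p.eval (s : ℂ) / (s : ℂ) ^ D := by
    filter_upwards [eventually_gt_atTop 0] with s hs
    have hs' : (s : ℂ) ≠ 0 := by exact_mod_cast hs.ne'
    rw [Polynomial.eval_eq_sum_range' (Nat.lt_succ_of_le hp), Finset.sum_div]
    refine Finset.sum_congr rfl fun i hi => ?_
    rw [eq_div_iff (pow_ne_zero D hs'), mul_assoc, Complex.ofReal_inv, inv_pow]
    congr 1
    have hi' : i ≤ D := Nat.lt_succ_iff.1 (Finset.mem_range.1 hi)
    nth_rewrite 2 [← Nat.sub_add_cancel hi']
    rw [pow_add, inv_mul_cancel_left₀ (pow_ne_zero _ hs')]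
  refine Tendsto.congr' h1 ?_
  have h2 : ∀ i ∈ Finset.range (D + 1), Tendsto (fun s : ℝ => p.coeff i * ((s⁻¹ : ℝ) : ℂ) ^ (D - i))
      atTop (𝓝 (if i = D then p.coeff D else 0)) := by
    intro i hi
    have hi' : i ≤ D := Nat.lt_succ_iff.1 (Finset.mem_range.1 hi)
    have h4 := (tendsto_ofReal_inv.pow (D - i)).const_mul (p.coeff i)
    split_ifs with h
    · subst h; simp
    · rwa [zero_pow (by omega), mul_zero] at h4
  have h3 := tendsto_finsetSum _ h2
  rwa [Finset.sum_ite_eq', if_pos (Finset.self_mem_range_succ D)] at h3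

/-- `t ↦ Q(tx)`, in terms of the homogeneous components of `Q`. -/
noncomputable def ray (Q : MvPolynomial (Fin n) ℂ) (x : Fin n → ℂ) : Polynomial ℂ :=
  ∑ N ∈ Finset.range (Q.totalDegree + 1),
    Polynomial.monomial N (MvPolynomial.eval x (MvPolynomial.homogeneousComponent N Q))

theorem coeff_ray (Q : MvPolynomial (Fin n) ℂ) (x : Fin n → ℂ) (N : ℕ) :
    (ray Q x).coeff N = MvPolynomial.eval x (MvPolynomial.homogeneousComponent N Q) := by
  rw [ray, Polynomial.finsetSum_coeff]
  simp only [Polynomial.coeff_monomial]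
  rw [Finset.sum_ite_eq']
  split_ifs with h
  · rfl
  · rw [MvPolynomial.homogeneousComponent_eq_zero, map_zero]
    simp at h; omega

theorem eval_ray (Q : MvPolynomial (Fin n) ℂ) (x : Fin n → ℂ) (t : ℂ) :
    (ray Q x).eval t = MvPolynomial.eval (t • x) Q := by
  conv_rhs => rw [← MvPolynomial.sum_homogeneousComponent Q]
  rw [ray, map_sum, Polynomial.eval_finsetSum]
  refine Finset.sum_congr rfl fun N _ => ?_
  rw [Polynomial.eval_monomial,
    eval_smul_of_isHomogeneous (MvPolynomial.homogeneousComponent_isHomogeneous _ _), mul_comm]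

-- Growth of order s^M along generic real rays bounds the degree on each ray and identifies the
-- coefficient of s^M there. A polynomial vanishing at all generic real points is zero, since its
-- product with ∏(x, α) vanishes at all real points.
open Filter Topology in
theorem homogeneousComponent_of_tendsto {𝒜 : Finset (Fin n → ℝ)} (h_ne : ∀ α ∈ 𝒜, α ≠ 0)
    {Q T : MvPolynomial (Fin n) ℂ} {M : ℕ}
    (h : ∀ l ∈ generic 𝒜, Tendsto (fun s : ℝ => MvPolynomial.eval ((s : ℂ) • toComplex l) Q
      / (s : ℂ) ^ M) atTop (𝓝 (MvPolynomial.eval (toComplex l) T))) :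
    Q.totalDegree ≤ M ∧ MvPolynomial.homogeneousComponent M Q = T := by
  have key : ∀ S : MvPolynomial (Fin n) ℂ,
      (∀ l ∈ generic 𝒜, MvPolynomial.eval (toComplex l) S = 0) → S = 0 := by
    intro S hS
    have h1 : S * AmPoly 𝒜 (fun _ => 1) = 0 := by
      refine mvPolynomial_eq_zero_of_real fun x => ?_
      rw [map_mul, eval_AmPoly]
      by_cases hx : x ∈ generic 𝒜
      · rw [hS x hx, zero_mul]
      · obtain ⟨α, hα, h0⟩ : ∃ α ∈ 𝒜, bilin (toComplex x) (toComplex α) = 0 := by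
          simpa [generic] using hx
        rw [Am, Finset.prod_eq_zero hα (by rw [h0, pow_one]), mul_zero]
    exact (mul_eq_zero.1 h1).resolve_right (AmPoly_ne_zero h_ne _)
  have hdeg : ∀ l ∈ generic 𝒜, (ray Q (toComplex l)).natDegree ≤ M := by
    intro l hl
    by_contra hlt
    push Not at hlt
    set p := ray Q (toComplex l)
    set D := p.natDegree with hD
    have h1 : Tendsto (fun s : ℝ => p.eval (s : ℂ) / (s : ℂ) ^ D) atTop (𝓝 0) := by
      have h3 := (h l hl).mul (tendsto_ofReal_inv.pow (D - M))
      rw [zero_pow (by omega), mul_zero] at h3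
      refine h3.congr' ?_
      filter_upwards [eventually_gt_atTop 0] with s hs
      have hs' : (s : ℂ) ≠ 0 := by exact_mod_cast hs.ne'
      rw [eval_ray, Complex.ofReal_inv, inv_pow, ← div_eq_mul_inv, div_div, ← pow_add,
        Nat.add_sub_cancel' hlt.le]
    have h2 := tendsto_nhds_unique (tendsto_polynomial_div_pow le_rfl) h1
    have h3 : p = 0 := Polynomial.leadingCoeff_eq_zero.1 h2
    rw [hD, h3] at hlt
    simp at hlt
  constructor
  · by_contra hlt
    push Not at hlt
    have hQ : Q ≠ 0 := by rintro rfl; simp at hlt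
    refine homogeneousComponent_totalDegree_ne_zero hQ (key _ fun l hl => ?_)
    rw [← coeff_ray]
    exact Polynomial.coeff_eq_zero_of_natDegree_lt ((hdeg l hl).trans_lt hlt)
  · refine sub_eq_zero.1 (key _ fun l hl => ?_)
    have h1 := tendsto_polynomial_div_pow (hdeg l hl)
    simp only [eval_ray] at h1
    rw [map_sub, ← coeff_ray, tendsto_nhds_unique h1 (h l hl), sub_self]

open Filter Topology in
/-- A polynomial along a sequence going to infinity in a fixed direction. -/
theorem tendsto_eval_smul_div_pow {Q : MvPolynomial (Fin n) ℂ} {M : ℕ} (hQ : Q.totalDegree ≤ M)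
    {r : ℝ → ℝ} (hr : Tendsto r atTop atTop) {z : ℝ → Fin n → ℂ} {x : Fin n → ℂ}
    (hz : Tendsto z atTop (𝓝 x)) :
    Tendsto (fun s : ℝ => MvPolynomial.eval ((r s : ℂ) • z s) Q / (r s : ℂ) ^ M) atTop
      (𝓝 (MvPolynomial.eval x (MvPolynomial.homogeneousComponent M Q))) := by
  have h1 : ∀ᶠ s : ℝ in atTop, ∑ N ∈ Finset.range (M + 1), (((r s)⁻¹ : ℝ) : ℂ) ^ (M - N)
      * MvPolynomial.eval (z s) (MvPolynomial.homogeneousComponent N Q)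
      = MvPolynomial.eval ((r s : ℂ) • z s) Q / (r s : ℂ) ^ M := by
    filter_upwards [hr.eventually_gt_atTop 0] with s hs
    have hs' : (r s : ℂ) ≠ 0 := by exact_mod_cast hs.ne'
    have h2 : (ray Q (z s)).natDegree ≤ M := by
      refine Polynomial.natDegree_le_iff_coeff_eq_zero.2 fun N hN => ?_
      rw [coeff_ray, MvPolynomial.homogeneousComponent_eq_zero _ _ (by omega), map_zero]
    rw [← eval_ray, Polynomial.eval_eq_sum_range' (Nat.lt_succ_of_le h2), Finset.sum_div]
    refine Finset.sum_congr rfl fun i hi => ?_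
    have hi' : i ≤ M := Nat.lt_succ_iff.1 (Finset.mem_range.1 hi)
    rw [eq_div_iff (pow_ne_zero M hs'), coeff_ray, Complex.ofReal_inv, inv_pow]
    nth_rewrite 2 [← Nat.sub_add_cancel hi']
    rw [pow_add]
    field_simp
  refine Tendsto.congr' h1 ?_
  have h2 : ∀ i ∈ Finset.range (M + 1), Tendsto (fun s : ℝ => (((r s)⁻¹ : ℝ) : ℂ) ^ (M - i)
      * MvPolynomial.eval (z s) (MvPolynomial.homogeneousComponent i Q))
      atTop (𝓝 (if i = M then
        MvPolynomial.eval x (MvPolynomial.homogeneousComponent M Q) else 0)) := by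
    intro i hi
    have hi' : i ≤ M := Nat.lt_succ_iff.1 (Finset.mem_range.1 hi)
    have h4 := ((tendsto_ofReal_inv.comp hr).pow (M - i)).mul (((MvPolynomial.continuous_eval
      (MvPolynomial.homogeneousComponent i Q)).tendsto x).comp hz)
    split_ifs with h
    · subst h
      simpa [Function.comp_def] using h4
    · rwa [zero_pow (by omega), zero_mul] at h4
  have h3 := tendsto_finsetSum _ h2
  rwa [Finset.sum_ite_eq', if_pos (Finset.self_mem_range_succ M)] at h3

theorem norm_eval_smul_div_le {Q : MvPolynomial (Fin n) ℂ} {M : ℕ} {C : ℝ}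
    (hC : ∀ x, ‖MvPolynomial.eval x Q‖ ≤ C * (1 + ‖x‖) ^ M) (hC0 : 0 ≤ C) {r : ℝ} (hr : 1 ≤ r)
    (x : Fin n → ℂ) :
    ‖MvPolynomial.eval ((r : ℂ) • x) Q / (r : ℂ) ^ M‖ ≤ C * (1 + ‖x‖) ^ M := by
  have hr0 : 0 < r := by linarith
  rw [norm_div, norm_pow, Complex.norm_real, Real.norm_of_nonneg hr0.le,
    div_le_iff₀ (pow_pos hr0 M), mul_assoc, ← mul_pow]
  refine (hC _).trans ?_
  rw [norm_smul, Complex.norm_real, Real.norm_of_nonneg hr0.le]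
  have := norm_nonneg x
  gcongr
  nlinarith

theorem integral_gaussDensity : ∫ y : Fin n → ℝ, gaussDensity (contour 0 y) = 1 := by
  have h1 : ∀ y : Fin n → ℝ, gaussDensity (contour 0 y)
      = (((2 * Real.pi) ^ (-(n : ℝ) / 2) : ℝ) : ℂ) * Complex.exp (-(1 / 2 : ℂ) * ∑ i, (y i : ℂ) ^ 2
        + ∑ i, (0 : Fin n → ℂ) i * (y i : ℂ)) := by
    intro y
    have : contour 0 y = toComplex y := by
      ext j; simp [contour, toComplex]
    rw [gaussDensity, this]
    congr 2
    simp [bilin, toComplex, sq]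
    ring
  simp only [h1]
  rw [integral_const_mul, GaussianFourier.integral_cexp_neg_mul_sum_add (by norm_num)]
  have h2 : (Real.pi : ℂ) / (1 / 2) = ((2 * Real.pi : ℝ) : ℂ) := by push_cast; ring
  have h3 : ((Fintype.card (Fin n) : ℂ) / 2) = (((n : ℝ) / 2 : ℝ) : ℂ) := by simp
  rw [h2, h3, ← Complex.ofReal_cpow (by positivity)]
  simp only [Pi.zero_apply]
  rw [neg_div, Real.rpow_neg (by positivity), Complex.ofReal_inv]
  have h4 : (((2 * Real.pi) ^ ((n : ℝ) / 2) : ℝ) : ℂ) ≠ 0 := by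
    exact_mod_cast (Real.rpow_pos_of_pos (by positivity) _).ne'
  simp [h4]

section Model

variable {𝒜 : Finset (Fin n → ℝ)} {m : (Fin n → ℝ) → ℕ} {φ : (Fin n → ℂ) → (Fin n → ℂ) → ℂ}
  {F : MvPolynomial (Fin n) (MvPolynomial (Fin n) ℂ)}

/-- Homogeneity replaces P(x, sλ) by P(sx, λ), so the first factor grows like s^{2|m|}, the second
like s^{|m|}, and A_m² like s^{2|m|}. Division by s^{|m|} leaves a bounded quotient. -/
theorem IsModel.shifted_smul_div (h : IsModel 𝒜 m φ F) {lam : Fin n → ℂ}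
    (hl : ∀ α ∈ 𝒜, bilin lam (toComplex α) ≠ 0) {s : ℝ} (hs : s ≠ 0) (mu w : Fin n → ℂ) :
    shifted 𝒜 m F ((s : ℂ) • lam) mu w / (s : ℂ) ^ totalMult 𝒜 m
      = MvPolynomial.eval (((s ^ 2 : ℝ) : ℂ) • (((s⁻¹ : ℝ) : ℂ) • (-Complex.I • w + mu) - lam))
          (MvPolynomial.map (MvPolynomial.eval lam) F) / ((s ^ 2 : ℝ) : ℂ) ^ totalMult 𝒜 m
        * (MvPolynomial.eval ((s : ℂ) • (((s⁻¹ : ℝ) : ℂ) • (Complex.I • w - mu) + lam))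
          (MvPolynomial.map (MvPolynomial.eval mu) F) / (s : ℂ) ^ totalMult 𝒜 m)
        / Am 𝒜 m (((s⁻¹ : ℝ) : ℂ) • (w + Complex.I • mu) - Complex.I • lam) ^ 2
        * gaussDensity w := by
  have hs' : (s : ℂ) ≠ 0 := by exact_mod_cast hs
  have e0 : (s : ℂ) * ((s⁻¹ : ℝ) : ℂ) = 1 := by
    rw [Complex.ofReal_inv, mul_inv_cancel₀ hs']
  have e1 : (s : ℂ) • (-Complex.I • w + (mu - (s : ℂ) • lam))
      = ((s ^ 2 : ℝ) : ℂ) • (((s⁻¹ : ℝ) : ℂ) • (-Complex.I • w + mu) - lam) := by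
    rw [smul_sub, smul_smul, Complex.ofReal_pow, sq, mul_assoc, e0, mul_one, ← add_sub_assoc,
      smul_sub, smul_smul]
  have e2 : Complex.I • w - (mu - (s : ℂ) • lam)
      = (s : ℂ) • (((s⁻¹ : ℝ) : ℂ) • (Complex.I • w - mu) + lam) := by
    rw [smul_add, smul_smul, e0, one_smul]; abel
  have e3 : w + Complex.I • (mu - (s : ℂ) • lam)
      = (s : ℂ) • (((s⁻¹ : ℝ) : ℂ) • (w + Complex.I • mu) - Complex.I • lam) := by
    rw [smul_sub (s : ℂ), smul_smul, e0, one_smul, smul_sub, smul_smul, smul_smul,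
      mul_comm Complex.I, add_sub_assoc]
  rw [shifted, (h.factor lam).eval_smul h.ne_zero h.linearIndependent hl hs
    (h.factor ((s : ℂ) • lam)), e1, e2, e3, Am_smul, Complex.ofReal_pow]
  have hsM := pow_ne_zero (totalMult 𝒜 m) hs'
  rw [mul_pow, ← pow_mul, ← pow_mul, mul_comm 2]
  rw [pow_mul]
  set S := (s : ℂ) ^ totalMult 𝒜 m
  rw [div_mul_div_comm, div_div, div_mul_eq_mul_div, div_mul_eq_mul_div, div_div]
  congr 1
  ring

/-- The integrand in rescaled variables. -/
noncomputable def rescaled (𝒜 : Finset (Fin n → ℝ)) (m : (Fin n → ℝ) → ℕ)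
    (P Q : MvPolynomial (Fin n) ℂ) (M : ℕ) (lam mu : Fin n → ℂ) (s : ℝ) (w : Fin n → ℂ) : ℂ :=
  MvPolynomial.eval (((s ^ 2 : ℝ) : ℂ) • (((s⁻¹ : ℝ) : ℂ) • (-Complex.I • w + mu) - lam)) P
      / ((s ^ 2 : ℝ) : ℂ) ^ M
    * (MvPolynomial.eval ((s : ℂ) • (((s⁻¹ : ℝ) : ℂ) • (Complex.I • w - mu) + lam)) Q
      / (s : ℂ) ^ M)
    / Am 𝒜 m (((s⁻¹ : ℝ) : ℂ) • (w + Complex.I • mu) - Complex.I • lam) ^ 2 * gaussDensity w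

theorem measurable_rescaled (𝒜 : Finset (Fin n → ℝ)) (m : (Fin n → ℝ) → ℕ)
    (P Q : MvPolynomial (Fin n) ℂ) (M : ℕ) (lam mu : Fin n → ℂ) (s : ℝ) :
    Measurable fun y => rescaled 𝒜 m P Q M lam mu s (contour 0 y) := by
  have hc := continuous_contour (0 : Fin n → ℝ)
  have h1 : Continuous fun y => ((s ^ 2 : ℝ) : ℂ) •
      (((s⁻¹ : ℝ) : ℂ) • (-Complex.I • contour 0 y + mu) - lam) := by fun_prop
  have h2 : Continuous fun y => (s : ℂ) •
      (((s⁻¹ : ℝ) : ℂ) • (Complex.I • contour 0 y - mu) + lam) := by fun_prop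
  have h3 : Continuous fun y =>
      ((s⁻¹ : ℝ) : ℂ) • (contour 0 y + Complex.I • mu) - Complex.I • lam := by fun_prop
  have h4 := (((MvPolynomial.continuous_eval P).comp h1).div_const
    (((s ^ 2 : ℝ) : ℂ) ^ M)).mul (((MvPolynomial.continuous_eval Q).comp h2).div_const
    ((s : ℂ) ^ M))
  have h5 := ((continuous_Am 𝒜 m).comp h3).pow 2
  exact (h4.measurable.div h5.measurable).mul
    (differentiable_gaussDensity.continuous.comp hc).measurable

theorem norm_rescaled_le {P Q : MvPolynomial (Fin n) ℂ} {M : ℕ} {C₁ C₂ δ s : ℝ}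
    (hb₁ : ∀ x, ‖MvPolynomial.eval x P‖ ≤ C₁ * (1 + ‖x‖) ^ M) (hC₁ : 0 ≤ C₁)
    (hb₂ : ∀ x, ‖MvPolynomial.eval x Q‖ ≤ C₂ * (1 + ‖x‖) ^ M) (hC₂ : 0 ≤ C₂)
    (hδ0 : 0 < δ) (hs1 : 1 ≤ s) (lam mu : Fin n → ℂ) (y : Fin n → ℝ)
    (hA : δ ≤ ‖Am 𝒜 m (((s⁻¹ : ℝ) : ℂ) • (contour 0 y + Complex.I • mu) - Complex.I • lam)‖) :
    ‖rescaled 𝒜 m P Q M lam mu s (contour 0 y)‖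
      ≤ C₁ * C₂ * (1 + (‖mu‖ + ‖lam‖)) ^ (2 * M) / δ ^ 2
        * (gaussConst n (2 * M) 0 * weight (2 * M) y) := by
  set b := ‖mu‖ + ‖lam‖ with hb
  have hb0 : 0 ≤ b := by positivity
  have hT0 : 0 ≤ C₁ * C₂ * (1 + b) ^ (2 * M) / δ ^ 2 := by positivity
  set w := contour 0 y
  refine norm_mul_exp_gaussDensity_le (by positivity) (by simp) hT0 ?_
  set z₁ := ((s⁻¹ : ℝ) : ℂ) • (-Complex.I • w + mu) - lam
  set z₂ := ((s⁻¹ : ℝ) : ℂ) • (Complex.I • w - mu) + lam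
  have hw0 := norm_nonneg w
  have hsi : ‖((s⁻¹ : ℝ) : ℂ)‖ ≤ 1 := by
    rw [Complex.norm_real, Real.norm_of_nonneg (by positivity)]
    exact inv_le_one_of_one_le₀ hs1
  have hz : ∀ x : Fin n → ℂ, ‖x‖ ≤ ‖w‖ + ‖mu‖ →
      1 + (‖((s⁻¹ : ℝ) : ℂ) • x‖ + ‖lam‖) ≤ (1 + b) * (1 + ‖w‖) := by
    intro x hx
    have h1 : ‖((s⁻¹ : ℝ) : ℂ) • x‖ ≤ ‖w‖ + ‖mu‖ := by
      rw [norm_smul]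
      exact (mul_le_of_le_one_left (norm_nonneg x) hsi).trans hx
    nlinarith [mul_nonneg hb0 hw0]
  have hn₁ : 1 + ‖z₁‖ ≤ (1 + b) * (1 + ‖w‖) := by
    refine le_trans (add_le_add le_rfl (norm_sub_le _ _)) (hz _ ?_)
    refine (norm_add_le _ _).trans_eq ?_
    rw [norm_smul, norm_neg, Complex.norm_I, one_mul]
  have hn₂ : 1 + ‖z₂‖ ≤ (1 + b) * (1 + ‖w‖) := by
    refine le_trans (add_le_add le_rfl (norm_add_le _ _)) (hz _ ?_)
    refine (norm_sub_le _ _).trans_eq ?_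
    rw [norm_smul, Complex.norm_I, one_mul]
  have h1 := norm_eval_smul_div_le hb₁ hC₁ (one_le_pow₀ hs1 (n := 2)) z₁
  have h2 := norm_eval_smul_div_le hb₂ hC₂ hs1 z₂
  have h3 : (1 + ‖w‖) ^ (2 * M) ≤ Real.exp (2 * M * (1 + ‖w‖)) := by
    refine (one_add_pow_le_exp hw0 (2 * M)).trans (Real.exp_le_exp.2 ?_)
    push_cast
    have : (0 : ℝ) ≤ 2 * M := by positivity
    nlinarith
  rw [norm_div, norm_mul, norm_pow, div_mul_eq_mul_div]
  refine div_le_div₀ (by positivity) ?_ (by positivity) (by gcongr)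
  calc _ ≤ (C₁ * ((1 + b) * (1 + ‖w‖)) ^ M) * (C₂ * ((1 + b) * (1 + ‖w‖)) ^ M) := by
        refine mul_le_mul (h1.trans ?_) (h2.trans ?_) (norm_nonneg _) (by positivity)
        · gcongr
        · gcongr
    _ = C₁ * C₂ * (1 + b) ^ (2 * M) * (1 + ‖w‖) ^ (2 * M) := by
        rw [mul_pow, two_mul, pow_add, pow_add]; ring
    _ ≤ _ := by gcongr

-- Only top components survive, giving A_m(λ)A_m(-λ) · A_m(μ)A_m(λ) / A_m(-iλ)². The signs
-- (-1)^{|m|} cancel.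
open Filter Topology in
theorem tendsto_rescaled {P Q : MvPolynomial (Fin n) ℂ} {lam mu : Fin n → ℂ}
    (hP : IsFactor 𝒜 m lam P) (hQ : IsFactor 𝒜 m mu Q) (hA0 : Am 𝒜 m lam ≠ 0)
    (w : Fin n → ℂ) :
    Tendsto (fun s => rescaled 𝒜 m P Q (totalMult 𝒜 m) lam mu s w) atTop
      (𝓝 (Am 𝒜 m mu * Am 𝒜 m lam * gaussDensity w)) := by
  refine Tendsto.mul_const _ ?_
  set M := totalMult 𝒜 m with hM
  have hz : ∀ x v : Fin n → ℂ,
      Tendsto (fun s : ℝ => ((s⁻¹ : ℝ) : ℂ) • x + v) atTop (𝓝 v) := by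
    intro x v
    simpa using (tendsto_ofReal_inv.smul_const x).add_const v
  have l1 : Tendsto (fun s => ((s⁻¹ : ℝ) : ℂ) • (-Complex.I • w + mu) - lam) atTop (𝓝 (-lam)) := by
    simpa only [sub_eq_add_neg] using hz (-Complex.I • w + mu) (-lam)
  have l2 : Tendsto (fun s => ((s⁻¹ : ℝ) : ℂ) • (Complex.I • w - mu) + lam) atTop (𝓝 lam) := hz _ _
  have l3 : Tendsto (fun s => ((s⁻¹ : ℝ) : ℂ) • (w + Complex.I • mu) - Complex.I • lam) atTop
      (𝓝 (-(Complex.I • lam))) := by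
    simpa only [sub_eq_add_neg] using hz (w + Complex.I • mu) (-(Complex.I • lam))
  have t1 := tendsto_eval_smul_div_pow hP.totalDegree_le
    (r := fun s => s ^ 2) (tendsto_pow_atTop two_ne_zero) l1
  have t2 := tendsto_eval_smul_div_pow hQ.totalDegree_le (r := fun s => s)
    tendsto_id l2
  have t3 := (((continuous_Am 𝒜 m).tendsto _).comp l3).pow 2
  have e1 : -lam = (-1 : ℂ) • lam := by rw [neg_smul, one_smul]
  have e3 : -(Complex.I • lam) = (-Complex.I) • lam := by rw [neg_smul]
  have hsq : ((-Complex.I) ^ M) ^ 2 = (-1 : ℂ) ^ M := by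
    rw [← pow_mul, mul_comm, pow_mul, neg_sq, Complex.I_sq]
  have hAne : Am 𝒜 m (-(Complex.I • lam)) ^ 2 ≠ 0 := by
    rw [e3, Am_smul, mul_pow, hsq]
    exact mul_ne_zero (pow_ne_zero _ (by norm_num)) (pow_ne_zero 2 hA0)
  have t4 := (t1.mul t2).div t3 hAne
  have hval : MvPolynomial.eval (-lam) (MvPolynomial.homogeneousComponent M P)
      * MvPolynomial.eval lam (MvPolynomial.homogeneousComponent M Q)
      / Am 𝒜 m (-(Complex.I • lam)) ^ 2 = Am 𝒜 m mu * Am 𝒜 m lam := by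
    rw [hP.top, hQ.top, map_mul, map_mul, MvPolynomial.eval_C,
      MvPolynomial.eval_C, eval_AmPoly, eval_AmPoly, e1, e3, Am_smul, Am_smul, mul_pow, hsq, ← hM]
    have : (-1 : ℂ) ^ M ≠ 0 := pow_ne_zero _ (by norm_num)
    field_simp
  rw [← hval]
  exact t4

open Filter Topology in
/-- The leading term of the normalised integral. -/
theorem IsModel.tendsto_normInt (h : IsModel 𝒜 m φ F) {ξ : Fin n → ℝ} (hξ : ξ ∈ generic 𝒜)
    (mu : Fin n → ℂ) {l : Fin n → ℝ} (hl : l ∈ generic 𝒜) :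
    Tendsto (fun s : ℝ => normInt 𝒜 m φ ξ mu ((s : ℂ) • toComplex l)
      / (s : ℂ) ^ totalMult 𝒜 m) atTop (𝓝 (Am 𝒜 m mu * Am 𝒜 m (toComplex l))) := by
  set M := totalMult 𝒜 m with hM
  set lam := toComplex l with hlam
  set Pl := MvPolynomial.map (MvPolynomial.eval lam) F with hPl
  set Pm := MvPolynomial.map (MvPolynomial.eval mu) F with hPm
  -- The real part of μ - sl is s·a(s), and a(s) tends to the generic point -l. Hence for large s
  -- the displacement η = 0 is allowed, and the rescaled denominator stays bounded below.
  let a : ℝ → Fin n → ℝ := fun s => s⁻¹ • rePart mu - l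
  have ha : Tendsto a atTop (𝓝 (-l)) := by
    have := (tendsto_inv_atTop_zero (𝕜 := ℝ)).smul_const (rePart mu)
    simpa using this.sub_const l
  have hl' : -l ∈ generic 𝒜 := by
    intro α hα h0
    refine hl α hα ?_
    have e : toComplex (-l) = (-1 : ℂ) • toComplex l := by ext j; simp [toComplex]
    rw [e, bilin_smul_left] at h0
    simpa using h0
  have hz₃ : ∀ (s : ℝ) (y : Fin n → ℝ),
      ((s⁻¹ : ℝ) : ℂ) • (contour 0 y + Complex.I • mu) - Complex.I • lam
        = contour (a s) (s⁻¹ • (y - fun j => (mu j).im)) := by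
    intro s y
    ext j
    simp only [a, contour, toComplex, rePart, hlam, Pi.add_apply, Pi.smul_apply, Pi.sub_apply,
      smul_eq_mul, Complex.ofReal_sub, Complex.ofReal_mul, Pi.zero_apply, Complex.ofReal_zero]
    conv_lhs => rw [← Complex.re_add_im (mu j)]
    linear_combination ((s⁻¹ : ℝ) : ℂ) * (mu j).im * Complex.I_sq
  set δ := ‖Am 𝒜 m (toComplex (-l))‖ / 2 with hδ
  have hApos : 0 < ‖Am 𝒜 m (toComplex (-l))‖ := norm_pos_iff.2 (Am_ne_zero m hl')
  have hδ0 : 0 < δ := half_pos hApos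
  have hAcont : Continuous fun η : Fin n → ℝ => ‖Am 𝒜 m (toComplex η)‖ :=
    ((continuous_Am 𝒜 m).comp continuous_toComplex).norm
  have hden : ∀ᶠ s in atTop, δ ≤ ‖Am 𝒜 m (toComplex (a s))‖ :=
    ((hAcont.tendsto (-l)).comp ha).eventually_const_le (half_lt_self hApos)
  have hgen : ∀ᶠ s in atTop, a s ∈ generic 𝒜 :=
    ha.eventually_mem ((isOpen_generic 𝒜).mem_nhds hl')
  have hInt : ∀ᶠ s : ℝ in atTop, ∫ y, rescaled 𝒜 m Pl Pm M lam mu s (contour 0 y)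
      = normInt 𝒜 m φ ξ mu ((s : ℂ) • lam) / (s : ℂ) ^ M := by
    filter_upwards [hgen, eventually_gt_atTop 0] with s hs hs0
    have hg : (0 : Fin n → ℝ) + rePart (mu - (s : ℂ) • lam) ∈ generic 𝒜 := by
      have e : (0 : Fin n → ℝ) + rePart (mu - (s : ℂ) • lam) = s • a s := by
        ext j
        simp only [rePart, a, hlam, toComplex, Pi.add_apply, Pi.zero_apply, Pi.sub_apply,
          Pi.smul_apply, smul_eq_mul, Complex.sub_re, zero_add, mul_sub]
        rw [mul_inv_cancel_left₀ hs0.ne', Complex.re_ofReal_mul, Complex.ofReal_re]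
      rw [e]
      intro α hα
      rw [toComplex_smul, bilin_smul_left]
      exact mul_ne_zero (by exact_mod_cast hs0.ne') (hs α hα)
    rw [h.normInt_eq hξ hg, ← integral_div]
    congr 1
    ext y
    exact (h.shifted_smul_div hl hs0.ne' mu _).symm
  have hlim : Am 𝒜 m mu * Am 𝒜 m lam
      = ∫ y : Fin n → ℝ, Am 𝒜 m mu * Am 𝒜 m lam * gaussDensity (contour 0 y) := by
    rw [integral_const_mul, integral_gaussDensity, mul_one]
  rw [hlim]
  refine Tendsto.congr' hInt ?_
  obtain ⟨C₁, hC₁, hb₁⟩ := exists_norm_eval_le Pl (h.factor lam).totalDegree_le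
  obtain ⟨C₂, hC₂, hb₂⟩ := exists_norm_eval_le Pm (h.factor mu).totalDegree_le
  refine tendsto_integral_filter_of_dominated_convergence
    (fun y => C₁ * C₂ * (1 + (‖mu‖ + ‖lam‖)) ^ (2 * M) / δ ^ 2
      * (gaussConst n (2 * M) 0 * weight (2 * M) y)) ?_ ?_
    (((integrable_weight _).const_mul _).const_mul _) ?_
  · exact Eventually.of_forall fun s => (measurable_rescaled ..).aestronglyMeasurable
  · filter_upwards [hden, eventually_ge_atTop 1] with s hs hs1
    refine Eventually.of_forall fun y => norm_rescaled_le hb₁ hC₁ hb₂ hC₂ hδ0 hs1 lam mu y ?_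
    rw [hz₃]
    exact hs.trans (norm_Am_le_contour _ _ _ _)
  · exact Eventually.of_forall fun y =>
      tendsto_rescaled (h.factor lam) (h.factor mu) (Am_ne_zero m hl) _

end Model

/-! ### Quasi-invariance of the normalised integral -/

section Model

variable {𝒜 : Finset (Fin n → ℝ)} {m : (Fin n → ℝ) → ℕ} {φ : (Fin n → ℂ) → (Fin n → ℂ) → ℂ}
  {F : MvPolynomial (Fin n) (MvPolynomial (Fin n) ℂ)}

/-- Quasi-invariance of φ(-ix, ·) in the spectral variable enters here: its odd part in c has a zero
of order 2m_α, with constants growing only exponentially in x. -/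
theorem IsModel.exists_norm_sub_le (h : IsModel 𝒜 m φ F) {α : Fin n → ℝ} (hα : α ∈ 𝒜)
    {lam : Fin n → ℂ} (hlam : bilin lam (toComplex α) = 0) (mu : Fin n → ℂ) :
    ∃ K : ℝ, 0 ≤ K ∧ ∀ x (c : ℂ), ‖c‖ < 1 →
      ‖pairing φ (lam + c • toComplex α) mu x - pairing φ (lam + -c • toComplex α) mu x‖
        ≤ 2 * ‖c‖ ^ (2 * m α) * Real.exp (K * (1 + ‖x‖)) := by
  set R := max (‖lam‖ + ‖toComplex α‖) ‖mu‖ with hR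
  obtain ⟨K, hK, hb⟩ := exists_norm_le_exp h.eq R
  refine ⟨2 * K, by positivity, fun x c hc => ?_⟩
  set f : ℂ → ℂ := fun c => φ (-Complex.I • x) (lam + c • toComplex α) with hf
  have hfd : Differentiable ℂ f := (h.differentiable_right _).comp (by fun_prop)
  have hgd : Differentiable ℂ fun z => f z - f (-z) := hfd.fun_sub (hfd.comp differentiable_neg)
  have h1 : ∀ z ∈ Metric.ball (0 : ℂ) 1, ‖f z‖ ≤ Real.exp (K * (1 + ‖x‖)) := by
    intro z hz
    have h2 := hb (-Complex.I • x) (lam + z • toComplex α) (by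
      refine le_max_of_le_left ((norm_add_le _ _).trans ?_)
      rw [norm_smul]
      have := (mem_ball_zero_iff.1 hz).le
      have := mul_le_of_le_one_left (norm_nonneg (toComplex α)) this
      gcongr)
    rwa [norm_smul, norm_neg, Complex.norm_I, one_mul] at h2
  have h2 : ∀ z ∈ Metric.ball (0 : ℂ) 1, ‖f z - f (-z)‖ ≤ 2 * Real.exp (K * (1 + ‖x‖)) := by
    intro z hz
    have hz' : -z ∈ Metric.ball (0 : ℂ) 1 := by simpa using hz
    rw [two_mul]
    exact (norm_sub_le _ _).trans (add_le_add (h1 z hz) (h1 _ hz'))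
  have h3 := norm_le_mul_pow_of_iteratedDeriv_eq_zero hgd h2 (fun i hi =>
    iteratedDeriv_sub_comp_neg_eq_zero hfd (h.oddVanish_right hα (-Complex.I • x) hlam) hi) hc
  rw [div_one] at h3
  have h4 := hb (Complex.I • x) mu (le_max_right _ _)
  rw [norm_smul, Complex.norm_I, one_mul] at h4
  rw [pairing, pairing, ← sub_mul, norm_mul, mul_assoc 2 K, two_mul (K * _), Real.exp_add]
  calc _ ≤ 2 * Real.exp (K * (1 + ‖x‖)) * ‖c‖ ^ (2 * m α) * Real.exp (K * (1 + ‖x‖)) :=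
        mul_le_mul h3 h4 (norm_nonneg _) (by positivity)
    _ = _ := by ring

theorem IsModel.exists_norm_contourInt_sub_le (h : IsModel 𝒜 m φ F) {ξ : Fin n → ℝ}
    (hξ : ξ ∈ generic 𝒜) {α : Fin n → ℝ} (hα : α ∈ 𝒜)
    {lam : Fin n → ℂ} (hlam : bilin lam (toComplex α) = 0) (mu : Fin n → ℂ) :
    ∃ C : ℝ, ∀ c : ℂ, ‖c‖ < 1 →
      ‖contourInt 𝒜 m φ ξ (lam + c • toComplex α) mu
        - contourInt 𝒜 m φ ξ (lam + -c • toComplex α) mu‖ ≤ C * ‖c‖ ^ (2 * m α) := by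
  obtain ⟨K, hK, hb⟩ := h.exists_norm_sub_le hα hlam mu
  have hA : 0 < ‖Am 𝒜 m (toComplex ξ)‖ := norm_pos_iff.2 (Am_ne_zero m hξ)
  set δ := ‖Am 𝒜 m (toComplex ξ)‖
  refine ⟨∫ y : Fin n → ℝ, 2 / δ ^ 2 * (gaussConst n K ‖ξ‖ * weight K y), fun c hc => ?_⟩
  rw [contourInt, contourInt, ← integral_sub (h.integrable hξ _ _) (h.integrable hξ _ _),
    ← integral_mul_const]
  refine norm_integral_le_of_norm_le
    ((((integrable_weight K).const_mul _).const_mul _).mul_const _)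
    (Filter.Eventually.of_forall fun y => ?_)
  rw [kernel, kernel, ← sub_mul, ← sub_div]
  refine (norm_mul_exp_gaussDensity_le hK le_rfl (T := 2 / δ ^ 2 * ‖c‖ ^ (2 * m α))
    (by positivity) ?_).trans_eq (by ring)
  rw [norm_div, norm_pow, div_mul_eq_mul_div, div_mul_eq_mul_div]
  have hle : δ ≤ ‖Am 𝒜 m (contour ξ y)‖ := norm_Am_le_contour 𝒜 m ξ y
  exact div_le_div₀ (by positivity) (hb _ c hc) (by positivity) (by gcongr)

-- Along λ + cα with (λ, α) = 0, the function Q(λ)e^{(λ,μ)} is the integral times a factor even in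
-- c. Its odd part is therefore O(|c|^{2m_α}) like that of the integral, and its odd derivatives
-- below that order vanish.
open Filter Topology in
theorem IsModel.quasiInv_normInt (h : IsModel 𝒜 m φ F) {ξ : Fin n → ℝ} (hξ : ξ ∈ generic 𝒜)
    {mu : Fin n → ℂ} {Q : MvPolynomial (Fin n) ℂ}
    (hQ : ∀ lam, normInt 𝒜 m φ ξ mu lam = MvPolynomial.eval lam Q) {α : Fin n → ℝ}
    (hα : α ∈ 𝒜) : QuasiInv α (m α) (bilin mu (toComplex α)) Q := by
  intro l hl j hj
  have hl0 := mem_hyperplane_iff.1 hl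
  set lam := toComplex l
  set a := toComplex α
  obtain ⟨C, hC⟩ := h.exists_norm_contourInt_sub_le hξ hα hl0 mu
  set E : ℂ → ℂ := fun c => Complex.exp ((bilin lam lam + c ^ 2 * bilin a a + bilin mu mu) / 2)
    with hE
  set Φ : ℂ → ℂ := fun c =>
    (line lam a Q).eval c * Complex.exp (bilin lam mu + c * bilin mu a) with hΦ
  have hΦE : ∀ c, Φ c = E c * contourInt 𝒜 m φ ξ (lam + c • a) mu := by
    intro c
    rw [hΦ, hE]
    simp only
    rw [eval_line, ← hQ, normInt, mul_right_comm, ← Complex.exp_add]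
    congr 2
    simp only [bilin_add_left, bilin_add_right, bilin_smul_left, bilin_smul_right]
    rw [bilin_comm a lam, hl0, bilin_comm a mu]
    ring
  have hΦd : Differentiable ℂ Φ :=
    (Polynomial.differentiable _).fun_mul (by fun_prop)
  have hΦc : Continuous fun c => ‖E c‖ := by fun_prop
  have hd : Differentiable ℂ fun c => Φ c - Φ (-c) := hΦd.fun_sub (hΦd.comp differentiable_neg)
  have hbound : ∀ᶠ c in 𝓝 (0 : ℂ), ‖Φ c - Φ (-c)‖ ≤ (‖E 0‖ + 1) * C * ‖c‖ ^ (2 * m α) := by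
    filter_upwards [hΦc.continuousAt.eventually_lt_const (lt_add_one ‖E 0‖),
      Metric.ball_mem_nhds (0 : ℂ) one_pos] with c hc1 hc2
    have hE' : E (-c) = E c := by simp only [hE, neg_sq]
    rw [hΦE, hΦE, hE', ← mul_sub, norm_mul, mul_assoc]
    exact mul_le_mul hc1.le (hC c (mem_ball_zero_iff.1 hc2)) (norm_nonneg _) (by positivity)
  have h0 := iteratedDeriv_eq_zero_of_norm_le (hd.analyticAt 0) hbound
    (i := 2 * j + 1) (by omega)
  rw [iteratedDeriv_sub_comp_neg hΦd, iteratedDeriv_polynomial_mul_exp] at h0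
  refine ((mul_eq_zero.1 ((mul_eq_zero.1 h0).resolve_left ?_)).resolve_left (Complex.exp_ne_zero _))
  rw [Odd.neg_one_pow ⟨j, rfl⟩]
  norm_num

/-! ### The integral -/

/-- The normalised integral as a polynomial in λ, and the factor of φ(·, μ), satisfy the same
defining properties with spectral parameter μ. Uniqueness requires (μ, α) ≠ 0 for all α. -/
theorem IsModel.contourInt_of_ne_zero (h : IsModel 𝒜 m φ F) {ξ : Fin n → ℝ} (hξ : ξ ∈ generic 𝒜)
    (lam : Fin n → ℂ) {mu : Fin n → ℂ} (hmu : ∀ α ∈ 𝒜, bilin mu (toComplex α) ≠ 0) :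
    contourInt 𝒜 m φ ξ lam mu
      = Complex.exp (-(bilin lam lam + bilin mu mu) / 2) * φ lam mu := by
  obtain ⟨Q, hQ⟩ := h.exists_normInt_eq_eval hξ mu
  obtain ⟨hdeg, htop⟩ := homogeneousComponent_of_tendsto h.ne_zero (Q := Q)
    (T := MvPolynomial.C (Am 𝒜 m mu) * AmPoly 𝒜 m) (M := totalMult 𝒜 m) fun l hl => by
      rw [map_mul, MvPolynomial.eval_C, eval_AmPoly]
      simpa only [hQ] using h.tendsto_normInt hξ mu hl
  have hfac : IsFactor 𝒜 m mu Q := ⟨hdeg, htop, fun α hα => h.quasiInv_normInt hξ hQ hα⟩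
  have e := hQ lam
  rw [hfac.eq h.ne_zero h.linearIndependent hmu (h.factor mu), normInt] at e
  rw [h.eq, ← e, mul_right_comm, ← mul_assoc, ← mul_assoc, ← Complex.exp_add, ← Complex.exp_add]
  rw [show -(bilin lam lam + bilin mu mu) / 2 + ((bilin lam lam + bilin mu mu) / 2 - bilin lam mu)
    + bilin lam mu = 0 by ring, Complex.exp_zero, one_mul]

/-- Both sides are continuous in μ and agree on the dense set where no (μ, α) vanishes. -/
theorem IsModel.contourInt_eq_exp_mul (h : IsModel 𝒜 m φ F) {ξ : Fin n → ℝ} (hξ : ξ ∈ generic 𝒜)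
    (lam mu : Fin n → ℂ) :
    contourInt 𝒜 m φ ξ lam mu
      = Complex.exp (-(bilin lam lam + bilin mu mu) / 2) * φ lam mu := by
  have hr : Continuous fun mu =>
      Complex.exp (-(bilin lam lam + bilin mu mu) / 2) * φ lam mu := by
    have h1 : Continuous fun mu : Fin n → ℂ => bilin mu mu := by unfold bilin; fun_prop
    exact (by fun_prop : Continuous fun mu : Fin n → ℂ =>
      Complex.exp (-(bilin lam lam + bilin mu mu) / 2)).mul (h.differentiable_right lam).continuous
  refine congrFun (Continuous.ext_on (dense_eval_ne_zero (AmPoly_ne_zero h.ne_zero fun _ => 1))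
    (h.continuous_contourInt hξ lam) hr fun nu hnu => h.contourInt_of_ne_zero hξ lam fun α hα h0 =>
      hnu ?_) mu
  rw [eval_AmPoly, Am]
  exact Finset.prod_eq_zero hα (by rw [h0, pow_one])

end Model

end BakerAkhiezer

theorem mainTheorem1 (n : ℕ) (𝒜 : Finset (Fin n → ℝ)) (m : (Fin n → ℝ) → ℕ)
    (h_ne : ∀ α ∈ 𝒜, α ≠ 0)
    (h_noncollinear : ∀ α ∈ 𝒜, ∀ β ∈ 𝒜, α ≠ β → LinearIndependent ℝ ![α, β])
    (φ : (Fin n → ℂ) → (Fin n → ℂ) → ℂ)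
    (hφ : BakerAkhiezer.IsBakerAkhiezer 𝒜 m φ)
    (lam mu : Fin n → ℂ) (ξ : Fin n → ℝ)
    (hξ : ∀ α ∈ 𝒜, ξ ∉ BakerAkhiezer.hyperplane α) :
    Integrable (fun y : Fin n → ℝ =>
        BakerAkhiezer.integrand 𝒜 m φ lam mu (BakerAkhiezer.contour ξ y)) volume ∧
      ∫ y : Fin n → ℝ, BakerAkhiezer.integrand 𝒜 m φ lam mu (BakerAkhiezer.contour ξ y)
        = Complex.exp (-(BakerAkhiezer.bilin lam lam + BakerAkhiezer.bilin mu mu) / 2)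
          * φ lam mu := by
  obtain ⟨F, hF⟩ := hφ.exists_polynomial h_ne h_noncollinear
  have hmodel : BakerAkhiezer.IsModel 𝒜 m φ F :=
    ⟨h_ne, h_noncollinear, fun nu => (hF nu).1, fun x nu => (hF nu).2 x⟩
  have hgen : ξ ∈ BakerAkhiezer.generic 𝒜 := fun α hα h0 =>
    hξ α hα (BakerAkhiezer.mem_hyperplane_iff.2 h0)
  exact ⟨hmodel.integrable hgen lam mu, hmodel.contourInt_eq_exp_mul hgen lam mu⟩
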